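/- Let $n\ge 1$, $0<p,q<\infty$, and let $\phi$ be a normal function on $[0,1)$, i.e. a positive continuous function for which there are constants $b>a>0$ such that $\phi(r)/(1-r)^a$ is non-increasing on $[0,1)$ and tends to $0$ as $r\to1^-$, and $\phi(r)/(1-r)^b$ is non-decreasing on $[0,1)$ and tends to $\infty$ as $r\to 1^-$. Let $H(\mathbb B_n)$ be the space of holomorphic functions on the unit ball $\mathbb B_n$ of $\mathbb C^n$, let $\mathcal Rf(z)=\sum_{j=1}^n z_j\frac{\partial f}{\partial z_j}(z)$, and let $H(p,q,\phi)$ be the space of all $f\in H(\mathbb B_n)$ with $$\|f\|_{p,q,\phi}^p=\int_0^1 M_q(f,r)^p\,\frac{\phi(r)^p}{1-r}\,dr<\infty,\qquad M_q(f,r)=\Big(\int_{\partial\mathbb B_n}|f(r\zeta)|^q\,d\sigma(\zeta)\Big)^{1/q},$$ where $\sigma$ is the normalized surface measure on the unit sphere. For a weight $\mu$ (a positive continuous function on $[0,1)$) let $\mathcal Z_\mu$ be the space of all $f\in H(\mathbb B_n)$ with $\|f\|_{\mathcal Z_\mu}=|f(0)|+\sup_{z\in\mathbb B_n}\mu(|z|)|\mathcal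 R^2f(z)|<\infty$. For $g\in H(\mathbb B_n)$ let $$L_gf(z)=\int_0^1\mathcal Rf(tz)\,g(tz)\,\frac{dt}{t},$$ and let the essential norm of $L_g$ be $$\|L_g\|_{e}=\inf_K\ \sup_{\|f\|_{p,q,\phi}\le1}\|L_gf-Kf\|_{\mathcal Z_\mu},$$ the infimum being over all compact linear operators $K:H(p,q,\phi)\to\mathcal Z_\mu$. Then there is a constant $C>0$, depending only on $n,p,q,\phi$, such that for every weight $\mu$ and every $g\in H(\mathbb B_n)$ for which $L_g:H(p,q,\phi)\to\mathcal Z_\mu$ is bounded, $$C^{-1}M\le\|L_g\|_{e}\le C\,M,\qquad M=\max\Big\{\limsup_{|z|\to1}\frac{\mu(|z|)|g(z)|}{\phi(|z|)(1-|z|^2)^{2+n/q}},\ \limsup_{|z|\to1}\frac{\mu(|z|)|\mathcal Rg(z)|}{\phi(|z|)(1-|z|^2)^{1+n/q}}\Big\}.$$ -/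

import Mathlib

open MeasureTheory Set Filter Topology
open scoped ENNReal NNReal

noncomputable section

/-- The space `ℂⁿ` with its Euclidean norm. -/
abbrev Cn (n : ℕ) : Type := EuclideanSpace ℂ (Fin n)

/-- The open unit ball `𝔹ₙ` of `ℂⁿ`. -/
abbrev unitBall (n : ℕ) : Set (Cn n) := Metric.ball 0 1

/-- The space `H(𝔹ₙ)` of holomorphic functions on the unit ball. A function on the ball is
represented by its extension by zero to `ℂⁿ`, so that two elements are equal exactly when they
agree on the ball. -/
def holBall (n : ℕ) : Submodule ℂ (Cn n → ℂ) where
  carrier := {f | AnalyticOnNhd ℂ f (unitBall n) ∧ ∀ z ∉ unitBall n, f z = 0}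
  add_mem' := fun {f g} hf hg =>
    ⟨hf.1.add hg.1, fun z hz => by simp [hf.2 z hz, hg.2 z hz]⟩
  zero_mem' := ⟨analyticOnNhd_const, fun _ _ => rfl⟩
  smul_mem' := fun c f hf =>
    ⟨fun z hz => analyticAt_const.smul (hf.1 z hz), fun z hz => by simp [hf.2 z hz]⟩

theorem holBall_analytic {n : ℕ} {f : Cn n → ℂ} (hf : f ∈ holBall n) :
    AnalyticOnNhd ℂ f (unitBall n) := hf.1

/-- The radial derivative `ℛf(z) = ∑ⱼ zⱼ ∂f/∂zⱼ(z)`, that is, the complex derivative of `f` at `z`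
in the direction `z`. -/
def radialDeriv {n : ℕ} (f : Cn n → ℂ) (z : Cn n) : ℂ := fderiv ℂ f z z

theorem radialDeriv_eq_sum {n : ℕ} (f : Cn n → ℂ) (z : Cn n) :
    radialDeriv f z = ∑ j, z j * fderiv ℂ f z (EuclideanSpace.single j 1) := by
  have h : z = ∑ j, z j • (EuclideanSpace.single j (1 : ℂ) : Cn n) := by
    ext i
    simp [Finset.sum_apply, Pi.single_apply]
  unfold radialDeriv
  conv_lhs => arg 2; rw [h]
  simp only [map_sum, map_smul, smul_eq_mul]

/-- The Riemann-Stieltjes operator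
`L_g f(z) = ∫₀¹ ℛf(tz) g(tz) dt/t` for `z` in the unit ball (extended by zero). -/
def rsOperator {n : ℕ} (g f : Cn n → ℂ) : Cn n → ℂ :=
  (unitBall n).indicator fun z =>
    ∫ t in (0 : ℝ)..1, radialDeriv f ((t : ℂ) • z) * g ((t : ℂ) • z) / (t : ℂ)

/-- A weight: a positive continuous function on `[0,1)`. -/
structure IsWeight (μ : ℝ → ℝ) : Prop where
  continuousOn : ContinuousOn μ (Ico 0 1)
  pos : ∀ r ∈ Ico (0 : ℝ) 1, 0 < μ r

/-- A normal function on `[0,1)`. -/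
structure IsNormalFun (φ : ℝ → ℝ) : Prop where
  continuousOn : ContinuousOn φ (Ico 0 1)
  pos : ∀ r ∈ Ico (0 : ℝ) 1, 0 < φ r
  exists_exponents : ∃ a b : ℝ, 0 < a ∧ a < b ∧
    AntitoneOn (fun r => φ r / (1 - r) ^ a) (Ico 0 1) ∧
    Tendsto (fun r => φ r / (1 - r) ^ a) (𝓝[<] 1) (𝓝 0) ∧
    MonotoneOn (fun r => φ r / (1 - r) ^ b) (Ico 0 1) ∧
    Tendsto (fun r => φ r / (1 - r) ^ b) (𝓝[<] 1) atTop

/-- The surface measure on the unit sphere of `ℂⁿ`, normalized to total mass one. -/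
def sphereMeasure (n : ℕ) : Measure (Metric.sphere (0 : Cn n) 1) :=
  ((volume : Measure (Cn n)).toSphere univ)⁻¹ • (volume : Measure (Cn n)).toSphere

/-- The `q`-th power of the integral mean: `M_q(f,r)^q = ∫_{|ζ|=1} |f(rζ)|^q dσ(ζ)`. -/
def integralMeanPow {n : ℕ} (q : ℝ) (f : Cn n → ℂ) (r : ℝ) : ℝ≥0∞ :=
  ∫⁻ ζ : Metric.sphere (0 : Cn n) 1, ‖f ((r : ℂ) • (ζ : Cn n))‖ₑ ^ q ∂sphereMeasure n

/-- The integral mean `M_q(f,r)`. -/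
def integralMean {n : ℕ} (q : ℝ) (f : Cn n → ℂ) (r : ℝ) : ℝ≥0∞ :=
  integralMeanPow q f r ^ (1 / q)

/-- `‖f‖_{p,q,φ}^p = ∫₀¹ M_q(f,r)^p φ(r)^p / (1-r) dr`. -/
def mixedNormPow {n : ℕ} (p q : ℝ) (φ : ℝ → ℝ) (f : Cn n → ℂ) : ℝ≥0∞ :=
  ∫⁻ r in Ioo (0 : ℝ) 1, integralMean q f r ^ p * ENNReal.ofReal (φ r ^ p / (1 - r))

/-- The (quasi-)norm `‖f‖_{p,q,φ}`, with values in `[0,∞]`. -/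
def mixedNorm {n : ℕ} (p q : ℝ) (φ : ℝ → ℝ) (f : Cn n → ℂ) : ℝ≥0∞ :=
  mixedNormPow p q φ f ^ (1 / p)

theorem enn_add_rpow_le {s : ℝ} (hs : 0 < s) (x y : ℝ≥0∞) :
    (x + y) ^ s ≤ 2 ^ s * (x ^ s + y ^ s) := by
  have h : x + y ≤ 2 * max x y := by
    rw [two_mul]; exact add_le_add (le_max_left _ _) (le_max_right _ _)
  refine (ENNReal.rpow_le_rpow h hs.le).trans ?_
  rw [ENNReal.mul_rpow_of_nonneg _ _ hs.le]
  gcongr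
  rcases le_total x y with h' | h'
  · rw [max_eq_right h']; exact le_add_self
  · rw [max_eq_left h']; exact le_self_add

theorem smul_sphere_mem {n : ℕ} {r : ℝ} (hr : r ∈ Ioo (0 : ℝ) 1)
    (ζ : Metric.sphere (0 : Cn n) 1) : (r : ℂ) • (ζ : Cn n) ∈ unitBall n := by
  have h1 : ‖(ζ : Cn n)‖ = 1 := by simp
  rw [Metric.mem_ball, dist_zero_right, norm_smul, h1, mul_one, Complex.norm_real,
    Real.norm_of_nonneg hr.1.le]
  exact hr.2

instance sphereMeasure_sFinite (n : ℕ) : SFinite (sphereMeasure n) := by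
  unfold sphereMeasure; infer_instance

theorem measurable_slice {n : ℕ} {f : Cn n → ℂ} (hf : f ∈ holBall n) {r : ℝ}
    (hr : r ∈ Ioo (0 : ℝ) 1) :
    Measurable fun ζ : Metric.sphere (0 : Cn n) 1 => f ((r : ℂ) • (ζ : Cn n)) := by
  apply Continuous.measurable
  exact (holBall_analytic hf).continuousOn.comp_continuous (by fun_prop) (smul_sphere_mem hr)

theorem aemeasurable_integralMeanPow {n : ℕ} {f : Cn n → ℂ} (hf : f ∈ holBall n) (q : ℝ) :
    AEMeasurable (integralMeanPow q f) (volume.restrict (Ioo (0 : ℝ) 1)) := by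
  let F : ℝ × Metric.sphere (0 : Cn n) 1 → ℂ := fun x => f ((x.1 : ℂ) • (x.2 : Cn n))
  have hS : MeasurableSet (Ioo (0 : ℝ) 1 ×ˢ (univ : Set (Metric.sphere (0 : Cn n) 1))) :=
    measurableSet_Ioo.prod MeasurableSet.univ
  have hF : ContinuousOn F (Ioo (0 : ℝ) 1 ×ˢ univ) := by
    refine (holBall_analytic hf).continuousOn.comp (Continuous.continuousOn (by fun_prop)) ?_
    rintro ⟨r, ζ⟩ ⟨hr, -⟩
    exact smul_sphere_mem hr ζ
  have hFm : Measurable ((Ioo (0 : ℝ) 1 ×ˢ univ).indicator F) := by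
    refine measurable_of_restrict_of_restrict_compl hS ?_ ?_
    · have h : (Ioo (0 : ℝ) 1 ×ˢ univ).domRestrict ((Ioo (0 : ℝ) 1 ×ˢ univ).indicator F) =
          (Ioo (0 : ℝ) 1 ×ˢ univ).domRestrict F := by
        ext x
        exact indicator_of_mem x.2 F
      rw [h]
      exact hF.domRestrict.measurable
    · have h : (Ioo (0 : ℝ) 1 ×ˢ univ)ᶜ.domRestrict ((Ioo (0 : ℝ) 1 ×ˢ univ).indicator F) =
          fun _ => 0 := by
        ext x
        exact indicator_of_notMem x.2 F
      rw [h]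
      exact measurable_const
  have hm : Measurable fun r : ℝ => ∫⁻ ζ, ‖(Ioo (0 : ℝ) 1 ×ˢ univ).indicator F (r, ζ)‖ₑ ^ q
      ∂sphereMeasure n :=
    (hFm.enorm.pow_const q).lintegral_prod_right'
  refine ⟨_, hm, ?_⟩
  filter_upwards [ae_restrict_mem measurableSet_Ioo] with r hr
  simp only [integralMeanPow]
  refine lintegral_congr fun ζ => ?_
  rw [indicator_of_mem (show (r, ζ) ∈ Ioo (0 : ℝ) 1 ×ˢ univ from ⟨hr, mem_univ _⟩)]

theorem integralMeanPow_add_le {n : ℕ} {f g : Cn n → ℂ} (hf : f ∈ holBall n) {q : ℝ}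
    (hq : 0 < q) {r : ℝ} (hr : r ∈ Ioo (0 : ℝ) 1) :
    integralMeanPow q (f + g) r ≤ 2 ^ q * (integralMeanPow q f r + integralMeanPow q g r) := by
  simp only [integralMeanPow]
  rw [← lintegral_add_left ((measurable_slice hf hr).enorm.pow_const q),
    ← lintegral_const_mul' _ _ (ENNReal.rpow_ne_top_of_nonneg hq.le (by simp))]
  refine lintegral_mono fun ζ => ?_
  refine (ENNReal.rpow_le_rpow (enorm_add_le _ _) hq.le).trans ?_
  exact enn_add_rpow_le hq _ _

theorem mixedNormPow_add_lt_top {n : ℕ} {p q : ℝ} (hp : 0 < p) (hq : 0 < q) {φ : ℝ → ℝ}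
    (hφ : IsNormalFun φ) {f g : Cn n → ℂ} (hf : f ∈ holBall n)
    (hf' : mixedNormPow p q φ f < ∞) (hg' : mixedNormPow p q φ g < ∞) :
    mixedNormPow p q φ (f + g) < ∞ := by
  have hs : 0 < 1 / q * p := by positivity
  let C : ℝ≥0∞ := (2 ^ q) ^ (1 / q * p) * 2 ^ (1 / q * p)
  have hC : C ≠ ∞ := by
    refine ENNReal.mul_ne_top (ENNReal.rpow_ne_top_of_nonneg hs.le ?_)
      (ENNReal.rpow_ne_top_of_nonneg hs.le (by simp))
    exact ENNReal.rpow_ne_top_of_nonneg hq.le (by simp)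
  have hw : AEMeasurable (fun r => ENNReal.ofReal (φ r ^ p / (1 - r)))
      (volume.restrict (Ioo (0 : ℝ) 1)) := by
    refine AEMeasurable.ennreal_ofReal (ContinuousOn.aemeasurable ?_ measurableSet_Ioo)
    refine ContinuousOn.div ?_ (by fun_prop) fun r hr => (sub_pos.2 hr.2).ne'
    exact (hφ.continuousOn.mono Ioo_subset_Ico_self).rpow_const
      fun r hr => Or.inl (hφ.pos r ⟨hr.1.le, hr.2⟩).ne'
  have hF : AEMeasurable
      (fun r => integralMean q f r ^ p * ENNReal.ofReal (φ r ^ p / (1 - r)))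
      (volume.restrict (Ioo (0 : ℝ) 1)) :=
    (((aemeasurable_integralMeanPow hf q).pow_const _).pow_const _).mul hw
  have hle : mixedNormPow p q φ (f + g) ≤ C * (mixedNormPow p q φ f + mixedNormPow p q φ g) := by
    simp only [mixedNormPow]
    rw [← lintegral_add_left' hF, ← lintegral_const_mul' _ _ hC]
    refine setLIntegral_mono' measurableSet_Ioo fun r hr => ?_
    rw [← add_mul, ← mul_assoc]
    gcongr
    simp only [integralMean, ← ENNReal.rpow_mul]
    refine (ENNReal.rpow_le_rpow (integralMeanPow_add_le hf hq hr) hs.le).trans ?_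
    rw [ENNReal.mul_rpow_of_nonneg _ _ hs.le, mul_assoc]
    gcongr
    exact enn_add_rpow_le hs _ _
  exact hle.trans_lt (ENNReal.mul_lt_top hC.lt_top (ENNReal.add_lt_top.2 ⟨hf', hg'⟩))

theorem mixedNormPow_smul {n : ℕ} {p q : ℝ} (hp : 0 < p) (hq : 0 < q) (φ : ℝ → ℝ)
    (c : ℂ) (f : Cn n → ℂ) :
    mixedNormPow p q φ (c • f) = ‖c‖ₑ ^ p * mixedNormPow p q φ f := by
  have h1 : ∀ r, integralMean q (c • f) r = ‖c‖ₑ * integralMean q f r := by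
    intro r
    have h2 : integralMeanPow q (c • f) r = ‖c‖ₑ ^ q * integralMeanPow q f r := by
      simp only [integralMeanPow]
      rw [← lintegral_const_mul' _ _ (ENNReal.rpow_ne_top_of_nonneg hq.le (by simp))]
      refine lintegral_congr fun ζ => ?_
      rw [Pi.smul_apply, smul_eq_mul, enorm_mul, ENNReal.mul_rpow_of_nonneg _ _ hq.le]
    simp only [integralMean]
    rw [h2, ENNReal.mul_rpow_of_nonneg _ _ (by positivity), ← ENNReal.rpow_mul,
      mul_one_div_cancel hq.ne', ENNReal.rpow_one]
  simp only [mixedNormPow]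
  rw [← lintegral_const_mul' _ _ (ENNReal.rpow_ne_top_of_nonneg hp.le (by simp))]
  refine lintegral_congr fun r => ?_
  rw [h1, ENNReal.mul_rpow_of_nonneg _ _ hp.le, mul_assoc]

/-- The mixed-norm space `H(p,q,φ)` of all holomorphic `f` on the ball with
`‖f‖_{p,q,φ} < ∞`. -/
def mixedNormSpace (n : ℕ) {p q : ℝ} (hp : 0 < p) (hq : 0 < q) {φ : ℝ → ℝ}
    (hφ : IsNormalFun φ) : Submodule ℂ (Cn n → ℂ) where
  carrier := {f | f ∈ holBall n ∧ mixedNormPow p q φ f < ∞}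
  add_mem' := fun hf hg =>
    ⟨add_mem hf.1 hg.1, mixedNormPow_add_lt_top hp hq hφ hf.1 hf.2 hg.2⟩
  zero_mem' := by
    refine ⟨zero_mem _, ?_⟩
    have h := mixedNormPow_smul hp hq φ (0 : ℂ) (0 : Cn n → ℂ)
    rw [zero_smul] at h
    rw [h]
    simp [ENNReal.zero_rpow_of_pos hp]
  smul_mem' := fun c f hf => by
    refine ⟨Submodule.smul_mem _ c hf.1, ?_⟩
    rw [mixedNormPow_smul hp hq]
    exact ENNReal.mul_lt_top (ENNReal.rpow_lt_top_of_nonneg hp.le (by simp)) hf.2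

/-- The norm `‖f‖_{𝒵_μ} = |f(0)| + sup_{z ∈ 𝔹ₙ} μ(|z|) |ℛ²f(z)|`, with values in `[0,∞]`. -/
def zygmundNorm {n : ℕ} (μ : ℝ → ℝ) (f : Cn n → ℂ) : ℝ≥0∞ :=
  ‖f 0‖ₑ + ⨆ z ∈ unitBall n, ENNReal.ofReal (μ ‖z‖) * ‖radialDeriv (radialDeriv f) z‖ₑ

theorem radialDeriv_analytic {n : ℕ} {f : Cn n → ℂ} (hf : AnalyticOnNhd ℂ f (unitBall n)) :
    AnalyticOnNhd ℂ (radialDeriv f) (unitBall n) := fun z hz =>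
  (ContinuousLinearMap.apply ℂ ℂ : Cn n →L[ℂ] (Cn n →L[ℂ] ℂ) →L[ℂ] ℂ).analyticAt_bilinear
    (z, fderiv ℂ f z) |>.comp₂ analyticAt_id (hf.fderiv z hz)

theorem radialDeriv_add {n : ℕ} {f g : Cn n → ℂ} (hf : AnalyticOnNhd ℂ f (unitBall n))
    (hg : AnalyticOnNhd ℂ g (unitBall n)) {z : Cn n} (hz : z ∈ unitBall n) :
    radialDeriv (f + g) z = radialDeriv f z + radialDeriv g z := by
  simp only [radialDeriv]
  rw [fderiv_add (hf z hz).differentiableAt (hg z hz).differentiableAt]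
  rfl

theorem radialDeriv_smul {n : ℕ} (c : ℂ) (f : Cn n → ℂ) :
    radialDeriv (c • f) = c • radialDeriv f := by
  ext z
  simp only [radialDeriv, Pi.smul_apply]
  rw [fderiv_const_smul_field]
  rfl

theorem radialDeriv_congr {n : ℕ} {f g : Cn n → ℂ} (h : EqOn f g (unitBall n)) {z : Cn n}
    (hz : z ∈ unitBall n) : radialDeriv f z = radialDeriv g z := by
  simp only [radialDeriv]
  rw [(h.eventuallyEq_of_mem (Metric.isOpen_ball.mem_nhds hz)).fderiv_eq]

theorem zygmundNorm_add_le {n : ℕ} (μ : ℝ → ℝ) {f g : Cn n → ℂ}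
    (hf : AnalyticOnNhd ℂ f (unitBall n)) (hg : AnalyticOnNhd ℂ g (unitBall n)) :
    zygmundNorm μ (f + g) ≤ zygmundNorm μ f + zygmundNorm μ g := by
  simp only [zygmundNorm]
  rw [add_add_add_comm]
  refine add_le_add (enorm_add_le _ _) (iSup₂_le fun z hz => ?_)
  rw [radialDeriv_congr (fun w hw => radialDeriv_add hf hg hw) hz,
    show (fun w => radialDeriv f w + radialDeriv g w) = radialDeriv f + radialDeriv g from rfl,
    radialDeriv_add (radialDeriv_analytic hf) (radialDeriv_analytic hg) hz]
  refine (mul_le_mul_right (enorm_add_le _ _) _).trans ?_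
  rw [mul_add]
  exact add_le_add
    (le_iSup₂ (f := fun z (_ : z ∈ unitBall n) =>
      ENNReal.ofReal (μ ‖z‖) * ‖radialDeriv (radialDeriv f) z‖ₑ) z hz)
    (le_iSup₂ (f := fun z (_ : z ∈ unitBall n) =>
      ENNReal.ofReal (μ ‖z‖) * ‖radialDeriv (radialDeriv g) z‖ₑ) z hz)

theorem zygmundNorm_smul {n : ℕ} (μ : ℝ → ℝ) (c : ℂ) (f : Cn n → ℂ) :
    zygmundNorm μ (c • f) = ‖c‖ₑ * zygmundNorm μ f := by
  simp only [zygmundNorm, radialDeriv_smul, Pi.smul_apply, smul_eq_mul, enorm_mul, mul_add,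
    ENNReal.mul_iSup, mul_left_comm]

/-- The Zygmund-type space `𝒵_μ` of all holomorphic `f` on the ball with `‖f‖_{𝒵_μ} < ∞`. -/
def zygmundSpace (n : ℕ) (μ : ℝ → ℝ) : Submodule ℂ (Cn n → ℂ) where
  carrier := {f | f ∈ holBall n ∧ zygmundNorm μ f < ∞}
  add_mem' := fun hf hg => ⟨add_mem hf.1 hg.1,
    (zygmundNorm_add_le μ (holBall_analytic hf.1) (holBall_analytic hg.1)).trans_lt (ENNReal.add_lt_top.2 ⟨hf.2, hg.2⟩)⟩
  zero_mem' := by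
    refine ⟨zero_mem _, ?_⟩
    have h := zygmundNorm_smul μ (0 : ℂ) (0 : Cn n → ℂ)
    rw [zero_smul] at h
    rw [h]
    simp
  smul_mem' := fun c f hf => by
    refine ⟨Submodule.smul_mem _ c hf.1, ?_⟩
    rw [zygmundNorm_smul]
    exact ENNReal.mul_lt_top (by simp) hf.2

section Operators

variable {n : ℕ} {p q : ℝ} (hp : 0 < p) (hq : 0 < q) {φ : ℝ → ℝ} (hφ : IsNormalFun φ) (μ : ℝ → ℝ)

/-- `T : H(p,q,φ) → 𝒵_μ` is bounded: `T` maps `H(p,q,φ)` into `𝒵_μ`, and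
`‖T f‖_{𝒵_μ} ≤ C ‖f‖_{p,q,φ}` for a finite constant `C`. -/
def IsBoundedOp (T : (Cn n → ℂ) → (Cn n → ℂ)) : Prop :=
  (∀ f ∈ mixedNormSpace n hp hq hφ, T f ∈ zygmundSpace n μ) ∧
    ∃ C : ℝ≥0, ∀ f ∈ mixedNormSpace n hp hq hφ,
      zygmundNorm μ (T f) ≤ C * mixedNorm p q φ f

/-- A linear operator `K : H(p,q,φ) → 𝒵_μ` is compact: the image of every bounded sequence has a
subsequence that converges in `𝒵_μ`. -/
def IsCompactOp (K : mixedNormSpace n hp hq hφ →ₗ[ℂ] zygmundSpace n μ) : Prop :=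
  ∀ f : ℕ → mixedNormSpace n hp hq hφ,
    (∃ M : ℝ≥0, ∀ k, mixedNorm p q φ (f k : Cn n → ℂ) ≤ M) →
    ∃ (h : zygmundSpace n μ) (s : ℕ → ℕ), StrictMono s ∧
      Tendsto (fun k => zygmundNorm μ ((K (f (s k)) : Cn n → ℂ) - (h : Cn n → ℂ))) atTop (𝓝 0)

/-- The essential norm of `T : H(p,q,φ) → 𝒵_μ`: the infimum, over all compact linear operators
`K : H(p,q,φ) → 𝒵_μ`, of the operator norm
`‖T - K‖ = sup {‖T f - K f‖_{𝒵_μ} : ‖f‖_{p,q,φ} ≤ 1}`. -/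
def essNorm (T : (Cn n → ℂ) → (Cn n → ℂ)) : ℝ≥0∞ :=
  ⨅ (K : mixedNormSpace n hp hq hφ →ₗ[ℂ] zygmundSpace n μ) (_ : IsCompactOp hp hq hφ μ K),
    ⨆ (f : mixedNormSpace n hp hq hφ) (_ : mixedNorm p q φ (f : Cn n → ℂ) ≤ 1),
      zygmundNorm μ (T f - (K f : Cn n → ℂ))

end Operators

/-- `limsup_{|z| → 1} F(z)`, where `z` ranges over the unit ball. -/
def limsupBoundary {n : ℕ} (F : Cn n → ℝ) : ℝ≥0∞ :=
  limsup (fun z => ENNReal.ofReal (F z)) (comap (fun z : Cn n => ‖z‖) (𝓝[<] 1))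

end

/-! ### Sub-mean value inequality for powers of moduli in one variable. -/

noncomputable section

/-! Differentiating along rays gives ℛ(L_g f) = g ℛf, hence ℛ²(L_g f) = g ℛ²f + ℛf ℛg, while L_g
f(0) = 0 (`radialDeriv_radialDeriv_rsOperator`). The norm of L_g f is therefore the supremum of μ |g
ℛ²f + ℛf ℛg|, and everything depends on the size of ℛf and ℛ²f for f in the unit ball of H(p,q,φ).
Such f satisfy |f(z)| ≤ C / (φ(|z|)(1-|z|)^{n/q}) (`exists_enorm_le_mixedNorm`): |f|^q is averaged
over an ellipsoid of volume comparable to (1-|z|)^{n+1}, and integral means increase with the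
radius. By Cauchy's estimate each radial derivative costs one factor 1-|z|
(`norm_radialDeriv_le_of_growth`).

Upper bound (`exists_essNorm_le`). The compact competitor is f ↦ L_g P_f, where P_f is a Taylor
polynomial of a dilation of f; it has finite rank. The difference f - P_f obeys the growth bound of
f up to a factor 3 and is as small as desired on a prescribed compact set. The compact part is then
negligible, and near the boundary the two quotients in M are below any m > M, which yields a
constant times m.

Lower bound (`limsupBoundary_le_mul_essNorm`). For w near the boundary, a power of 1 - ⟨w,z⟩ times a
quadratic polynomial in ⟨w,z⟩ that vanishes at z = w has norm bounded independently of w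
(`exists_test_function`). Its two coefficients can be chosen so that ℛf(w) = 0, which isolates g(w),
or so that ℛ²f(w) = 0, which isolates ℛg(w). Given a compact K and points z_k tending to the
boundary, pass to a subsequence along which K f_k converges and evaluate L_g(f_k - f_j) at z_k. The
part K(f_k - f_j) is small, the rest is bounded by a constant times ‖L_g - K‖, and L_g f_j
contributes nothing as k → ∞: f_j is bounded and φ tends to 0. Working with differences avoids any
discussion of weak convergence. -/

theorem log_norm_le_circleAverage {F : ℂ → ℂ} {c : ℂ} {R : ℝ} (hR : 0 < R)
    (hF : AnalyticOnNhd ℂ F (Metric.closedBall c R)) (h0 : F c ≠ 0) :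
    Real.log ‖F c‖ ≤ Real.circleAverage (fun z => Real.log ‖F z‖) c R := by
  have hF' : AnalyticOnNhd ℂ F (Metric.closedBall c |R|) := by rwa [abs_of_pos hR]
  -- Jensen's formula: the average exceeds log |F c| by the sum over the zeros u of their
  -- multiplicity times log (R / |c - u|), and no term is negative. The index u = c is harmless, as
  -- log 0 = 0.
  rw [AnalyticOnNhd.circleAverage_log_norm hR.ne' hF' h0]
  refine le_add_of_nonneg_left (finsum_nonneg fun u => ?_)
  by_cases hu : u ∈ Metric.closedBall c |R|
  · refine mul_nonneg ?_ ?_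
    · have := MeromorphicOn.AnalyticOnNhd.divisor_nonneg hF'
      exact_mod_cast this u
    · rcases eq_or_ne u c with rfl | huc
      · simp
      · apply Real.log_nonneg
        have h1 : 0 < ‖c - u‖ := norm_pos_iff.2 (sub_ne_zero.2 huc.symm)
        rw [← div_eq_mul_inv, le_div_iff₀ h1, one_mul]
        rw [abs_of_pos hR, Metric.mem_closedBall, dist_comm, dist_eq_norm] at hu
        exact hu
  · simp [hu]

/-- The `q`-th power of the modulus of a holomorphic function has the sub-mean value property. -/
theorem norm_rpow_le_circleAverage {F : ℂ → ℂ} {c : ℂ} {R : ℝ} (hR : 0 < R) {q : ℝ} (hq : 0 < q)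
    (hF : AnalyticOnNhd ℂ F (Metric.closedBall c R)) :
    ‖F c‖ ^ q ≤ Real.circleAverage (fun z => ‖F z‖ ^ q) c R := by
  have hcont : ContinuousOn F (Metric.sphere c |R|) := by
    rw [abs_of_pos hR]; exact hF.continuousOn.mono Metric.sphere_subset_closedBall
  by_cases h0 : F c = 0
  · rw [h0, norm_zero, Real.zero_rpow hq.ne']
    refine Real.circleAverage_nonneg_of_nonneg fun z _ => by positivity
  have hn : 0 < ‖F c‖ := norm_pos_iff.2 h0
  -- The tangent line e·x ≤ exp x touches at x = 1. With this scaling q log |G c| = 1, so the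
  -- tangent line is sharp at the centre and replaces Jensen's inequality for the exponential.
  set κ : ℝ := Real.exp (1 / q) / ‖F c‖ with hκ
  have hκ0 : 0 < κ := by positivity
  set G : ℂ → ℂ := fun z => (κ : ℂ) * F z with hG
  have hGa : AnalyticOnNhd ℂ G (Metric.closedBall c R) := fun z hz =>
    analyticAt_const.mul (hF z hz)
  have hnG : ∀ z, ‖G z‖ = κ * ‖F z‖ := fun z => by
    simp [hG, abs_of_pos hκ0]
  have hGc : ‖G c‖ = Real.exp (1 / q) := by rw [hnG, hκ]; field_simp
  have hGc0 : G c ≠ 0 := by rw [← norm_pos_iff, hGc]; positivity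
  have hlog := log_norm_le_circleAverage hR hGa hGc0
  rw [hGc, Real.log_exp] at hlog
  have hint1 : CircleIntegrable (fun z => Real.exp 1 * (q * Real.log ‖G z‖)) c R := by
    have : CircleIntegrable (fun z => Real.log ‖G z‖) c R := by
      refine MeromorphicOn.circleIntegrable_log_norm (AnalyticOnNhd.meromorphicOn ?_)
      rw [abs_of_pos hR]; exact hGa.mono Metric.sphere_subset_closedBall
    exact (IntervalIntegrable.const_mul this q).const_mul (Real.exp 1)
  have hint2 : CircleIntegrable (fun z => κ ^ q * ‖F z‖ ^ q) c R := by
    refine ContinuousOn.circleIntegrable' ?_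
    exact continuousOn_const.mul (hcont.norm.rpow_const fun _ _ => Or.inr hq.le)
  have key := Real.circleAverage_mono hint1 hint2 (fun z _ => by
    rw [← Real.mul_rpow hκ0.le (norm_nonneg _), ← hnG]
    -- At a zero of G both sides are 0, because log 0 = 0.
    rcases eq_or_lt_of_le (norm_nonneg (G z)) with h | h
    · rw [← h]; simp [Real.zero_rpow hq.ne']
    · rw [Real.rpow_def_of_pos h, mul_comm q]
      have h1 := Real.add_one_le_exp (Real.log ‖G z‖ * q - 1)
      calc Real.exp 1 * (Real.log ‖G z‖ * q)
          ≤ Real.exp 1 * Real.exp (Real.log ‖G z‖ * q - 1) := by gcongr; linarith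
        _ = _ := by rw [← Real.exp_add]; congr 1; ring)
  have e1 : Real.circleAverage (fun z => Real.exp 1 * (q * Real.log ‖G z‖)) c R
      = Real.exp 1 * (q * Real.circleAverage (fun z => Real.log ‖G z‖) c R) := by
    simp only [← smul_eq_mul]
    rw [Real.circleAverage_fun_smul, Real.circleAverage_fun_smul]
  have e2 : Real.circleAverage (fun z => κ ^ q * ‖F z‖ ^ q) c R
      = κ ^ q * Real.circleAverage (fun z => ‖F z‖ ^ q) c R := by
    simp only [← smul_eq_mul]
    rw [Real.circleAverage_fun_smul]
  rw [e1, e2] at key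
  have h3 : κ ^ q * ‖F c‖ ^ q = Real.exp 1 := by
    rw [← Real.mul_rpow hκ0.le (norm_nonneg _), ← hnG, hGc, ← Real.exp_mul]
    congr 1; field_simp
  have h4 : κ ^ q * ‖F c‖ ^ q ≤ κ ^ q * Real.circleAverage (fun z => ‖F z‖ ^ q) c R := by
    rw [h3]
    refine le_trans ?_ key
    have : 1 ≤ q * Real.circleAverage (fun z => Real.log ‖G z‖) c R := by
      rw [div_le_iff₀ hq] at hlog; linarith
    nlinarith [Real.exp_pos 1]
  exact le_of_mul_le_mul_left h4 (by positivity)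

/-! ### Circle invariance of the surface measure. -/

section Rotation

variable {n : ℕ}

/-- Multiplication by a unimodular scalar, as a map of the unit sphere. -/
def sphereRotate (u : Circle) (ζ : Metric.sphere (0 : Cn n) 1) : Metric.sphere (0 : Cn n) 1 :=
  ⟨(u : ℂ) • (ζ : Cn n), by simp [norm_smul, Circle.norm_coe]⟩

theorem continuous_sphereRotate (u : Circle) : Continuous (sphereRotate (n := n) u) := by
  unfold sphereRotate
  fun_prop

/-- Multiplication by a unimodular scalar as a real isometry. -/
def rotateIsometry (n : ℕ) (u : Circle) : Cn n ≃ₗᵢ[ℝ] Cn n where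
  toFun z := (u : ℂ) • z
  invFun z := ((u⁻¹ : Circle) : ℂ) • z
  map_add' := smul_add _
  map_smul' c z := smul_comm _ _ _
  left_inv z := by simp [smul_smul]
  right_inv z := by simp [smul_smul]
  norm_map' z := by simp [norm_smul, Circle.norm_coe]

theorem rotateIsometry_apply (u : Circle) (z : Cn n) : rotateIsometry n u z = (u : ℂ) • z := rfl

-- The surface measure of a set is a multiple of the volume of the cone over it; a unimodular scalar
-- commutes with taking cones and preserves volume, being a linear isometry.
open scoped Pointwise in
theorem measurePreserving_sphereRotate (u : Circle) :
    MeasurePreserving (sphereRotate (n := n) u) (sphereMeasure n) (sphereMeasure n) := by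
  refine ⟨(continuous_sphereRotate u).measurable, ?_⟩
  have h : Measure.map (sphereRotate (n := n) u) (volume : Measure (Cn n)).toSphere =
      (volume : Measure (Cn n)).toSphere := by
    ext s hs
    rw [Measure.map_apply (continuous_sphereRotate u).measurable hs,
      Measure.toSphere_apply' _ hs,
      Measure.toSphere_apply' _ ((continuous_sphereRotate u).measurable hs)]
    congr 1
    have hmp := (LinearIsometryEquiv.measurePreserving (rotateIsometry n u)).measure_preimage_equiv
      (f := (rotateIsometry n u).toMeasurableEquiv) (Ioo (0 : ℝ) 1 • (Subtype.val '' s))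
    rw [← hmp]
    congr 1
    ext z
    rw [mem_preimage, LinearIsometryEquiv.coe_toMeasurableEquiv, rotateIsometry_apply]
    constructor
    · rintro ⟨r, hr, _, ⟨ζ, hζ, rfl⟩, rfl⟩
      exact ⟨r, hr, _, ⟨_, hζ, rfl⟩, smul_comm _ _ _⟩
    · rintro ⟨r, hr, _, ⟨ζ, hζ, rfl⟩, h⟩
      refine ⟨r, hr, _, ⟨sphereRotate u⁻¹ ζ, ?_, rfl⟩, ?_⟩
      · have he : sphereRotate u (sphereRotate u⁻¹ ζ) = ζ :=
          Subtype.ext (by simp [sphereRotate, smul_smul])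
        rwa [mem_preimage, he]
      · change r • (((u⁻¹ : Circle) : ℂ) • (ζ : Cn n)) = z
        change r • (ζ : Cn n) = _ at h
        rw [smul_comm, h, smul_smul]; simp
  unfold sphereMeasure
  rw [Measure.map_smul, h]

end Rotation

/-! ### Integral means increase with the radius. -/

section Means

variable {n : ℕ}

instance sphereMeasure_isFinite (n : ℕ) : IsFiniteMeasure (sphereMeasure n) := by
  unfold sphereMeasure
  -- If the surface measure vanishes, as for n = 0, the normalizing factor is ∞, but its product
  -- with the zero measure is still zero.
  by_cases h : (volume : Measure (Cn n)).toSphere = 0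
  · rw [h]; simp only [smul_zero]; infer_instance
  · refine Measure.smul_finite _ ?_
    exact ENNReal.inv_ne_top.2 (by rwa [Ne, Measure.measure_univ_eq_zero])

/-- The `q`-th power mean of `|f|` over the sphere of radius `|w|`. -/
def sphereMean (q : ℝ) (f : Cn n → ℂ) (w : ℂ) : ℝ :=
  ∫ ζ : Metric.sphere (0 : Cn n) 1, ‖f (w • (ζ : Cn n))‖ ^ q ∂sphereMeasure n

theorem smul_sphere_mem_unitBall {w : ℂ} (hw : ‖w‖ < 1) (ζ : Metric.sphere (0 : Cn n) 1) :
    w • (ζ : Cn n) ∈ unitBall n := by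
  have h1 : ‖(ζ : Cn n)‖ = 1 := by simp
  rwa [Metric.mem_ball, dist_zero_right, norm_smul, h1, mul_one]

/-- Write w = |w| e^{iθ} and absorb e^{iθ} into the rotation-invariant measure. The mean is thus a
radial function on the disc, to which a maximum principle applies. -/
theorem sphereMean_norm (q : ℝ) (f : Cn n → ℂ) (w : ℂ) :
    sphereMean q f w = sphereMean q f (‖w‖ : ℂ) := by
  have hmp := measurePreserving_sphereRotate (n := n) (Circle.exp w.arg)
  have hme : MeasurableEmbedding (sphereRotate (n := n) (Circle.exp w.arg)) := by
    refine (continuous_sphereRotate _).measurableEmbedding fun x y hxy => ?_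
    have := congrArg Subtype.val hxy
    exact Subtype.ext (smul_right_injective _ (Circle.coe_ne_zero _) this)
  have h := hmp.integral_comp hme
    (fun ζ : Metric.sphere (0 : Cn n) 1 => ‖f ((‖w‖ : ℂ) • (ζ : Cn n))‖ ^ q)
  unfold sphereMean
  rw [← h]
  congr 1
  ext ζ
  simp only [sphereRotate, smul_smul]
  rw [Circle.coe_exp, Complex.norm_mul_exp_arg_mul_I]

theorem exists_norm_le_of_norm_le {f : Cn n → ℂ} (hf : AnalyticOnNhd ℂ f (unitBall n)) {r : ℝ}
    (hr : r < 1) : ∃ B, 0 ≤ B ∧ ∀ z : Cn n, ‖z‖ ≤ r → ‖f z‖ ≤ B := by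
  have hsub : Metric.closedBall (0 : Cn n) r ⊆ unitBall n := Metric.closedBall_subset_ball hr
  obtain ⟨B, hB⟩ := (isCompact_closedBall (0 : Cn n) r).exists_bound_of_continuousOn
    (hf.continuousOn.mono hsub)
  exact ⟨max B 0, le_max_right _ _, fun z hz => (hB z (by simpa using hz)).trans (le_max_left _ _)⟩

theorem continuous_sphereMean_comp {f : Cn n → ℂ} (hf : AnalyticOnNhd ℂ f (unitBall n)) {q : ℝ}
    (hq : 0 < q) {w : ℝ → ℂ} (hw : Continuous w) {r : ℝ} (hr : r < 1) (hwr : ∀ x, ‖w x‖ ≤ r) :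
    Continuous fun x => sphereMean q f (w x) := by
  obtain ⟨B, hB0, hB⟩ := exists_norm_le_of_norm_le hf hr
  have hj : Continuous fun x : ℝ × Metric.sphere (0 : Cn n) 1 =>
      ‖f (w x.1 • (x.2 : Cn n))‖ ^ q :=
    (hf.continuousOn.comp_continuous (by fun_prop)
      (fun x => smul_sphere_mem_unitBall ((hwr _).trans_lt hr) _)).norm.rpow_const
      fun _ => Or.inr hq.le
  refine continuous_of_dominated (bound := fun _ => B ^ q) (fun x => ?_) (fun x => ?_)
    (integrable_const _) ?_
  · exact (hj.comp (Continuous.prodMk_right x)).aestronglyMeasurable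
  · refine Eventually.of_forall fun ζ => ?_
    rw [Real.norm_of_nonneg (by positivity)]
    refine Real.rpow_le_rpow (norm_nonneg _) (hB _ ?_) hq.le
    simpa [norm_smul] using hwr x
  · exact Eventually.of_forall fun ζ => hj.comp (Continuous.prodMk_left ζ)

theorem analyticOnNhd_slice {f : Cn n → ℂ} (hf : AnalyticOnNhd ℂ f (unitBall n)) (z : Cn n)
    {s : Set ℂ} (hs : ∀ w ∈ s, w • z ∈ unitBall n) :
    AnalyticOnNhd ℂ (fun w : ℂ => f (w • z)) s := fun w hw =>
  (hf _ (hs w hw)).comp_of_eq (analyticAt_id.smul analyticAt_const) rfl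

/-- The one-variable inequality on each slice x ↦ f(xζ), integrated over ζ with Fubini. -/
theorem sphereMean_le_circleAverage {f : Cn n → ℂ} (hf : AnalyticOnNhd ℂ f (unitBall n)) {q : ℝ}
    (hq : 0 < q) {w : ℂ} {R : ℝ} (hR : 0 < R) (hwR : ‖w‖ + R < 1) :
    sphereMean q f w ≤ Real.circleAverage (sphereMean q f) w R := by
  have hle : ∀ x ∈ Metric.closedBall w R, ‖x‖ ≤ ‖w‖ + R := fun x hx => by
    have := norm_le_norm_add_norm_sub' x w
    rw [Metric.mem_closedBall, dist_eq_norm] at hx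
    linarith
  have hcm : ∀ θ, ‖circleMap w R θ‖ ≤ ‖w‖ + R := fun θ =>
    hle _ (Metric.sphere_subset_closedBall (circleMap_mem_sphere _ hR.le _))
  obtain ⟨B, hB0, hB⟩ := exists_norm_le_of_norm_le hf hwR
  have hj : Continuous fun x : ℝ × Metric.sphere (0 : Cn n) 1 =>
      ‖f (circleMap w R x.1 • (x.2 : Cn n))‖ ^ q :=
    (hf.continuousOn.comp_continuous (by fun_prop)
      (fun x => smul_sphere_mem_unitBall ((hcm _).trans_lt hwR) _)).norm.rpow_const
      fun _ => Or.inr hq.le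
  have hjb : ∀ x : ℝ × Metric.sphere (0 : Cn n) 1,
      ‖‖f (circleMap w R x.1 • (x.2 : Cn n))‖ ^ q‖ ≤ B ^ q := fun x => by
    rw [Real.norm_of_nonneg (by positivity)]
    refine Real.rpow_le_rpow (norm_nonneg _) (hB _ ?_) hq.le
    simpa [norm_smul] using hcm x.1
  have hint : Integrable (fun x : ℝ × Metric.sphere (0 : Cn n) 1 =>
      ‖f (circleMap w R x.1 • (x.2 : Cn n))‖ ^ q)
      ((volume.restrict (Ioc 0 (2 * Real.pi))).prod (sphereMeasure n)) :=
    Integrable.of_bound hj.aestronglyMeasurable (B ^ q) (Eventually.of_forall hjb)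
  have hpt : ∀ ζ : Metric.sphere (0 : Cn n) 1, ‖f (w • (ζ : Cn n))‖ ^ q ≤
      (2 * Real.pi)⁻¹ * ∫ θ in Ioc 0 (2 * Real.pi), ‖f (circleMap w R θ • (ζ : Cn n))‖ ^ q := by
    intro ζ
    have h := norm_rpow_le_circleAverage hR hq (F := fun x : ℂ => f (x • (ζ : Cn n))) (c := w)
      (analyticOnNhd_slice hf _ fun x hx => smul_sphere_mem_unitBall ((hle x hx).trans_lt hwR) ζ)
    rwa [Real.circleAverage, intervalIntegral.integral_of_le Real.two_pi_pos.le,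
      smul_eq_mul] at h
  rw [Real.circleAverage, intervalIntegral.integral_of_le Real.two_pi_pos.le, smul_eq_mul]
  unfold sphereMean
  rw [integral_integral_swap hint, ← integral_const_mul]
  refine integral_mono ?_ ?_ hpt
  · have hc : Continuous fun ζ : Metric.sphere (0 : Cn n) 1 => ‖f (w • (ζ : Cn n))‖ ^ q :=
      (hf.continuousOn.comp_continuous (by fun_prop)
        (fun x => smul_sphere_mem_unitBall (by linarith) _)).norm.rpow_const
        fun _ => Or.inr hq.le
    exact hc.integrable_of_hasCompactSupport (HasCompactSupport.of_compactSpace _)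
  · exact (hint.integral_prod_right).const_mul _

/-- The integral means of a holomorphic function increase with the radius. -/
theorem sphereMean_mono {f : Cn n → ℂ} (hf : AnalyticOnNhd ℂ f (unitBall n)) {q : ℝ}
    (hq : 0 < q) {r s : ℝ} (hr : 0 ≤ r) (hrs : r ≤ s) (hs : s < 1) :
    sphereMean q f r ≤ sphereMean q f s := by
  by_contra! hlt
  have hs0 : 0 ≤ s := hr.trans hrs
  have hcont : Continuous fun x : ℝ => sphereMean q f ((max 0 (min x s) : ℝ) : ℂ) := by
    refine continuous_sphereMean_comp hf hq (by fun_prop) hs fun x => ?_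
    rw [Complex.norm_real, Real.norm_of_nonneg (le_max_left _ _)]
    exact max_le hs0 (min_le_right _ _)
  have hclamp : ∀ x ∈ Icc 0 s, max 0 (min x s) = x := fun x hx => by
    rw [min_eq_left hx.2, max_eq_right hx.1]
  have hcontOn : ContinuousOn (fun x : ℝ => sphereMean q f (x : ℂ)) (Icc 0 s) :=
    hcont.continuousOn.congr fun x hx => by simp only [hclamp x hx]
  -- Maximum principle: the circle of radius s - r0 about a maximizer r0 < s stays in |w| ≤ s and
  -- passes through s, where the mean is strictly below its maximum V. Its average is then below V,
  -- against the sub-mean value inequality at r0.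
  obtain ⟨x0, hx0, hmax⟩ := isCompact_Icc.exists_isMaxOn ⟨r, hr, hrs⟩ hcontOn
  set V := sphereMean q f (x0 : ℂ) with hV
  have hK : IsCompact {x ∈ Icc 0 s | sphereMean q f (x : ℂ) = V} := by
    have : IsClosed (Icc 0 s ∩ (fun x : ℝ => sphereMean q f (x : ℂ)) ⁻¹' {V}) :=
      hcontOn.preimage_isClosed_of_isClosed isClosed_Icc isClosed_singleton
    exact isCompact_Icc.of_isClosed_subset this inter_subset_left
  obtain ⟨r0, ⟨hr0, hr0V⟩, hgr⟩ := hK.exists_isGreatest ⟨x0, hx0, rfl⟩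
  have hsV : sphereMean q f (s : ℂ) < V := hlt.trans_le (hmax ⟨hr, hrs⟩)
  have hr0s : r0 < s := lt_of_le_of_ne hr0.2 (by rintro rfl; exact hsV.ne hr0V)
  have hR : 0 < s - r0 := sub_pos.2 hr0s
  have hnr0 : ‖(r0 : ℂ)‖ = r0 := by rw [Complex.norm_real, Real.norm_of_nonneg hr0.1]
  have hcm : ∀ θ, ‖circleMap (r0 : ℂ) (s - r0) θ‖ ≤ s := fun θ => by
    have h1 := norm_le_norm_add_norm_sub' (circleMap (r0 : ℂ) (s - r0) θ) r0
    rw [circleMap_sub_center, norm_circleMap_zero, abs_of_pos hR, hnr0] at h1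
    linarith
  have hle : ∀ θ, sphereMean q f (circleMap (r0 : ℂ) (s - r0) θ) ≤ V := fun θ => by
    rw [sphereMean_norm]
    exact hmax ⟨norm_nonneg _, hcm θ⟩
  obtain ⟨s', hss', hs'⟩ := exists_between hs
  have hc : Continuous fun θ => sphereMean q f (circleMap (r0 : ℂ) (s - r0) θ) :=
    continuous_sphereMean_comp hf hq (continuous_circleMap _ _) hs hcm
  have hstrict : ∫ θ in (0 : ℝ)..2 * Real.pi, sphereMean q f (circleMap (r0 : ℂ) (s - r0) θ)
      < ∫ _ in (0 : ℝ)..2 * Real.pi, V := by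
    refine intervalIntegral.integral_lt_integral_of_continuousOn_of_le_of_exists_lt
      Real.two_pi_pos hc.continuousOn continuousOn_const (fun θ _ => hle θ)
      ⟨0, ⟨le_rfl, Real.two_pi_pos.le⟩, ?_⟩
    have : circleMap (r0 : ℂ) (s - r0) 0 = s := by simp [circleMap]
    rwa [this]
  have hsub := sphereMean_le_circleAverage hf hq (w := (r0 : ℂ)) hR (by rw [hnr0]; linarith)
  rw [hr0V, Real.circleAverage, smul_eq_mul] at hsub
  rw [intervalIntegral.integral_const, smul_eq_mul, sub_zero] at hstrict
  have h2 : (2 * Real.pi)⁻¹ * ∫ θ in (0 : ℝ)..2 * Real.pi,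
      sphereMean q f (circleMap (r0 : ℂ) (s - r0) θ) < (2 * Real.pi)⁻¹ * (2 * Real.pi * V) := by
    gcongr
  rw [inv_mul_cancel_left₀ Real.two_pi_pos.ne'] at h2
  linarith

theorem integralMeanPow_eq_ofReal {f : Cn n → ℂ} (hf : AnalyticOnNhd ℂ f (unitBall n)) {q : ℝ}
    (hq : 0 < q) {r : ℝ} (hr : r ∈ Ico (0 : ℝ) 1) :
    integralMeanPow q f r = ENNReal.ofReal (sphereMean q f r) := by
  have hc : Continuous fun ζ : Metric.sphere (0 : Cn n) 1 => ‖f ((r : ℂ) • (ζ : Cn n))‖ ^ q :=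
    (hf.continuousOn.comp_continuous (by fun_prop)
      (fun x => smul_sphere_mem_unitBall
        (by rw [Complex.norm_real, Real.norm_of_nonneg hr.1]; exact hr.2) _)).norm.rpow_const
      fun _ => Or.inr hq.le
  unfold integralMeanPow sphereMean
  rw [ofReal_integral_eq_lintegral_ofReal
    (hc.integrable_of_hasCompactSupport (HasCompactSupport.of_compactSpace _))
    (Eventually.of_forall fun ζ => by positivity)]
  refine lintegral_congr fun ζ => ?_
  rw [← ofReal_norm, ENNReal.ofReal_rpow_of_nonneg (norm_nonneg _) hq.le]

theorem integralMeanPow_mono {f : Cn n → ℂ} (hf : AnalyticOnNhd ℂ f (unitBall n)) {q : ℝ}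
    (hq : 0 < q) {r s : ℝ} (hr : 0 ≤ r) (hrs : r ≤ s) (hs : s < 1) :
    integralMeanPow q f r ≤ integralMeanPow q f s := by
  rw [integralMeanPow_eq_ofReal hf hq ⟨hr, hrs.trans_lt hs⟩,
    integralMeanPow_eq_ofReal hf hq ⟨hr.trans hrs, hs⟩]
  exact ENNReal.ofReal_le_ofReal (sphereMean_mono hf hq hr hrs hs)

end Means

/-! ### Pointwise growth from integral means, through nonisotropic ellipsoids. -/

section

variable {n : ℕ}

/-- Integration in polar coordinates. -/
theorem lintegral_polar (hn : 1 ≤ n) {G : Cn n → ℝ≥0∞} (hG : Measurable G) :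
    ∫⁻ z, G z = ∫⁻ r in Ioi (0 : ℝ), ENNReal.ofReal (r ^ (2 * n - 1)) *
      ∫⁻ ζ : Metric.sphere (0 : Cn n) 1, G ((r : ℂ) • (ζ : Cn n))
        ∂(volume : Measure (Cn n)).toSphere := by
  have hdim : Module.finrank ℝ (Cn n) = 2 * n := by
    rw [finrank_real_of_complex]; simp
  have : Nontrivial (Cn n) := by
    have : Nonempty (Fin n) := ⟨⟨0, hn⟩⟩
    infer_instance
  have hmp := (volume : Measure (Cn n)).measurePreserving_homeomorphUnitSphereProd
  rw [hdim] at hmp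
  have hme : MeasurableEmbedding (Subtype.val : ({0}ᶜ : Set (Cn n)) → Cn n) :=
    MeasurableEmbedding.subtype_coe (measurableSet_singleton _).compl
  have h1 : ∫⁻ z, G z = ∫⁻ z : ({0}ᶜ : Set (Cn n)), G z ∂(volume : Measure (Cn n)).comap (↑) := by
    rw [← hme.lintegral_map, hme.map_comap, Subtype.range_coe]
    rw [restrict_compl_singleton]
  let G' : Metric.sphere (0 : Cn n) 1 × Ioi (0 : ℝ) → ℝ≥0∞ := fun x =>
    G ((x.2 : ℝ) • (x.1 : Cn n))
  have hG' : Measurable G' := hG.comp (by fun_prop)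
  have h2 : ∫⁻ z : ({0}ᶜ : Set (Cn n)), G z ∂(volume : Measure (Cn n)).comap (↑) =
      ∫⁻ z : ({0}ᶜ : Set (Cn n)), G' (homeomorphUnitSphereProd (Cn n) z)
        ∂(volume : Measure (Cn n)).comap (↑) := by
    refine lintegral_congr fun z => ?_
    simp only [G']
    congr 1
    have hz : ‖(z : Cn n)‖ ≠ 0 := norm_ne_zero_iff.2 z.2
    simp [smul_smul, hz]
  rw [h1, h2, hmp.lintegral_comp hG', lintegral_prod_symm' _ hG', Measure.volumeIoiPow,
    lintegral_withDensity_eq_lintegral_mul₀ (by fun_prop)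
      (hG'.lintegral_prod_left').aemeasurable]
  refine (lintegral_subtype_comap measurableSet_Ioi (fun r : ℝ => ENNReal.ofReal (r ^ (2 * n - 1)) *
      ∫⁻ ζ : Metric.sphere (0 : Cn n) 1, G (r • (ζ : Cn n))
        ∂(volume : Measure (Cn n)).toSphere)).trans ?_
  simp only [Complex.coe_smul]

theorem measurable_indicator_enorm_rpow {h : Cn n → ℂ} (hh : AnalyticOnNhd ℂ h (unitBall n))
    (q : ℝ) : Measurable ((unitBall n).indicator fun z => ‖h z‖ₑ ^ q) := by
  have hm : Measurable ((unitBall n).indicator h) := by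
    classical
    rw [← piecewise_eq_indicator]
    exact hh.continuousOn.measurable_piecewise continuousOn_const measurableSet_ball
  have : (unitBall n).indicator (fun z => ‖h z‖ₑ ^ q) =
      (unitBall n).indicator fun z => ‖(unitBall n).indicator h z‖ₑ ^ q := by
    ext z
    by_cases hz : z ∈ unitBall n
    · simp only [indicator_of_mem hz]
    · simp only [indicator_of_notMem hz]
  rw [this]
  exact (hm.enorm.pow_const q).indicator measurableSet_ball

/-- Sub-mean value property of `|h|^q` over the unit ball. -/
theorem enorm_rpow_mul_volume_le {h : Cn n → ℂ} (hh : AnalyticOnNhd ℂ h (unitBall n))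
    {q : ℝ} (hq : 0 < q) :
    ‖h 0‖ₑ ^ q * volume (unitBall n) ≤ ∫⁻ z in unitBall n, ‖h z‖ₑ ^ q := by
  set G : Cn n → ℝ≥0∞ := (unitBall n).indicator fun z => ‖h z‖ₑ ^ q with hG
  have hGm : Measurable G := measurable_indicator_enorm_rpow hh q
  have hint : ∫⁻ z in unitBall n, ‖h z‖ₑ ^ q = ∫⁻ z, G z :=
    (lintegral_indicator measurableSet_ball _).symm
  have hrot : ∀ θ : ℝ, ∫⁻ z, G ((Circle.exp θ : ℂ) • z) = ∫⁻ z, G z := fun θ =>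
    (LinearIsometryEquiv.measurePreserving (rotateIsometry n (Circle.exp θ))).lintegral_comp hGm
  have hmem : ∀ (θ : ℝ) (z : Cn n), z ∈ unitBall n → (Circle.exp θ : ℂ) • z ∈ unitBall n := by
    intro θ z hz
    simpa [norm_smul, Circle.norm_coe] using hz
  -- On each orbit θ ↦ e^{iθ}z the one-variable inequality compares with the value at 0. Integrating
  -- over z and exchanging the integrals removes θ, since volume is invariant under rotation.
  have hpt : ∀ z ∈ unitBall n, ENNReal.ofReal (2 * Real.pi) * ‖h 0‖ₑ ^ q ≤
      ∫⁻ θ in Ioc 0 (2 * Real.pi), G ((Circle.exp θ : ℂ) • z) := by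
    intro z hz
    have hsl : ∀ w ∈ Metric.closedBall (0 : ℂ) 1, w • z ∈ unitBall n := fun w hw => by
      rw [mem_closedBall_zero_iff] at hw
      rw [mem_ball_zero_iff] at hz ⊢
      rw [norm_smul]
      exact (mul_le_of_le_one_left (norm_nonneg _) hw).trans_lt hz
    have h1 := norm_rpow_le_circleAverage one_pos hq (c := 0) (analyticOnNhd_slice hh z hsl)
    simp only [zero_smul] at h1
    have hc : Continuous fun θ : ℝ => ‖h ((Circle.exp θ : ℂ) • z)‖ ^ q :=
      (hh.continuousOn.comp_continuous (by fun_prop) (fun θ => hmem θ z hz)).norm.rpow_const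
        fun _ => Or.inr hq.le
    have h2 : ∫⁻ θ in Ioc 0 (2 * Real.pi), G ((Circle.exp θ : ℂ) • z) =
        ENNReal.ofReal (∫ θ in Ioc 0 (2 * Real.pi), ‖h ((Circle.exp θ : ℂ) • z)‖ ^ q) := by
      rw [ofReal_integral_eq_lintegral_ofReal]
      · refine lintegral_congr fun θ => ?_
        rw [hG, indicator_of_mem (hmem θ z hz), ← ofReal_norm,
          ENNReal.ofReal_rpow_of_nonneg (norm_nonneg _) hq.le]
      · exact (hc.intervalIntegrable 0 (2 * Real.pi)).1
      · exact Eventually.of_forall fun _ => by positivity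
    rw [h2, ← ofReal_norm, ENNReal.ofReal_rpow_of_nonneg (norm_nonneg _) hq.le,
      ← ENNReal.ofReal_mul Real.two_pi_pos.le]
    refine ENNReal.ofReal_le_ofReal ?_
    rw [Real.circleAverage, intervalIntegral.integral_of_le Real.two_pi_pos.le, smul_eq_mul,
      ← div_eq_inv_mul, le_div_iff₀' Real.two_pi_pos] at h1
    simpa [circleMap] using h1
  have hpi : ENNReal.ofReal (2 * Real.pi) ≠ 0 := by simp [Real.pi_pos]
  rw [hint, ← ENNReal.mul_le_mul_iff_right hpi ENNReal.ofReal_ne_top]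
  calc ENNReal.ofReal (2 * Real.pi) * (‖h 0‖ₑ ^ q * volume (unitBall n))
      = ∫⁻ _ in unitBall n, ENNReal.ofReal (2 * Real.pi) * ‖h 0‖ₑ ^ q := by
        rw [setLIntegral_const, mul_assoc]
    _ ≤ ∫⁻ z in unitBall n, ∫⁻ θ in Ioc 0 (2 * Real.pi), G ((Circle.exp θ : ℂ) • z) :=
        setLIntegral_mono' measurableSet_ball hpt
    _ ≤ ∫⁻ z, ∫⁻ θ in Ioc 0 (2 * Real.pi), G ((Circle.exp θ : ℂ) • z) :=
        setLIntegral_le_lintegral _ _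
    _ = ∫⁻ θ in Ioc 0 (2 * Real.pi), ∫⁻ z, G ((Circle.exp θ : ℂ) • z) := by
        refine lintegral_lintegral_swap (Measurable.aemeasurable ?_)
        exact hGm.comp (by fun_prop)
    _ = ENNReal.ofReal (2 * Real.pi) * ∫⁻ z, G z := by
        simp only [hrot, setLIntegral_const, Real.volume_Ioc, sub_zero]
        rw [mul_comm]

/-- The complex linear map that scales by `δ` in the direction `η` and by `√δ` orthogonally. -/
def koranyiMap (η : Cn n) (δ : ℝ) : Cn n →ₗ[ℂ] Cn n :=
  ((√δ : ℝ) : ℂ) • LinearMap.transvection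
    (((√δ - 1 : ℝ) : ℂ) • (innerSL ℂ η : Cn n →L[ℂ] ℂ).toLinearMap) η

theorem koranyiMap_apply (η : Cn n) {δ : ℝ} (hδ : 0 ≤ δ) (v : Cn n) :
    koranyiMap η δ v = ((√δ : ℝ) : ℂ) • v + (((δ - √δ : ℝ) : ℂ) * inner ℂ η v) • η := by
  have : √δ * √δ = δ := Real.mul_self_sqrt hδ
  simp only [koranyiMap, LinearMap.smul_apply, LinearMap.transvection.apply, smul_add, smul_smul,
    ContinuousLinearMap.coe_coe, innerSL_apply_apply, smul_eq_mul]
  rw [← mul_assoc, ← Complex.ofReal_mul, mul_sub, this, mul_one]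

/-- The scalar √δ contributes √δ^n, and the transvection one further factor 1 + (√δ - 1) = √δ. -/
theorem det_koranyiMap {η : Cn n} (hη : ‖η‖ = 1) (δ : ℝ) :
    LinearMap.det (koranyiMap η δ) = ((√δ ^ (n + 1) : ℝ) : ℂ) := by
  rw [koranyiMap, LinearMap.det_smul, LinearMap.transvection.det]
  simp [inner_self_eq_norm_sq_to_K, hη, pow_succ]

/-- The real Jacobian of a complex linear map is the squared modulus of its determinant. The
exponent n + 1, instead of 2n, is what produces the sharp growth: integrating over a shell of
thickness δ gives one power back and leaves δ^{-n}. -/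
theorem map_koranyiMap {η : Cn n} (hη : ‖η‖ = 1) {δ : ℝ} (hδ : 0 < δ) :
    Measure.map (koranyiMap η δ) (volume : Measure (Cn n)) =
      ENNReal.ofReal (δ ^ (n + 1))⁻¹ • (volume : Measure (Cn n)) := by
  have hd : LinearMap.det ((koranyiMap η δ).restrictScalars ℝ) = δ ^ (n + 1) := by
    have h := LinearMap.det_restrictScalars (R := ℝ) (f := koranyiMap η δ)
    rw [det_koranyiMap hη δ, Algebra.norm_complex_apply] at h
    rw [h, Complex.normSq_ofReal, ← mul_pow, Real.mul_self_sqrt hδ.le]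
  have h := Measure.map_linearMap_addHaar_eq_smul_addHaar (volume : Measure (Cn n))
    (f := (koranyiMap η δ).restrictScalars ℝ) (by rw [hd]; positivity)
  rw [hd, abs_of_pos (by positivity)] at h
  exact h

theorem lintegral_koranyiMap {η : Cn n} (hη : ‖η‖ = 1) {δ : ℝ} (hδ : 0 < δ) (z : Cn n)
    {G : Cn n → ℝ≥0∞} (hG : Measurable G) :
    ∫⁻ v, G (z + koranyiMap η δ v) = ENNReal.ofReal (δ ^ (n + 1))⁻¹ * ∫⁻ v, G v := by
  have hm : Measurable (koranyiMap η δ) :=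
    (LinearMap.continuous_of_finiteDimensional _).measurable
  have h1 : Measurable fun v => G (z + v) := hG.comp (measurable_const_add z)
  rw [← lintegral_map (f := fun v => G (z + v)) h1 hm, map_koranyiMap hη hδ,
    lintegral_smul_measure, lintegral_add_left_eq_self, smul_eq_mul]

/-- Pythagoras for the complex line of η and its orthogonal complement, in the form that computes
norms of points moved by `koranyiMap`. -/
theorem norm_sq_add_orthogonal {η : Cn n} (hη : ‖η‖ = 1) (b t : ℂ) (v : Cn n) :
    ‖b • η + t • (v - inner ℂ η v • η)‖ ^ 2 =
      ‖b‖ ^ 2 + ‖t‖ ^ 2 * (‖v‖ ^ 2 - ‖inner ℂ η v‖ ^ 2) := by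
  have hηη : inner ℂ η η = 1 := by rw [inner_self_eq_norm_sq_to_K, hη]; simp
  have horth : ∀ a c : ℂ, inner ℂ (a • η) (c • (v - inner ℂ η v • η)) = 0 := fun a c => by
    simp only [inner_smul_left, inner_smul_right, inner_sub_right, hηη, mul_one]
    ring
  have h1 : ‖v‖ ^ 2 = ‖inner ℂ η v‖ ^ 2 + ‖v - inner ℂ η v • η‖ ^ 2 := by
    have h := norm_add_sq_eq_norm_sq_add_norm_sq_of_inner_eq_zero _ _ (horth (inner ℂ η v) 1)
    rw [one_smul, add_sub_cancel, norm_smul, hη, mul_one] at h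
    simpa only [sq] using h
  have h2 := norm_add_sq_eq_norm_sq_add_norm_sq_of_inner_eq_zero _ _ (horth b t)
  simp only [← sq] at h2
  rw [h2, norm_smul, norm_smul, hη, mul_one, mul_pow, h1]
  ring

theorem exists_unit_smul (hn : 1 ≤ n) (z : Cn n) :
    ∃ η : Cn n, ‖η‖ = 1 ∧ z = (‖z‖ : ℂ) • η := by
  rcases eq_or_ne z 0 with rfl | hz
  · exact ⟨EuclideanSpace.single ⟨0, hn⟩ 1, by simp, by simp⟩
  · have h : ‖z‖ ≠ 0 := norm_ne_zero_iff.2 hz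
    refine ⟨((‖z‖⁻¹ : ℝ) : ℂ) • z, by simp [norm_smul, h], ?_⟩
    rw [smul_smul, ← Complex.ofReal_mul, mul_inv_cancel₀ h, Complex.ofReal_one, one_smul]

/-- Displacements of order √δ orthogonal to η enter the squared norm only as δ, the same order as
displacements of order δ along η. The ellipsoid at ρη therefore stays in a shell of thickness
comparable to δ, at distance at least δ/4 from the sphere. -/
theorem norm_add_koranyiMap_mem {η : Cn n} (hη : ‖η‖ = 1) {ρ δ : ℝ} (hρ : 0 ≤ ρ) (hρδ : ρ = 1 - δ)
    (hδ : 0 < δ) {v : Cn n} (hv : ‖v‖ < 1) :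
    ‖(ρ : ℂ) • η + koranyiMap η (δ / 4) v‖ ∈ Ioo (1 - 2 * δ) (1 - δ / 4) := by
  set a : ℂ := inner ℂ η v with ha
  have hav : ‖a‖ ≤ ‖v‖ := by
    have := norm_inner_le_norm (𝕜 := ℂ) η v
    rwa [hη, one_mul] at this
  have ha1 : ‖a‖ < 1 := hav.trans_lt hv
  have hs : √(δ / 4) * √(δ / 4) = δ / 4 := Real.mul_self_sqrt (by positivity)
  have he : (ρ : ℂ) • η + koranyiMap η (δ / 4) v =
      ((ρ : ℂ) + ((δ / 4 : ℝ) : ℂ) * a) • η + ((√(δ / 4) : ℝ) : ℂ) • (v - a • η) := by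
    rw [koranyiMap_apply η (by positivity), Complex.ofReal_sub]
    module
  have hb1 : ‖(ρ : ℂ) + ((δ / 4 : ℝ) : ℂ) * a‖ ≤ ρ + δ / 4 := by
    refine (norm_add_le _ _).trans ?_
    rw [norm_mul, Complex.norm_real, Complex.norm_real, Real.norm_of_nonneg hρ,
      Real.norm_of_nonneg (by positivity)]
    nlinarith
  have hb2 : ρ - δ / 4 ≤ ‖(ρ : ℂ) + ((δ / 4 : ℝ) : ℂ) * a‖ := by
    have h := norm_sub_le_norm_add (ρ : ℂ) (((δ / 4 : ℝ) : ℂ) * a)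
    rw [norm_mul, Complex.norm_real, Complex.norm_real, Real.norm_of_nonneg hρ,
      Real.norm_of_nonneg (by positivity)] at h
    nlinarith
  have hsq := norm_sq_add_orthogonal hη ((ρ : ℂ) + ((δ / 4 : ℝ) : ℂ) * a)
    ((√(δ / 4) : ℝ) : ℂ) v
  rw [← ha, ← he, Complex.norm_real, Real.norm_of_nonneg (Real.sqrt_nonneg _), sq (√(δ / 4)),
    hs] at hsq
  set N := ‖(ρ : ℂ) • η + koranyiMap η (δ / 4) v‖
  have hN : 0 ≤ N := norm_nonneg _
  have hb0 := norm_nonneg ((ρ : ℂ) + ((δ / 4 : ℝ) : ℂ) * a)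
  have hv2 : ‖v‖ ^ 2 ≤ 1 := by nlinarith [norm_nonneg v]
  have ha2 : ‖a‖ ^ 2 ≤ ‖v‖ ^ 2 := by gcongr
  have hbsq : ‖(ρ : ℂ) + ((δ / 4 : ℝ) : ℂ) * a‖ ^ 2 ≤ (ρ + δ / 4) ^ 2 := by gcongr
  constructor
  · have : ‖(ρ : ℂ) + ((δ / 4 : ℝ) : ℂ) * a‖ ≤ N := by
      refine le_of_sq_le_sq ?_ hN
      rw [hsq]; nlinarith
    linarith
  · have h1 : N ^ 2 < (1 - δ / 4) ^ 2 := by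
      have : δ / 4 * (‖v‖ ^ 2 - ‖a‖ ^ 2) ≤ δ / 4 := by nlinarith [sq_nonneg ‖a‖]
      rw [hsq]; subst hρδ; nlinarith
    exact lt_of_pow_lt_pow_left₀ 2 (by linarith) h1

/-- Growth of a holomorphic function in terms of its integral means. -/
theorem exists_enorm_rpow_le_integralMeanPow (hn : 1 ≤ n) {q : ℝ} (hq : 0 < q) :
    ∃ C : ℝ≥0∞, C ≠ ∞ ∧ ∀ f : Cn n → ℂ, AnalyticOnNhd ℂ f (unitBall n) → ∀ z ∈ unitBall n,
      ‖f z‖ₑ ^ q ≤ C * ENNReal.ofReal (((1 - ‖z‖) ^ n)⁻¹) *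
        integralMeanPow q f (1 - (1 - ‖z‖) / 4) := by
  set ω : ℝ≥0∞ := (volume : Measure (Cn n)).toSphere univ with hω
  set V : ℝ≥0∞ := volume (unitBall n) with hV
  have hV0 : V ≠ 0 := (Metric.measure_ball_pos _ _ one_pos).ne'
  have hVt : V ≠ ∞ := measure_ball_lt_top.ne
  have hωt : ω ≠ ∞ := measure_ne_top _ _
  have hω0 : ω ≠ 0 := by
    have : Nonempty (Fin n) := ⟨⟨0, hn⟩⟩
    rw [hω, Ne, Measure.measure_univ_eq_zero]
    exact Measure.toSphere_ne_zero _
  -- 4^{n+1} undoes the Jacobian of the ellipsoid of parameter δ/4, and 2δ bounds the thickness 7δ/4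
  -- of the shell containing it.
  refine ⟨V⁻¹ * ω * ENNReal.ofReal (2 * 4 ^ (n + 1)), by finiteness, fun f hf z hz => ?_⟩
  rw [mem_ball_zero_iff] at hz
  obtain ⟨η, hη, hzη⟩ := exists_unit_smul hn z
  set ρ := ‖z‖ with hρ
  set δ := 1 - ρ with hδ
  have hρ0 : 0 ≤ ρ := norm_nonneg z
  have hδ0 : 0 < δ := by linarith
  have hδ1 : δ ≤ 1 := by linarith
  set S : Set (Cn n) := {w | ‖w‖ ∈ Ioo (1 - 2 * δ) (1 - δ / 4)} with hS
  have hSm : MeasurableSet S := measurableSet_Ioo.preimage measurable_norm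
  have hSB : S ⊆ unitBall n := fun w hw => by
    rw [mem_ball_zero_iff]; have := hw.2; linarith
  set G : Cn n → ℝ≥0∞ := S.indicator fun w => ‖f w‖ₑ ^ q with hG
  have hGm : Measurable G := by
    have : G = S.indicator ((unitBall n).indicator fun w => ‖f w‖ₑ ^ q) := by
      rw [indicator_indicator, inter_eq_left.2 hSB]
    rw [this]
    exact (measurable_indicator_enorm_rpow hf q).indicator hSm
  have hmem : ∀ v ∈ unitBall n, z + koranyiMap η (δ / 4) v ∈ S := fun v hv => by
    rw [mem_ball_zero_iff] at hv
    have := norm_add_koranyiMap_mem hη hρ0 (by linarith) hδ0 hv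
    rwa [← hzη] at this
  have hla : ∀ v, AnalyticAt ℂ (fun v => z + koranyiMap η (δ / 4) v) v := fun v =>
    analyticAt_const.add
      ((LinearMap.toContinuousLinearMap (koranyiMap η (δ / 4))).analyticAt v)
  have hcomp : AnalyticOnNhd ℂ (fun v => f (z + koranyiMap η (δ / 4) v)) (unitBall n) :=
    fun v hv => (hf _ (hSB (hmem v hv))).comp_of_eq (hla v) rfl
  have h1 := enorm_rpow_mul_volume_le hcomp hq
  simp only [map_zero, add_zero] at h1
  have h2 : ∫⁻ v in unitBall n, ‖f (z + koranyiMap η (δ / 4) v)‖ₑ ^ q ≤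
      ENNReal.ofReal ((δ / 4) ^ (n + 1))⁻¹ * ∫⁻ w, G w := by
    rw [← lintegral_koranyiMap hη (by positivity) z hGm]
    refine le_trans (setLIntegral_mono' measurableSet_ball fun v hv => ?_)
      (setLIntegral_le_lintegral (unitBall n) _)
    rw [hG, indicator_of_mem (hmem v hv)]
  -- In polar coordinates the shell integral is an integral of means, each at most the mean at the
  -- outer radius 1 - δ/4.
  have h3 : ∫⁻ w, G w ≤ ENNReal.ofReal (2 * δ) * (ω * integralMeanPow q f (1 - δ / 4)) := by
    rw [lintegral_polar hn hGm]
    have hin : ∀ r ∈ Ioi (0 : ℝ), ENNReal.ofReal (r ^ (2 * n - 1)) *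
        ∫⁻ ζ : Metric.sphere (0 : Cn n) 1, G ((r : ℂ) • (ζ : Cn n))
          ∂(volume : Measure (Cn n)).toSphere ≤
        (Ioo (1 - 2 * δ) (1 - δ / 4)).indicator
          (fun _ => ω * integralMeanPow q f (1 - δ / 4)) r := by
      intro r hr
      have hnr : ∀ ζ : Metric.sphere (0 : Cn n) 1, ‖(r : ℂ) • (ζ : Cn n)‖ = r := fun ζ => by
        have : ‖(ζ : Cn n)‖ = 1 := by simp
        rw [norm_smul, this, mul_one, Complex.norm_real, Real.norm_of_nonneg (le_of_lt hr)]
      have hSr : ∀ ζ : Metric.sphere (0 : Cn n) 1,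
          (r : ℂ) • (ζ : Cn n) ∈ S ↔ r ∈ Ioo (1 - 2 * δ) (1 - δ / 4) := fun ζ => by
        simp only [hS, mem_ofPred_eq, hnr]
      by_cases hrI : r ∈ Ioo (1 - 2 * δ) (1 - δ / 4)
      · rw [indicator_of_mem hrI]
        have hr1 : ENNReal.ofReal (r ^ (2 * n - 1)) ≤ 1 := by
          rw [← ENNReal.ofReal_one]
          refine ENNReal.ofReal_le_ofReal (pow_le_one₀ (le_of_lt hr) ?_)
          have := hrI.2; linarith
        have hGr : ∫⁻ ζ : Metric.sphere (0 : Cn n) 1, G ((r : ℂ) • (ζ : Cn n))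
            ∂(volume : Measure (Cn n)).toSphere = ω * integralMeanPow q f r := by
          have : (volume : Measure (Cn n)).toSphere = ω • sphereMeasure n := by
            rw [sphereMeasure, smul_smul, ENNReal.mul_inv_cancel hω0 hωt, one_smul]
          rw [this, lintegral_smul_measure, smul_eq_mul, integralMeanPow]
          congr 1
          refine lintegral_congr fun ζ => ?_
          rw [hG, indicator_of_mem ((hSr ζ).2 hrI)]
        rw [hGr]
        refine (mul_le_of_le_one_left' hr1).trans ?_
        gcongr
        exact integralMeanPow_mono hf hq (le_of_lt hr) hrI.2.le (by linarith)
      · have : ∀ ζ : Metric.sphere (0 : Cn n) 1, G ((r : ℂ) • (ζ : Cn n)) = 0 := fun ζ => by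
          rw [hG, indicator_of_notMem (mt (hSr ζ).1 hrI)]
        simp only [this, lintegral_zero, mul_zero, zero_le]
    refine (setLIntegral_mono' measurableSet_Ioi hin).trans ?_
    refine (setLIntegral_le_lintegral _ _).trans ?_
    rw [lintegral_indicator measurableSet_Ioo, setLIntegral_const, Real.volume_Ioo, mul_comm]
    gcongr
    linarith
  have h4 : ‖f z‖ₑ ^ q = V⁻¹ * (‖f z‖ₑ ^ q * V) := by
    rw [mul_comm, mul_assoc, ENNReal.mul_inv_cancel hV0 hVt, mul_one]
  rw [h4]
  calc V⁻¹ * (‖f z‖ₑ ^ q * V)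
      ≤ V⁻¹ * (ENNReal.ofReal ((δ / 4) ^ (n + 1))⁻¹ *
        (ENNReal.ofReal (2 * δ) * (ω * integralMeanPow q f (1 - δ / 4)))) := by
        refine mul_le_mul_right (h1.trans (h2.trans ?_)) _
        exact mul_le_mul_right h3 _
    _ = V⁻¹ * ω * (ENNReal.ofReal ((δ / 4) ^ (n + 1))⁻¹ * ENNReal.ofReal (2 * δ)) *
        integralMeanPow q f (1 - δ / 4) := by ring
    _ = V⁻¹ * ω * (ENNReal.ofReal (2 * 4 ^ (n + 1)) * ENNReal.ofReal ((δ ^ n)⁻¹)) *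
        integralMeanPow q f (1 - δ / 4) := by
        rw [← ENNReal.ofReal_mul (by positivity), ← ENNReal.ofReal_mul (by positivity)]
        congr 3
        rw [div_pow, pow_succ δ n]
        field_simp
    _ = _ := by ring

/-! ### Nonisotropic balls and integrals of the Cauchy kernel. -/

theorem inner_add_koranyiMap {η : Cn n} (hη : ‖η‖ = 1) {t : ℝ} (ht : 0 ≤ t) (v : Cn n) :
    inner ℂ η (η + koranyiMap η t v) = 1 + t * inner ℂ η v := by
  have hηη : inner ℂ η η = 1 := by rw [inner_self_eq_norm_sq_to_K, hη]; simp
  rw [koranyiMap_apply η ht, inner_add_right, inner_add_right, inner_smul_right, inner_smul_right,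
    hηη, Complex.ofReal_sub]
  ring

/-- The nonisotropic balls `{|1 - ⟨ζ, η⟩| < t}` of the unit sphere have measure `O(tⁿ)`. -/
theorem exists_toSphere_koranyi_le (hn : 1 ≤ n) :
    ∃ C : ℝ≥0∞, C ≠ ∞ ∧ ∀ η : Cn n, ‖η‖ = 1 → ∀ t : ℝ, 0 < t →
      (volume : Measure (Cn n)).toSphere {ζ | ‖1 - inner ℂ η (ζ : Cn n)‖ < t} ≤
        C * ENNReal.ofReal (t ^ n) := by
  set ω : ℝ≥0∞ := (volume : Measure (Cn n)).toSphere univ with hω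
  have hωt : ω ≠ ∞ := measure_ne_top _ _
  set V : ℝ≥0∞ := volume (Metric.ball (0 : Cn n) 3) with hV
  have hVt : V ≠ ∞ := measure_ball_lt_top.ne
  refine ⟨ω * ENNReal.ofReal (2 ^ n) + V * ENNReal.ofReal (2 ^ (2 * n - 1)), by finiteness,
    fun η hη t ht => ?_⟩
  set Q : Set (Metric.sphere (0 : Cn n) 1) := {ζ | ‖1 - inner ℂ η (ζ : Cn n)‖ < t} with hQ
  -- For t > 1/2 the total mass suffices, as 2^n t^n ≥ 1.
  rcases lt_or_ge (1 / 2) t with h | h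
  · calc (volume : Measure (Cn n)).toSphere Q ≤ ω := measure_mono (subset_univ _)
      _ = ω * 1 := (mul_one _).symm
      _ ≤ ω * (ENNReal.ofReal (2 ^ n) * ENNReal.ofReal (t ^ n)) := by
          gcongr
          rw [← ENNReal.ofReal_mul (by positivity), ← mul_pow, ENNReal.one_le_ofReal]
          exact one_le_pow₀ (by linarith)
      _ ≤ _ := by
          rw [← mul_assoc]
          gcongr
          exact le_self_add
  · have hQm : MeasurableSet Q := measurableSet_lt (by fun_prop) measurable_const
    -- E contains rζ for ζ in Q and 1 - t < r < 1, so its volume is at least a constant times t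
    -- times the measure of Q. It lies in the image of a fixed ball under the nonisotropic map at η,
    -- so its volume is O(t^{n+1}).
    set E : Set (Cn n) := {z | ‖z‖ < 1} ∩ {z | ‖1 - inner ℂ η z‖ < 2 * t} with hE
    have hEm : MeasurableSet E := (measurableSet_lt (by fun_prop) measurable_const).inter
      (measurableSet_lt (by fun_prop) measurable_const)
    have hGm : Measurable (E.indicator (1 : Cn n → ℝ≥0∞)) := measurable_one.indicator hEm
    have h1 : volume E ≤ ENNReal.ofReal (t ^ (n + 1)) * V := by
      have h := lintegral_koranyiMap hη ht η hGm
      rw [lintegral_indicator_one hEm] at h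
      have h2 : ∫⁻ v, E.indicator (1 : Cn n → ℝ≥0∞) (η + koranyiMap η t v) ≤ V := by
        rw [hV, ← lintegral_indicator_one measurableSet_ball]
        refine lintegral_mono fun v => ?_
        by_cases hv : η + koranyiMap η t v ∈ E
        · rw [indicator_of_mem hv, indicator_of_mem]
          · rfl
          obtain ⟨hv1, hv2⟩ := hv
          rw [mem_ofPred_eq] at hv1 hv2
          rw [inner_add_koranyiMap hη ht.le] at hv2
          set a : ℂ := inner ℂ η v with ha
          have hs : √t * √t = t := Real.mul_self_sqrt ht.le
          have he : η + koranyiMap η t v = ((1 : ℂ) + (t : ℂ) * a) • η + ((√t : ℝ) : ℂ) •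
              (v - a • η) := by
            rw [koranyiMap_apply η ht.le, Complex.ofReal_sub]
            module
          have hsq := norm_sq_add_orthogonal hη ((1 : ℂ) + (t : ℂ) * a) ((√t : ℝ) : ℂ) v
          rw [← ha, ← he, Complex.norm_real, Real.norm_of_nonneg (Real.sqrt_nonneg _), sq (√t),
            hs] at hsq
          have hta : ‖(t : ℂ) * a‖ = t * ‖a‖ := by
            rw [norm_mul, Complex.norm_real, Real.norm_of_nonneg ht.le]
          have ha2 : ‖a‖ < 2 := by
            rw [sub_add_cancel_left, norm_neg, hta] at hv2
            nlinarith
          have hb : 1 - t * ‖a‖ ≤ ‖(1 : ℂ) + (t : ℂ) * a‖ := by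
            have := norm_sub_le_norm_add (1 : ℂ) ((t : ℂ) * a)
            rwa [norm_one, hta] at this
          have hb0 : 0 ≤ 1 - t * ‖a‖ := by nlinarith [norm_nonneg a]
          have hN : ‖η + koranyiMap η t v‖ ^ 2 < 1 := by
            nlinarith [norm_nonneg (η + koranyiMap η t v)]
          have hbsq : (1 - t * ‖a‖) ^ 2 ≤ ‖(1 : ℂ) + (t : ℂ) * a‖ ^ 2 := by gcongr
          -- Being inside the unit ball gives ‖v‖² < |a|² + 2|a|, below 8 as |a| < 2; hence the
          -- radius 3.
          have h4 : t * (‖v‖ ^ 2 - ‖a‖ ^ 2) < t * (2 * ‖a‖) := by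
            nlinarith [sq_nonneg (t * ‖a‖)]
          have h5 := lt_of_mul_lt_mul_left h4 ht.le
          rw [mem_ball_zero_iff]
          nlinarith [norm_nonneg a, norm_nonneg v]
        · rw [indicator_of_notMem hv]
          exact zero_le
      rw [h] at h2
      calc volume E = ENNReal.ofReal (t ^ (n + 1)) *
            (ENNReal.ofReal (t ^ (n + 1))⁻¹ * volume E) := by
            rw [← mul_assoc, ← ENNReal.ofReal_mul (by positivity),
              mul_inv_cancel₀ (by positivity), ENNReal.ofReal_one, one_mul]
        _ ≤ _ := by gcongr
    have h2 : ENNReal.ofReal t * (ENNReal.ofReal ((1 / 2) ^ (2 * n - 1)) *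
        (volume : Measure (Cn n)).toSphere Q) ≤ volume E := by
      rw [← lintegral_indicator_one hEm, lintegral_polar hn hGm]
      calc ENNReal.ofReal t * (ENNReal.ofReal ((1 / 2) ^ (2 * n - 1)) *
          (volume : Measure (Cn n)).toSphere Q)
          = ∫⁻ r in Ioo (1 - t) 1, (ENNReal.ofReal ((1 / 2) ^ (2 * n - 1)) *
          (volume : Measure (Cn n)).toSphere Q) := by
            rw [setLIntegral_const, Real.volume_Ioo, sub_sub_cancel, mul_comm]
        _ ≤ ∫⁻ r in Ioo (1 - t) 1, (ENNReal.ofReal (r ^ (2 * n - 1)) *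
          ∫⁻ ζ : Metric.sphere (0 : Cn n) 1, E.indicator 1 ((r : ℂ) • (ζ : Cn n))
            ∂(volume : Measure (Cn n)).toSphere) := by
            refine setLIntegral_mono' measurableSet_Ioo fun r hr => ?_
            have hr2 : 1 / 2 ≤ r := by linarith [hr.1]
            gcongr
            rw [← lintegral_indicator_one hQm]
            refine lintegral_mono fun ζ => ?_
            by_cases hζ : ζ ∈ Q
            · rw [indicator_of_mem hζ, indicator_of_mem]
              · rfl
              have hζ1 : ‖(ζ : Cn n)‖ = 1 := by simp
              have hin : ‖inner ℂ η (ζ : Cn n)‖ ≤ 1 := by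
                have := norm_inner_le_norm (𝕜 := ℂ) η (ζ : Cn n)
                rwa [hη, hζ1, one_mul] at this
              refine ⟨?_, ?_⟩
              · rw [mem_ofPred_eq, norm_smul, hζ1, mul_one, Complex.norm_real,
                Real.norm_of_nonneg (by linarith)]
                exact hr.2
              · rw [mem_ofPred_eq, inner_smul_right]
                have : (1 : ℂ) - r * inner ℂ η (ζ : Cn n) = (1 - inner ℂ η (ζ : Cn n)) +
                    ((1 - r : ℝ) : ℂ) * inner ℂ η (ζ : Cn n) := by push_cast; ring
                rw [this]
                refine (norm_add_le _ _).trans_lt ?_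
                rw [norm_mul, Complex.norm_real, Real.norm_of_nonneg (by linarith [hr.2])]
                have : ‖1 - inner ℂ η (ζ : Cn n)‖ < t := hζ
                nlinarith [hr.1, hr.2]
            · rw [indicator_of_notMem hζ]
              exact zero_le
        _ ≤ _ := lintegral_mono_set fun r hr => by
            have := hr.1; simp only [mem_Ioi]; linarith
    have h3 := h2.trans h1
    calc (volume : Measure (Cn n)).toSphere Q
        = ENNReal.ofReal (t⁻¹ * 2 ^ (2 * n - 1)) * (ENNReal.ofReal t *
          (ENNReal.ofReal ((1 / 2) ^ (2 * n - 1)) * (volume : Measure (Cn n)).toSphere Q)) := by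
          rw [← mul_assoc, ← mul_assoc, ← ENNReal.ofReal_mul (by positivity),
            ← ENNReal.ofReal_mul (by positivity)]
          rw [show t⁻¹ * 2 ^ (2 * n - 1) * t * (1 / 2) ^ (2 * n - 1) = 1 by
            rw [one_div, inv_pow]; field_simp]
          rw [ENNReal.ofReal_one, one_mul]
      _ ≤ ENNReal.ofReal (t⁻¹ * 2 ^ (2 * n - 1)) * (ENNReal.ofReal (t ^ (n + 1)) * V) := by
          gcongr
      _ = V * ENNReal.ofReal (2 ^ (2 * n - 1)) * ENNReal.ofReal (t ^ n) := by
          rw [← mul_assoc, ← ENNReal.ofReal_mul (by positivity), mul_comm, mul_assoc V,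
            ← ENNReal.ofReal_mul (by positivity)]
          congr 2
          field_simp
          ring
      _ ≤ _ := by
          gcongr
          exact le_add_self

theorem one_sub_norm_le_norm_one_sub_inner (a : Cn n) {z : Cn n} (hz : ‖z‖ ≤ 1) :
    1 - ‖a‖ ≤ ‖1 - inner ℂ a z‖ := by
  have h1 := norm_sub_norm_le (1 : ℂ) (inner ℂ a z)
  have h2 := norm_inner_le_norm (𝕜 := ℂ) a z
  rw [norm_one] at h1
  nlinarith [norm_nonneg a]

/-- Integrals over the sphere of powers of the Cauchy kernel. -/
theorem exists_lintegral_kernel_le (hn : 1 ≤ n) {c : ℝ} (hc : 0 < c) :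
    ∃ C : ℝ≥0∞, C ≠ ∞ ∧ ∀ a ∈ unitBall n,
      ∫⁻ ζ : Metric.sphere (0 : Cn n) 1,
        ENNReal.ofReal (‖1 - inner ℂ a (ζ : Cn n)‖ ^ (-(n + c))) ∂sphereMeasure n ≤
        C * ENNReal.ofReal ((1 - ‖a‖) ^ (-c)) := by
  obtain ⟨C₀, hC₀, hK⟩ := exists_toSphere_koranyi_le hn
  set ω : ℝ≥0∞ := (volume : Measure (Cn n)).toSphere univ with hω
  have hω0 : ω ≠ 0 := by
    have : Nonempty (Fin n) := ⟨⟨0, hn⟩⟩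
    rw [hω, Ne, Measure.measure_univ_eq_zero]
    exact Measure.toSphere_ne_zero _
  set x : ℝ≥0∞ := ENNReal.ofReal (2 ^ (-c)) with hx
  have hx1 : x < 1 := by
    rw [hx, ENNReal.ofReal_lt_one]
    exact Real.rpow_lt_one_of_one_lt_of_neg one_lt_two (by linarith)
  have hsum : ∑' k : ℕ, x ^ k ≠ ∞ := by
    rw [ENNReal.tsum_geometric]
    exact ENNReal.inv_ne_top.2 (tsub_pos_of_lt hx1).ne'
  refine ⟨ω⁻¹ * C₀ * ENNReal.ofReal (4 ^ n) * ∑' k : ℕ, x ^ k, ?_, fun a ha => ?_⟩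
  · refine ENNReal.mul_ne_top (ENNReal.mul_ne_top (ENNReal.mul_ne_top ?_ hC₀) (by simp)) hsum
    exact ENNReal.inv_ne_top.2 hω0
  rw [mem_ball_zero_iff] at ha
  obtain ⟨η, hη, haη⟩ := exists_unit_smul hn a
  set δ := 1 - ‖a‖ with hδ
  have hδ0 : 0 < δ := by linarith
  set D : Metric.sphere (0 : Cn n) 1 → ℝ := fun ζ => ‖1 - inner ℂ a (ζ : Cn n)‖ with hD
  have hDm : Measurable D := by fun_prop
  have hDδ : ∀ ζ, δ ≤ D ζ := fun ζ =>
    one_sub_norm_le_norm_one_sub_inner a (le_of_eq (by simp))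
  -- Replacing a by the unit vector η changes 1 - ⟨a,ζ⟩ by at most δ, and δ ≤ D ζ < t, so doubling t
  -- is enough.
  have hmeas : ∀ t, 0 < t → sphereMeasure n {ζ | D ζ < t} ≤
      ω⁻¹ * (C₀ * ENNReal.ofReal ((2 * t) ^ n)) := by
    intro t ht
    rw [sphereMeasure, Measure.smul_apply, smul_eq_mul]
    gcongr
    refine le_trans (measure_mono fun ζ hζ => ?_) (hK η hη (2 * t) (by linarith))
    have h1 : ‖inner ℂ η (ζ : Cn n)‖ ≤ 1 := by
      have := norm_inner_le_norm (𝕜 := ℂ) η (ζ : Cn n)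
      have hζ1 : ‖(ζ : Cn n)‖ = 1 := by simp
      rwa [hη, hζ1, one_mul] at this
    have h2 : (1 : ℂ) - inner ℂ η (ζ : Cn n) = (1 - inner ℂ a (ζ : Cn n)) -
        (δ : ℂ) * inner ℂ η (ζ : Cn n) := by
      have : inner ℂ a (ζ : Cn n) = (‖a‖ : ℂ) * inner ℂ η (ζ : Cn n) := by
        conv_lhs => rw [haη]
        rw [inner_smul_left, Complex.conj_ofReal]
      rw [this, hδ]; push_cast; ring
    change ‖_‖ < _
    rw [h2]
    refine (norm_sub_le _ _).trans_lt ?_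
    rw [norm_mul, Complex.norm_real, Real.norm_of_nonneg hδ0.le]
    have h3 : ‖1 - inner ℂ a (ζ : Cn n)‖ < t := hζ
    have h4 := hDδ ζ
    simp only [hD] at h4
    nlinarith
  -- Dyadic shells 2^k δ ≤ D < 2^{k+1} δ: the kernel is at most (2^k δ)^{-(n+c)} on a set of measure
  -- O((2^k δ)^n), which leaves δ^{-c} times a geometric series of ratio 2^{-c}.
  have hpt : ∀ ζ, ENNReal.ofReal (D ζ ^ (-(n + c))) ≤
      ∑' k : ℕ, {ζ | D ζ < 2 ^ (k + 1) * δ}.indicator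
        (fun _ => ENNReal.ofReal ((2 ^ k * δ) ^ (-(n + c)))) ζ := by
    intro ζ
    obtain ⟨k, hk1, hk2⟩ := exists_nat_pow_near ((one_le_div hδ0).2 (hDδ ζ)) one_lt_two
    rw [le_div_iff₀ hδ0] at hk1
    rw [div_lt_iff₀ hδ0] at hk2
    refine le_trans ?_ (ENNReal.le_tsum k)
    rw [indicator_of_mem (show ζ ∈ {ζ | D ζ < 2 ^ (k + 1) * δ} from hk2)]
    refine ENNReal.ofReal_le_ofReal ?_
    exact Real.rpow_le_rpow_of_nonpos (by positivity) hk1 (by have : (0 : ℝ) ≤ n := by positivity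
                                                              linarith)
  have hSm : ∀ k : ℕ, MeasurableSet {ζ | D ζ < 2 ^ (k + 1) * δ} := fun k =>
    measurableSet_lt hDm measurable_const
  calc ∫⁻ ζ : Metric.sphere (0 : Cn n) 1, ENNReal.ofReal (D ζ ^ (-(n + c))) ∂sphereMeasure n
      ≤ ∫⁻ ζ, ∑' k : ℕ, {ζ | D ζ < 2 ^ (k + 1) * δ}.indicator
        (fun _ => ENNReal.ofReal ((2 ^ k * δ) ^ (-(n + c)))) ζ ∂sphereMeasure n :=
        lintegral_mono hpt
    _ = ∑' k : ℕ, ENNReal.ofReal ((2 ^ k * δ) ^ (-(n + c))) *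
        sphereMeasure n {ζ | D ζ < 2 ^ (k + 1) * δ} := by
        rw [lintegral_tsum fun k => (measurable_const.indicator (hSm k)).aemeasurable]
        exact tsum_congr fun k => lintegral_indicator_const (hSm k) _
    _ ≤ ∑' k : ℕ, (ω⁻¹ * C₀ * ENNReal.ofReal (4 ^ n) * ENNReal.ofReal (δ ^ (-c))) * x ^ k := by
        refine ENNReal.tsum_le_tsum fun k => ?_
        refine (mul_le_mul_right (hmeas _ (by positivity)) _).trans (le_of_eq ?_)
        have hxk : x ^ k = ENNReal.ofReal ((2 ^ (-c)) ^ k) := by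
          rw [hx, ENNReal.ofReal_pow (by positivity)]
        have hre : (2 ^ k * δ) ^ (-(n + c)) * (2 * (2 ^ (k + 1) * δ)) ^ n =
            4 ^ n * δ ^ (-c) * (2 ^ (-c)) ^ k := by
          have e1 : (2 : ℝ) * (2 ^ (k + 1) * δ) = 4 * (2 ^ k * δ) := by rw [pow_succ]; ring
          have h0 : 0 < 2 ^ k * δ := by positivity
          rw [e1, mul_pow, neg_add, Real.rpow_add h0, Real.rpow_neg h0.le, Real.rpow_natCast,
            Real.mul_rpow (by positivity) hδ0.le, ← Real.rpow_natCast 2 k, ← Real.rpow_mul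
            zero_le_two, ← Real.rpow_natCast (2 ^ (-c)) k, ← Real.rpow_mul zero_le_two,
            mul_comm (k : ℝ) (-c)]
          field_simp
        rw [hxk, mul_left_comm, mul_left_comm _ C₀, ← ENNReal.ofReal_mul (by positivity), hre,
          ENNReal.ofReal_mul (by positivity), ENNReal.ofReal_mul (by positivity)]
        ring
    _ = _ := by rw [ENNReal.tsum_mul_left]; ring

/-! ### Radial integrals and norms of functions dominated by a Cauchy kernel. -/

theorem IsNormalFun.antitoneOn {φ : ℝ → ℝ} (hφ : IsNormalFun φ) : AntitoneOn φ (Ico 0 1) := by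
  obtain ⟨a, b, ha, hab, hanti, -, -, -⟩ := hφ.exists_exponents
  intro r hr s hs hrs
  have h1 : 0 < 1 - r := sub_pos.2 hr.2
  have h2 : 0 < 1 - s := sub_pos.2 hs.2
  have h := hanti hr hs hrs
  simp only at h
  rw [div_le_div_iff₀ (by positivity) (by positivity)] at h
  have h3 : (1 - s) ^ a ≤ (1 - r) ^ a := Real.rpow_le_rpow h2.le (by linarith) ha.le
  have h4 : 0 < φ r := hφ.pos r hr
  have h5 : 0 < (1 - r) ^ a := by positivity
  nlinarith [mul_le_mul_of_nonneg_left h3 h4.le]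

theorem lintegral_Ioo_rpow_le {ρ s : ℝ} (hρ : ρ < 1) (hs : 0 < s) :
    ∫⁻ r in Ioo ρ 1, ENNReal.ofReal ((1 - r) ^ (s - 1)) ≤
      ENNReal.ofReal ((1 - ρ) ^ s / s) := by
  have hi : IntervalIntegrable (fun r : ℝ => (1 - r) ^ (s - 1)) volume ρ 1 := by
    have h := (intervalIntegral.intervalIntegrable_rpow' (a := 0) (b := 1 - ρ)
      (r := s - 1) (by linarith)).comp_sub_left 1
    simp only [sub_zero, sub_sub_cancel] at h
    exact h.symm
  have hval : ∫ r in ρ..1, (1 - r) ^ (s - 1) = (1 - ρ) ^ s / s := by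
    rw [intervalIntegral.integral_comp_sub_left (fun x : ℝ => x ^ (s - 1)) 1, sub_self,
      integral_rpow (Or.inl (by linarith)), sub_add_cancel, Real.zero_rpow hs.ne', sub_zero]
  rw [← hval, intervalIntegral.integral_of_le hρ.le, ofReal_integral_eq_lintegral_ofReal hi.1]
  · exact lintegral_mono_set Ioo_subset_Ioc_self
  · filter_upwards [ae_restrict_mem measurableSet_Ioc] with r hr
    exact Real.rpow_nonneg (by linarith [hr.2]) _

theorem lintegral_Ioc_rpow_le {ρ s : ℝ} (hρ0 : 0 ≤ ρ) (hρ : ρ < 1) (hs : 0 < s) :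
    ∫⁻ r in Ioc 0 ρ, ENNReal.ofReal ((1 - r) ^ (-s - 1)) ≤
      ENNReal.ofReal ((1 - ρ) ^ (-s) / s) := by
  have hder : ∀ r ∈ uIcc 0 ρ, HasDerivAt (fun r : ℝ => (1 - r) ^ (-s) / s)
      ((1 - r) ^ (-s - 1)) r := by
    intro r hr
    rw [uIcc_of_le hρ0] at hr
    have h1 : 0 < 1 - r := by linarith [hr.2]
    have h := (((hasDerivAt_id r).const_sub 1).rpow_const (p := -s) (Or.inl h1.ne')).div_const s
    simp only [id] at h
    rwa [show -1 * -s * (1 - r) ^ (-s - 1) / s = (1 - r) ^ (-s - 1) by field_simp] at h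
  have hc : ContinuousOn (fun r : ℝ => (1 - r) ^ (-s - 1)) (uIcc 0 ρ) := by
    intro r hr
    rw [uIcc_of_le hρ0] at hr
    exact ((continuousAt_const.sub continuousAt_id).rpow_const
      (Or.inl (sub_pos.2 (hr.2.trans_lt hρ)).ne')).continuousWithinAt
  have hval := intervalIntegral.integral_eq_sub_of_hasDerivAt hder hc.intervalIntegrable
  rw [← ofReal_integral_eq_lintegral_ofReal hc.intervalIntegrable.1,
    ← intervalIntegral.integral_of_le hρ0, hval]
  · refine ENNReal.ofReal_le_ofReal (sub_le_self _ ?_)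
    simp only [sub_zero, Real.one_rpow]
    positivity
  · filter_upwards [ae_restrict_mem measurableSet_Ioc] with r hr
    exact Real.rpow_nonneg (by linarith [hr.2]) _

/-- A uniform bound in `H(p,q,φ)` for functions dominated by normalized powers of the Cauchy
kernel. -/
theorem exists_mixedNormPow_le_of_kernel_bound (hn : 1 ≤ n) {p q : ℝ} (hp : 0 < p) (hq : 0 < q)
    {φ : ℝ → ℝ} (hφ : IsNormalFun φ) :
    ∃ β : ℝ, 0 < β ∧ ∀ A : ℝ, 0 < A → ∃ C : ℝ≥0∞, C ≠ ∞ ∧ ∀ w ∈ unitBall n, ∀ f : Cn n → ℂ,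
      (∀ z ∈ unitBall n, ‖f z‖ ≤
        A * ((1 - ‖w‖) ^ β / φ ‖w‖ * ‖1 - inner ℂ w z‖ ^ (-(n / q + β)))) →
      mixedNormPow p q φ f ≤ C := by
  obtain ⟨a, b, ha, hab, hanti, -, hmono, -⟩ := hφ.exists_exponents
  have hb : 0 < b := ha.trans hab
  -- β must exceed b: on r ≤ |w| the decay of the kernel has to beat the growth of φ(r) / φ(|w|),
  -- and one spare power makes the integral concentrate near r = |w|.
  have hβ : 0 < b + 1 := by linarith
  set β := b + 1 with hβdef
  obtain ⟨C₁, hC₁, hker⟩ := exists_lintegral_kernel_le hn (c := β * q) (by positivity)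
  refine ⟨β, hβ, fun A hA => ?_⟩
  set K : ℝ≥0∞ := C₁ ^ (1 / q * p) * ENNReal.ofReal (A ^ p) with hK
  have hKt : K ≠ ∞ := by
    refine ENNReal.mul_ne_top (ENNReal.rpow_ne_top_of_nonneg (by positivity) hC₁) (by simp)
  refine ⟨K * (ENNReal.ofReal (1 / p) + ENNReal.ofReal (1 / (a * p))), by finiteness,
    fun w hw f hf => ?_⟩
  rw [mem_ball_zero_iff] at hw
  set ρ := ‖w‖ with hρ
  have hρ0 : 0 ≤ ρ := norm_nonneg w
  have hφρ : 0 < φ ρ := hφ.pos ρ ⟨hρ0, hw⟩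
  have h1ρ : 0 < 1 - ρ := by linarith
  -- On the sphere of radius r the kernel at w becomes the kernel at rw with exponent n + βq, whose
  -- integral is O((1 - rρ)^{-βq}).
  have hM : ∀ r ∈ Ioo (0 : ℝ) 1, integralMean q f r ^ p ≤
      K * ENNReal.ofReal (((1 - ρ) ^ β / φ ρ * (1 - r * ρ) ^ (-β)) ^ p) := by
    intro r hr
    have hrρ : 0 < 1 - r * ρ := by nlinarith [hr.1, hr.2]
    have hpow : integralMeanPow q f r ≤
        C₁ * ENNReal.ofReal ((A * ((1 - ρ) ^ β / φ ρ * (1 - r * ρ) ^ (-β))) ^ q) := by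
      have hnra : ‖(r : ℂ) • w‖ = r * ρ := by
        rw [norm_smul, Complex.norm_real, Real.norm_of_nonneg hr.1.le]
      have hk := hker ((r : ℂ) • w) (by
        rw [mem_ball_zero_iff, hnra]; linarith)
      rw [hnra] at hk
      set B : ℝ := A * ((1 - ρ) ^ β / φ ρ) with hB
      have hB0 : 0 ≤ B := by positivity
      calc integralMeanPow q f r
          ≤ ∫⁻ ζ : Metric.sphere (0 : Cn n) 1, ENNReal.ofReal (B ^ q) * ENNReal.ofReal
            (‖1 - inner ℂ ((r : ℂ) • w) (ζ : Cn n)‖ ^ (-(n + β * q))) ∂sphereMeasure n := by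
            refine lintegral_mono fun ζ => ?_
            have h := hf _ (smul_sphere_mem hr ζ)
            rw [← mul_assoc, inner_smul_right] at h
            rw [inner_smul_left, Complex.conj_ofReal, ← ofReal_norm,
              ENNReal.ofReal_rpow_of_nonneg (norm_nonneg _) hq.le,
              ← ENNReal.ofReal_mul (by positivity)]
            refine ENNReal.ofReal_le_ofReal ?_
            refine (Real.rpow_le_rpow (norm_nonneg _) h hq.le).trans (le_of_eq ?_)
            rw [Real.mul_rpow hB0 (by positivity), ← Real.rpow_mul (norm_nonneg _)]
            congr 2
            field_simp
        _ ≤ ENNReal.ofReal (B ^ q) * (C₁ * ENNReal.ofReal ((1 - r * ρ) ^ (-(β * q)))) := by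
            rw [lintegral_const_mul' _ _ ENNReal.ofReal_ne_top]
            gcongr
        _ = _ := by
            rw [mul_left_comm, ← ENNReal.ofReal_mul (by positivity)]
            congr 2
            rw [← mul_assoc, Real.mul_rpow hB0 (by positivity), ← Real.rpow_mul hrρ.le, neg_mul]
    calc integralMean q f r ^ p = integralMeanPow q f r ^ (1 / q * p) := by
          rw [integralMean, ← ENNReal.rpow_mul]
      _ ≤ (C₁ * ENNReal.ofReal ((A * ((1 - ρ) ^ β / φ ρ * (1 - r * ρ) ^ (-β))) ^ q)) ^
            (1 / q * p) := ENNReal.rpow_le_rpow hpow (by positivity)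
      _ = _ := by
          rw [ENNReal.mul_rpow_of_nonneg _ _ (by positivity), hK, mul_assoc,
            ENNReal.ofReal_rpow_of_nonneg (by positivity) (by positivity),
            ← ENNReal.ofReal_mul (by positivity), ← Real.rpow_mul (by positivity)]
          congr 2
          rw [show q * (1 / q * p) = p by field_simp, Real.mul_rpow hA.le (by positivity)]
  -- For r ≤ ρ use 1 - rρ ≥ 1 - r and the upper exponent b.
  have hlow : ∀ r ∈ Ioc (0 : ℝ) ρ, ((1 - ρ) ^ β / φ ρ * (1 - r * ρ) ^ (-β)) ^ p *
      (φ r ^ p / (1 - r)) ≤ (1 - ρ) ^ p * (1 - r) ^ (-p - 1) := by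
    intro r hr
    have hr1 : r < 1 := hr.2.trans_lt hw
    have h1r : 0 < 1 - r := by linarith
    have hrρ : 0 < 1 - r * ρ := by nlinarith [hr.1, hr.2]
    have hφr : 0 < φ r := hφ.pos r ⟨hr.1.le, hr1⟩
    have h := hmono ⟨hr.1.le, hr1⟩ ⟨hρ0, hw⟩ hr.2
    simp only at h
    rw [div_le_iff₀ (by positivity)] at h
    have h2 : (1 - r * ρ) ^ (-β) ≤ (1 - r) ^ (-β) :=
      Real.rpow_le_rpow_of_nonpos h1r (by nlinarith [hr.1]) (by linarith)
    have h3 : (1 - ρ) ^ β / φ ρ * (1 - r * ρ) ^ (-β) * φ r ≤ (1 - ρ) * (1 - r)⁻¹ := by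
      calc (1 - ρ) ^ β / φ ρ * (1 - r * ρ) ^ (-β) * φ r
          ≤ (1 - ρ) ^ β / φ ρ * (1 - r) ^ (-β) * (φ ρ / (1 - ρ) ^ b * (1 - r) ^ b) := by
            gcongr
        _ = _ := by
            rw [hβdef, neg_add, Real.rpow_add h1ρ, Real.rpow_add h1r, Real.rpow_one,
              Real.rpow_neg_one, Real.rpow_neg h1r.le]
            field_simp
    calc ((1 - ρ) ^ β / φ ρ * (1 - r * ρ) ^ (-β)) ^ p * (φ r ^ p / (1 - r))
        = ((1 - ρ) ^ β / φ ρ * (1 - r * ρ) ^ (-β) * φ r) ^ p / (1 - r) := by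
          rw [Real.mul_rpow (by positivity) hφr.le, mul_div_assoc]
      _ ≤ ((1 - ρ) * (1 - r)⁻¹) ^ p / (1 - r) := by gcongr
      _ = _ := by
          rw [Real.mul_rpow h1ρ.le (by positivity), Real.rpow_sub h1r, Real.rpow_one,
            Real.rpow_neg h1r.le, Real.inv_rpow h1r.le, mul_div_assoc]
  -- For r > ρ use 1 - rρ ≥ 1 - ρ and the lower exponent a > 0, which makes the integral converge at
  -- 1.
  have hhigh : ∀ r ∈ Ioo ρ 1, ((1 - ρ) ^ β / φ ρ * (1 - r * ρ) ^ (-β)) ^ p *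
      (φ r ^ p / (1 - r)) ≤ (1 - ρ) ^ (-(a * p)) * (1 - r) ^ (a * p - 1) := by
    intro r hr
    have hr0 : 0 ≤ r := hρ0.trans hr.1.le
    have h1r : 0 < 1 - r := by linarith [hr.2]
    have hrρ : 0 < 1 - r * ρ := by nlinarith [hr.1, hr.2]
    have hφr : 0 < φ r := hφ.pos r ⟨hr0, hr.2⟩
    have h := hanti ⟨hρ0, hw⟩ ⟨hr0, hr.2⟩ hr.1.le
    simp only at h
    rw [div_le_iff₀ (by positivity)] at h
    have h2 : (1 - r * ρ) ^ (-β) ≤ (1 - ρ) ^ (-β) :=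
      Real.rpow_le_rpow_of_nonpos h1ρ (by nlinarith [hr.2]) (by linarith)
    have h3 : (1 - ρ) ^ β / φ ρ * (1 - r * ρ) ^ (-β) * φ r ≤ (1 - ρ) ^ (-a) * (1 - r) ^ a := by
      calc (1 - ρ) ^ β / φ ρ * (1 - r * ρ) ^ (-β) * φ r
          ≤ (1 - ρ) ^ β / φ ρ * (1 - ρ) ^ (-β) * (φ ρ / (1 - ρ) ^ a * (1 - r) ^ a) := by
            gcongr
        _ = _ := by
            rw [Real.rpow_neg h1ρ.le, Real.rpow_neg h1ρ.le]
            field_simp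
    calc ((1 - ρ) ^ β / φ ρ * (1 - r * ρ) ^ (-β)) ^ p * (φ r ^ p / (1 - r))
        = ((1 - ρ) ^ β / φ ρ * (1 - r * ρ) ^ (-β) * φ r) ^ p / (1 - r) := by
          rw [Real.mul_rpow (by positivity) hφr.le, mul_div_assoc]
      _ ≤ ((1 - ρ) ^ (-a) * (1 - r) ^ a) ^ p / (1 - r) := by gcongr
      _ = _ := by
          rw [Real.mul_rpow (by positivity) (by positivity), ← Real.rpow_mul h1ρ.le,
            ← Real.rpow_mul h1r.le, Real.rpow_sub h1r, Real.rpow_one, neg_mul, mul_div_assoc]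
  have hint : ∀ r ∈ Ioo (0 : ℝ) 1,
      integralMean q f r ^ p * ENNReal.ofReal (φ r ^ p / (1 - r)) ≤
      K * ENNReal.ofReal (((1 - ρ) ^ β / φ ρ * (1 - r * ρ) ^ (-β)) ^ p * (φ r ^ p / (1 - r))) := by
    intro r hr
    have hrρ : 0 < 1 - r * ρ := by nlinarith [hr.1, hr.2]
    rw [ENNReal.ofReal_mul (by positivity), ← mul_assoc]
    gcongr
    exact hM r hr
  unfold mixedNormPow
  refine (setLIntegral_mono' measurableSet_Ioo hint).trans ?_
  rw [lintegral_const_mul' _ _ hKt]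
  refine mul_le_mul_right ?_ K
  calc ∫⁻ r in Ioo (0 : ℝ) 1, ENNReal.ofReal
        (((1 - ρ) ^ β / φ ρ * (1 - r * ρ) ^ (-β)) ^ p * (φ r ^ p / (1 - r)))
      ≤ ∫⁻ r in Ioc (0 : ℝ) ρ ∪ Ioo ρ 1, ENNReal.ofReal
        (((1 - ρ) ^ β / φ ρ * (1 - r * ρ) ^ (-β)) ^ p * (φ r ^ p / (1 - r))) :=
        lintegral_mono_set fun r hr => by
          rcases le_or_gt r ρ with h | h
          · exact Or.inl ⟨hr.1, h⟩
          · exact Or.inr ⟨h, hr.2⟩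
    _ ≤ _ := lintegral_union_le _ _ _
    _ ≤ (∫⁻ r in Ioc (0 : ℝ) ρ, ENNReal.ofReal ((1 - ρ) ^ p) *
          ENNReal.ofReal ((1 - r) ^ (-p - 1))) +
        ∫⁻ r in Ioo ρ 1, ENNReal.ofReal ((1 - ρ) ^ (-(a * p))) *
          ENNReal.ofReal ((1 - r) ^ (a * p - 1)) := by
        refine add_le_add (setLIntegral_mono' measurableSet_Ioc fun r hr => ?_)
          (setLIntegral_mono' measurableSet_Ioo fun r hr => ?_)
        · rw [← ENNReal.ofReal_mul (by positivity)]
          exact ENNReal.ofReal_le_ofReal (hlow r hr)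
        · rw [← ENNReal.ofReal_mul (by positivity)]
          exact ENNReal.ofReal_le_ofReal (hhigh r hr)
    _ ≤ _ := by
        rw [lintegral_const_mul' _ _ ENNReal.ofReal_ne_top,
          lintegral_const_mul' _ _ ENNReal.ofReal_ne_top]
        refine add_le_add
          ((mul_le_mul_right (lintegral_Ioc_rpow_le hρ0 hw hp) _).trans (le_of_eq ?_))
          ((mul_le_mul_right (lintegral_Ioo_rpow_le hw (by positivity)) _).trans (le_of_eq ?_))
        · rw [← ENNReal.ofReal_mul (by positivity), Real.rpow_neg h1ρ.le]
          congr 1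
          field_simp
        · rw [← ENNReal.ofReal_mul (by positivity), Real.rpow_neg h1ρ.le]
          congr 1
          field_simp

/-! ### The growth weight and its doubling property. -/

/-- The weight `1 / (φ(r) (1 - r)^{n/q})` that controls the growth of functions in `H(p,q,φ)`. -/
def growthWeight (n : ℕ) (q : ℝ) (φ : ℝ → ℝ) (r : ℝ) : ℝ := (φ r * (1 - r) ^ (n / q))⁻¹

theorem growthWeight_pos {φ : ℝ → ℝ} (hφ : IsNormalFun φ) (n : ℕ) (q : ℝ) {r : ℝ}
    (hr : r ∈ Ico (0 : ℝ) 1) : 0 < growthWeight n q φ r := by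
  have h1 := hφ.pos r hr
  have h2 : 0 < 1 - r := sub_pos.2 hr.2
  unfold growthWeight
  positivity

theorem growthWeight_monotoneOn {φ : ℝ → ℝ} (hφ : IsNormalFun φ) (n : ℕ) {q : ℝ} (hq : 0 < q) :
    MonotoneOn (growthWeight n q φ) (Ico 0 1) := by
  intro r hr s hs hrs
  have h1 := hφ.pos s hs
  have h2 : 0 < 1 - s := sub_pos.2 hs.2
  have h3 := hφ.pos r hr
  unfold growthWeight
  refine inv_anti₀ (by positivity) ?_
  have := hφ.antitoneOn hr hs hrs
  gcongr

/-- The monotonicity of φ(r)/(1-r)^b in multiplicative form: φ loses at most a constant factor when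
1 - r shrinks by a constant factor. It is applied with ratios 2 and 8. -/
theorem IsNormalFun.exists_le_mul {φ : ℝ → ℝ} (hφ : IsNormalFun φ) :
    ∃ b : ℝ, 0 < b ∧ ∀ r s : ℝ, r ∈ Ico (0 : ℝ) 1 → s ∈ Ico (0 : ℝ) 1 → r ≤ s →
      φ r ≤ ((1 - r) / (1 - s)) ^ b * φ s := by
  obtain ⟨a, b, ha, hab, -, -, hmono, -⟩ := hφ.exists_exponents
  refine ⟨b, ha.trans hab, fun r s hr hs hrs => ?_⟩
  have h1 : 0 < 1 - r := sub_pos.2 hr.2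
  have h2 : 0 < 1 - s := sub_pos.2 hs.2
  have h := hmono hr hs hrs
  simp only at h
  rw [div_le_iff₀ (by positivity)] at h
  refine h.trans (le_of_eq ?_)
  rw [Real.div_rpow h1.le h2.le]
  ring

/-- Halving 1 - r costs 2^b through φ and 2^{n/q} through the power. This lets Cauchy estimates at
radius (1+|z|)/2 be stated with the weight at |z|. -/
theorem exists_growthWeight_doubling {φ : ℝ → ℝ} (hφ : IsNormalFun φ) (n : ℕ) (q : ℝ) :
    ∃ D : ℝ, 0 < D ∧ ∀ r ∈ Ico (0 : ℝ) 1,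
      growthWeight n q φ ((1 + r) / 2) ≤ D * growthWeight n q φ r := by
  obtain ⟨b, hb, hle⟩ := hφ.exists_le_mul
  refine ⟨2 ^ b * 2 ^ (n / q), by positivity, fun r hr => ?_⟩
  have h1 : 0 < 1 - r := sub_pos.2 hr.2
  have hs : (1 + r) / 2 ∈ Ico (0 : ℝ) 1 := ⟨by linarith [hr.1], by linarith [hr.2]⟩
  have h := hle r _ hr hs (by linarith [hr.2])
  have e : (1 - r) / (1 - (1 + r) / 2) = 2 := by
    rw [div_eq_iff (by linarith)]; ring
  rw [e] at h
  have hφr := hφ.pos r hr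
  have hφs := hφ.pos _ hs
  have e2 : (1 - (1 + r) / 2) = (1 - r) / 2 := by ring
  unfold growthWeight
  rw [e2, Real.div_rpow h1.le zero_le_two, ← div_eq_mul_inv, inv_le_comm₀ (by positivity)
    (by positivity), inv_div, div_le_iff₀ (by positivity)]
  calc φ r * (1 - r) ^ (n / q) ≤ (2 ^ b * φ ((1 + r) / 2)) * (1 - r) ^ (n / q) := by gcongr
    _ = _ := by field_simp

/-- Functions in `H(p,q,φ)` are bounded pointwise by the growth weight. -/
theorem exists_enorm_le_mixedNorm (hn : 1 ≤ n) {p q : ℝ} (hp : 0 < p) (hq : 0 < q)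
    {φ : ℝ → ℝ} (hφ : IsNormalFun φ) :
    ∃ C : ℝ≥0∞, C ≠ ∞ ∧ ∀ f : Cn n → ℂ, AnalyticOnNhd ℂ f (unitBall n) → ∀ z ∈ unitBall n,
      ‖f z‖ₑ ≤ C * ENNReal.ofReal (growthWeight n q φ ‖z‖) * mixedNorm p q φ f := by
  obtain ⟨C, hC, hCf⟩ := exists_enorm_rpow_le_integralMeanPow hn hq
  obtain ⟨b, hb, hle⟩ := hφ.exists_le_mul
  refine ⟨C ^ (1 / q) * ENNReal.ofReal (2 ^ (1 / p) * 8 ^ b), ?_, fun f hf z hz => ?_⟩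
  · exact ENNReal.mul_ne_top (ENNReal.rpow_ne_top_of_nonneg (by positivity) hC) (by simp)
  have h0 := hCf f hf z hz
  rw [mem_ball_zero_iff] at hz
  set ρ := ‖z‖ with hρ
  set δ := 1 - ρ with hδ
  have hρ0 : 0 ≤ ρ := norm_nonneg z
  have hδ0 : 0 < δ := by linarith
  set m := integralMeanPow q f (1 - δ / 4) with hm
  have hφρ := hφ.pos ρ ⟨hρ0, hz⟩
  have h3 : 1 - δ / 8 ∈ Ico (0 : ℝ) 1 := ⟨by linarith, by linarith⟩
  have hφ3 := hφ.pos _ h3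
  have hd := hle ρ (1 - δ / 8) ⟨hρ0, hz⟩ h3 (by linarith)
  rw [show (1 - ρ) / (1 - (1 - δ / 8)) = 8 by
    rw [div_eq_iff (by linarith)]; rw [← hδ]; ring] at hd
  -- On this shell the mean is at least m, φ is at least its value at the outer radius, and 1/(1-r)
  -- ≥ 4/δ. The length δ/8 leaves the factor 1/2, free of δ.
  have hlow : m ^ (1 / q * p) * ENNReal.ofReal (φ (1 - δ / 8) ^ p / 2) ≤ mixedNormPow p q φ f := by
    calc m ^ (1 / q * p) * ENNReal.ofReal (φ (1 - δ / 8) ^ p / 2)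
        = ∫⁻ _ in Ioo (1 - δ / 4) (1 - δ / 8),
            m ^ (1 / q * p) * ENNReal.ofReal (φ (1 - δ / 8) ^ p / (δ / 4)) := by
          rw [setLIntegral_const, Real.volume_Ioo, mul_assoc, ← ENNReal.ofReal_mul (by positivity)]
          congr 2
          field_simp
          ring
      _ ≤ ∫⁻ r in Ioo (1 - δ / 4) (1 - δ / 8),
            integralMean q f r ^ p * ENNReal.ofReal (φ r ^ p / (1 - r)) := by
          refine setLIntegral_mono' measurableSet_Ioo fun r hr => ?_
          have hr0 : 0 ≤ r := by linarith [hr.1]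
          have hr1 : r < 1 := by linarith [hr.2]
          have hφr := hφ.pos r ⟨hr0, hr1⟩
          have h1r : 0 < 1 - r := by linarith
          rw [integralMean, ← ENNReal.rpow_mul]
          gcongr
          · exact integralMeanPow_mono hf hq (by linarith) hr.1.le hr1
          · exact hφ.antitoneOn ⟨hr0, hr1⟩ h3 hr.2.le
          · linarith [hr.1]
      _ ≤ _ := lintegral_mono_set (Ioo_subset_Ioo (by linarith) (by linarith))
  have hm1 : m ^ (1 / q) ≤ ENNReal.ofReal (2 ^ (1 / p) * 8 ^ b / φ ρ) * mixedNorm p q φ f := by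
    have h1 : m ^ (1 / q) = ENNReal.ofReal (2 ^ (1 / p) / φ (1 - δ / 8)) *
        (m ^ (1 / q * p) * ENNReal.ofReal (φ (1 - δ / 8) ^ p / 2)) ^ (1 / p) := by
      rw [ENNReal.mul_rpow_of_nonneg _ _ (by positivity), ← ENNReal.rpow_mul,
        ENNReal.ofReal_rpow_of_nonneg (by positivity) (by positivity), mul_left_comm,
        ← ENNReal.ofReal_mul (by positivity), Real.div_rpow (by positivity) (by positivity),
        ← Real.rpow_mul hφ3.le, mul_one_div_cancel hp.ne', Real.rpow_one,
        show 2 ^ (1 / p) / φ (1 - δ / 8) * (φ (1 - δ / 8) / 2 ^ (1 / p)) = 1 by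
          rw [div_mul_div_comm, mul_comm, div_self (by positivity)],
        ENNReal.ofReal_one, mul_one]
      congr 1
      field_simp
    rw [h1]
    refine mul_le_mul' (ENNReal.ofReal_le_ofReal ?_) (ENNReal.rpow_le_rpow hlow (by positivity))
    rw [div_le_div_iff₀ hφ3 hφρ]
    calc 2 ^ (1 / p) * φ ρ ≤ 2 ^ (1 / p) * (8 ^ b * φ (1 - δ / 8)) := by gcongr
      _ = _ := by ring
  calc ‖f z‖ₑ = (‖f z‖ₑ ^ q) ^ (1 / q) := by
        rw [← ENNReal.rpow_mul, mul_one_div_cancel hq.ne', ENNReal.rpow_one]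
    _ ≤ (C * ENNReal.ofReal ((δ ^ n)⁻¹) * m) ^ (1 / q) := by gcongr
    _ = C ^ (1 / q) * ENNReal.ofReal ((δ ^ (n / q))⁻¹) * m ^ (1 / q) := by
        rw [ENNReal.mul_rpow_of_nonneg _ _ (by positivity),
          ENNReal.mul_rpow_of_nonneg _ _ (by positivity),
          ENNReal.ofReal_rpow_of_nonneg (by positivity) (by positivity),
          Real.inv_rpow (by positivity), ← Real.rpow_natCast, ← Real.rpow_mul hδ0.le,
          mul_one_div]
    _ ≤ C ^ (1 / q) * ENNReal.ofReal ((δ ^ (n / q))⁻¹) *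
        (ENNReal.ofReal (2 ^ (1 / p) * 8 ^ b / φ ρ) * mixedNorm p q φ f) := by gcongr
    _ = C ^ (1 / q) * (ENNReal.ofReal ((δ ^ (n / q))⁻¹) *
        ENNReal.ofReal (2 ^ (1 / p) * 8 ^ b / φ ρ)) * mixedNorm p q φ f := by ring
    _ = C ^ (1 / q) * (ENNReal.ofReal (2 ^ (1 / p) * 8 ^ b) *
        ENNReal.ofReal (growthWeight n q φ ρ)) * mixedNorm p q φ f := by
        rw [← ENNReal.ofReal_mul (by positivity), ← ENNReal.ofReal_mul (by positivity)]
        congr 3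
        rw [growthWeight, ← hδ]
        field_simp
    _ = _ := by ring

/-! ### Cauchy estimates along complex lines. -/

theorem hasDerivAt_slice {f : Cn n → ℂ} {z : Cn n} {w : ℂ} (hf : AnalyticAt ℂ f (w • z)) :
    HasDerivAt (fun x : ℂ => f (x • z)) (fderiv ℂ f (w • z) z) w := by
  have h1 : HasDerivAt (fun x : ℂ => x • z) z w := by
    simpa using (hasDerivAt_id w).smul_const z
  exact hf.differentiableAt.hasFDerivAt.comp_hasDerivAt w h1

theorem norm_smul_le_half {z : Cn n} (hz : ‖z‖ < 1) {x : ℂ}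
    (hx : ‖x - 1‖ ≤ (1 - ‖z‖) / 2) : ‖x • z‖ ≤ (1 + ‖z‖) / 2 := by
  have h1 : ‖x‖ ≤ 1 + (1 - ‖z‖) / 2 := by
    have := norm_le_norm_add_norm_sub' x 1
    rw [norm_one] at this; linarith
  rw [norm_smul]
  nlinarith [norm_nonneg z]

/-- Cauchy's estimate for the radial derivative. -/
theorem norm_radialDeriv_le {h : Cn n → ℂ} (hh : AnalyticOnNhd ℂ h (unitBall n)) {z : Cn n}
    (hz : z ∈ unitBall n) {B : ℝ} (hB : ∀ x, ‖x‖ ≤ (1 + ‖z‖) / 2 → ‖h x‖ ≤ B) :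
    ‖radialDeriv h z‖ ≤ 2 * B / (1 - ‖z‖) := by
  rw [mem_ball_zero_iff] at hz
  -- The radial derivative is the derivative of x ↦ h(xz) at x = 1, so the one-variable estimate on
  -- this disc suffices.
  have hR : 0 < (1 - ‖z‖) / 2 := by linarith
  have hle : ∀ x ∈ Metric.closedBall (1 : ℂ) ((1 - ‖z‖) / 2), ‖x • z‖ ≤ (1 + ‖z‖) / 2 := by
    intro x hx
    rw [Metric.mem_closedBall, dist_eq_norm] at hx
    exact norm_smul_le_half hz hx
  have han : AnalyticOnNhd ℂ (fun x : ℂ => h (x • z))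
      (Metric.closedBall (1 : ℂ) ((1 - ‖z‖) / 2)) :=
    analyticOnNhd_slice hh z fun x hx => by
      rw [mem_ball_zero_iff]; linarith [hle x hx]
  have hder := Complex.norm_deriv_le_of_forall_mem_sphere_norm_le hR
    (DifferentiableOn.diffContOnCl (by
      rw [closure_ball _ hR.ne']; exact han.differentiableOn))
    (C := B) fun x hx => hB _ (hle x (Metric.sphere_subset_closedBall hx))
  have heq : deriv (fun x : ℂ => h (x • z)) 1 = radialDeriv h z := by
    have := (hasDerivAt_slice (w := 1) (f := h) (z := z)
      (hh _ (by rw [one_smul, mem_ball_zero_iff]; exact hz))).deriv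
    rwa [one_smul] at this
  rw [heq] at hder
  refine hder.trans (le_of_eq ?_)
  field_simp

/-- Growth estimates for the first two radial derivatives. -/
theorem norm_radialDeriv_le_of_growth {ψ : ℝ → ℝ} (hψ : MonotoneOn ψ (Ico 0 1))
    (hψ0 : ∀ r ∈ Ico (0 : ℝ) 1, 0 ≤ ψ r) {D : ℝ} (hD : 0 < D)
    (hψD : ∀ r ∈ Ico (0 : ℝ) 1, ψ ((1 + r) / 2) ≤ D * ψ r) {h : Cn n → ℂ}
    (hh : AnalyticOnNhd ℂ h (unitBall n)) {A : ℝ} (hA : 0 ≤ A)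
    (hb : ∀ z ∈ unitBall n, ‖h z‖ ≤ A * ψ ‖z‖) {z : Cn n} (hz : z ∈ unitBall n) :
    ‖radialDeriv h z‖ ≤ 2 * D * A * ψ ‖z‖ / (1 - ‖z‖) ∧
      ‖radialDeriv (radialDeriv h) z‖ ≤ 8 * D ^ 2 * A * ψ ‖z‖ / (1 - ‖z‖) ^ 2 := by
  have hstep : ∀ x y : Cn n, x ∈ unitBall n → ‖y‖ ≤ (1 + ‖x‖) / 2 →
      y ∈ unitBall n ∧ ψ ‖y‖ ≤ D * ψ ‖x‖ := by
    intro x y hx hy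
    rw [mem_ball_zero_iff] at hx ⊢
    have hx0 := norm_nonneg x
    refine ⟨by linarith, (hψ ⟨norm_nonneg y, by linarith⟩ ⟨by linarith, by linarith⟩ hy).trans
      (hψD _ ⟨hx0, hx⟩)⟩
  have h1 : ∀ x ∈ unitBall n, ‖radialDeriv h x‖ ≤ 2 * D * A * ψ ‖x‖ / (1 - ‖x‖) := by
    intro x hx
    have hx1 : 0 < 1 - ‖x‖ := by rw [mem_ball_zero_iff] at hx; linarith
    refine (norm_radialDeriv_le hh hx (B := A * (D * ψ ‖x‖)) fun y hy => ?_).trans (le_of_eq ?_)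
    · obtain ⟨hy1, hy2⟩ := hstep x y hx hy
      exact (hb y hy1).trans (by gcongr)
    · ring
  refine ⟨h1 z hz, ?_⟩
  have hz1 : 0 < 1 - ‖z‖ := by rw [mem_ball_zero_iff] at hz; linarith
  -- The first estimate is used at |y| ≤ (1+|z|)/2, where 1 - |y| ≥ (1-|z|)/2; this costs a second
  -- factor D, and 8 = 2·2·2.
  refine (norm_radialDeriv_le (radialDeriv_analytic hh) hz
    (B := 2 * D * A * (D * ψ ‖z‖) / ((1 - ‖z‖) / 2)) fun y hy => ?_).trans (le_of_eq ?_)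
  · obtain ⟨hy1, hy2⟩ := hstep z y hz hy
    have hy3 : 0 ≤ D * ψ ‖z‖ := mul_nonneg hD.le (hψ0 _ ⟨norm_nonneg z, by linarith⟩)
    refine (h1 y hy1).trans ?_
    gcongr
    linarith
  · field_simp
    ring

/-! ### The Riemann-Stieltjes operator and its radial derivatives. -/

/-- The direction tz in the radial derivative carries a factor t that cancels 1/t; the new integrand
is continuous up to t = 0. -/
theorem rsOperator_apply {f g : Cn n → ℂ} {z : Cn n} (hz : z ∈ unitBall n) :
    rsOperator g f z =
      ∫ t in (0 : ℝ)..1, fderiv ℂ f ((t : ℂ) • z) z * g ((t : ℂ) • z) := by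
  rw [rsOperator, indicator_of_mem hz]
  refine intervalIntegral.integral_congr_ae (Eventually.of_forall fun t ht => ?_)
  rw [uIoc_of_le zero_le_one] at ht
  have : (t : ℂ) ≠ 0 := by exact_mod_cast ht.1.ne'
  simp only [radialDeriv, map_smul, smul_eq_mul]
  field_simp

theorem continuousOn_rsIntegrand {f g : Cn n → ℂ} (hf : AnalyticOnNhd ℂ f (unitBall n))
    (hg : AnalyticOnNhd ℂ g (unitBall n)) (z : Cn n) :
    ContinuousOn (fun t : ℝ => fderiv ℂ f ((t : ℂ) • z) z * g ((t : ℂ) • z))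
      {t : ℝ | (t : ℂ) • z ∈ unitBall n} := by
  have hc : ContinuousOn (fun t : ℝ => (t : ℂ) • z) {t : ℝ | (t : ℂ) • z ∈ unitBall n} :=
    Continuous.continuousOn (by fun_prop)
  exact ((hf.fderiv.continuousOn.comp hc fun t ht => ht).clm_apply continuousOn_const).mul
    (hg.continuousOn.comp hc fun t ht => ht)

theorem smul_mem_unitBall {z : Cn n} (hz : z ∈ unitBall n) {t : ℝ} (ht : t ∈ Icc (0 : ℝ) 1) :
    (t : ℂ) • z ∈ unitBall n := by
  rw [mem_ball_zero_iff] at hz ⊢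
  rw [norm_smul, Complex.norm_real, Real.norm_of_nonneg ht.1]
  exact (mul_le_of_le_one_left (norm_nonneg _) ht.2).trans_lt hz

theorem intervalIntegrable_rsIntegrand {f g : Cn n → ℂ} (hf : AnalyticOnNhd ℂ f (unitBall n))
    (hg : AnalyticOnNhd ℂ g (unitBall n)) {z : Cn n} (hz : z ∈ unitBall n) :
    IntervalIntegrable (fun t : ℝ => fderiv ℂ f ((t : ℂ) • z) z * g ((t : ℂ) • z))
      volume 0 1 := by
  refine ContinuousOn.intervalIntegrable ((continuousOn_rsIntegrand hf hg z).mono fun t ht => ?_)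
  rw [uIcc_of_le zero_le_one] at ht
  exact smul_mem_unitBall hz ht

theorem rsOperator_zero (f g : Cn n → ℂ) : rsOperator g f 0 = 0 := by
  rw [rsOperator_apply (by simp)]
  simp

theorem rsOperator_add {f₁ f₂ g : Cn n → ℂ} (hf₁ : AnalyticOnNhd ℂ f₁ (unitBall n))
    (hf₂ : AnalyticOnNhd ℂ f₂ (unitBall n)) (hg : AnalyticOnNhd ℂ g (unitBall n)) :
    rsOperator g (f₁ + f₂) = rsOperator g f₁ + rsOperator g f₂ := by
  ext z
  by_cases hz : z ∈ unitBall n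
  · rw [Pi.add_apply, rsOperator_apply hz, rsOperator_apply hz, rsOperator_apply hz,
      ← intervalIntegral.integral_add (intervalIntegrable_rsIntegrand hf₁ hg hz)
      (intervalIntegrable_rsIntegrand hf₂ hg hz)]
    refine intervalIntegral.integral_congr fun t ht => ?_
    rw [uIcc_of_le zero_le_one] at ht
    have hm := smul_mem_unitBall hz ht
    rw [fderiv_add (hf₁ _ hm).differentiableAt (hf₂ _ hm).differentiableAt,
      _root_.add_apply, add_mul]
  · simp [rsOperator, hz]

theorem rsOperator_smul (c : ℂ) (f g : Cn n → ℂ) :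
    rsOperator g (c • f) = c • rsOperator g f := by
  ext z
  by_cases hz : z ∈ unitBall n
  · rw [Pi.smul_apply, rsOperator_apply hz, rsOperator_apply hz, smul_eq_mul,
      ← intervalIntegral.integral_const_mul]
    refine intervalIntegral.integral_congr fun t ht => ?_
    rw [fderiv_const_smul_field]
    simp [mul_assoc]
  · simp [rsOperator, hz]

/-- By substitution L_g f(xz) is the integral of J from 0 to x, and the fundamental theorem of
calculus at x = 1 gives J(1). Analyticity of L_g f, assumed here and later supplied by boundedness
of L_g, identifies this real derivative with the complex one. -/
theorem radialDeriv_rsOperator {f g : Cn n → ℂ} (hf : AnalyticOnNhd ℂ f (unitBall n))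
    (hg : AnalyticOnNhd ℂ g (unitBall n)) (hL : AnalyticOnNhd ℂ (rsOperator g f) (unitBall n))
    {z : Cn n} (hz : z ∈ unitBall n) :
    radialDeriv (rsOperator g f) z = radialDeriv f z * g z := by
  set J : ℝ → ℂ := fun t => fderiv ℂ f ((t : ℂ) • z) z * g ((t : ℂ) • z) with hJ
  set U : Set ℝ := {t : ℝ | (t : ℂ) • z ∈ unitBall n} with hU
  have hUo : IsOpen U := Metric.isOpen_ball.preimage (by fun_prop)
  have h1U : (1 : ℝ) ∈ U := by simpa [hU] using hz
  have hJc : ContinuousOn J U := continuousOn_rsIntegrand hf hg z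
  have hFTC : HasDerivAt (fun x => ∫ t in (0 : ℝ)..x, J t) (J 1) 1 :=
    intervalIntegral.integral_hasDerivAt_right (intervalIntegrable_rsIntegrand hf hg hz)
      (hJc.stronglyMeasurableAtFilter hUo 1 h1U) (hJc.continuousAt (hUo.mem_nhds h1U))
  have hev : (fun x : ℝ => rsOperator g f ((x : ℂ) • z)) =ᶠ[𝓝 1]
      fun x => ∫ t in (0 : ℝ)..x, J t := by
    filter_upwards [hUo.mem_nhds h1U] with x hx
    rw [rsOperator_apply hx]
    have h := intervalIntegral.smul_integral_comp_mul_left (a := 0) (b := 1) J x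
    rw [mul_zero, mul_one] at h
    rw [← h, ← intervalIntegral.integral_smul]
    refine intervalIntegral.integral_congr fun t _ => ?_
    simp only [hJ, smul_smul, map_smul, Complex.ofReal_mul, smul_eq_mul, Complex.real_smul]
    rw [mul_comm (t : ℂ) x, mul_assoc]
  have hder : HasDerivAt (fun x : ℝ => rsOperator g f ((x : ℂ) • z))
      (fderiv ℂ (rsOperator g f) ((1 : ℂ) • z) z) 1 :=
    HasDerivAt.comp_ofReal (z := 1) (hasDerivAt_slice (w := 1) (hL _ (by rwa [one_smul])))
  have := hder.unique (hFTC.congr_of_eventuallyEq hev)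
  simpa [hJ, radialDeriv] using this

theorem radialDeriv_mul {f g : Cn n → ℂ} (hf : AnalyticOnNhd ℂ f (unitBall n))
    (hg : AnalyticOnNhd ℂ g (unitBall n)) {z : Cn n} (hz : z ∈ unitBall n) :
    radialDeriv (fun x => f x * g x) z = radialDeriv f z * g z + f z * radialDeriv g z := by
  simp only [radialDeriv]
  rw [fderiv_fun_mul (hf z hz).differentiableAt (hg z hz).differentiableAt]
  simp only [_root_.add_apply, _root_.smul_apply, smul_eq_mul]
  ring

theorem radialDeriv_radialDeriv_rsOperator {f g : Cn n → ℂ}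
    (hf : AnalyticOnNhd ℂ f (unitBall n)) (hg : AnalyticOnNhd ℂ g (unitBall n))
    (hL : AnalyticOnNhd ℂ (rsOperator g f) (unitBall n)) {z : Cn n} (hz : z ∈ unitBall n) :
    radialDeriv (radialDeriv (rsOperator g f)) z =
      radialDeriv (radialDeriv f) z * g z + radialDeriv f z * radialDeriv g z := by
  rw [radialDeriv_congr (fun x hx => radialDeriv_rsOperator hf hg hL hx) hz]
  exact radialDeriv_mul (radialDeriv_analytic hf) hg hz

/-! ### Test functions. -/

theorem radialDeriv_comp_inner {w z : Cn n} {G : ℂ → ℂ} {G' : ℂ}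
    (hG : HasDerivAt G G' (inner ℂ w z)) :
    radialDeriv (fun x => G (inner ℂ w x)) z = inner ℂ w z * G' := by
  have h : HasFDerivAt (fun x : Cn n => inner ℂ w x) (innerSL ℂ w) z :=
    (innerSL ℂ w).hasFDerivAt
  have h2 := hG.comp_hasFDerivAt z h
  unfold radialDeriv
  rw [show (fun x => G (inner ℂ w x)) = G ∘ fun x : Cn n => inner ℂ w x from rfl, h2.fderiv]
  simp [mul_comm]

/-- A power of the Cauchy kernel times a polynomial vanishing at `U`. -/
def testProfile (A B U s : ℝ) (u : ℂ) : ℂ :=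
  (A * (u - U) + B * (u - U) ^ 2) * (1 - u) ^ (-(s : ℂ))

/-- The derivative of `testProfile`. -/
def testProfileDeriv (A B U s : ℝ) (u : ℂ) : ℂ :=
  (A + 2 * B * (u - U)) * (1 - u) ^ (-(s : ℂ)) +
    (A * (u - U) + B * (u - U) ^ 2) * (s * (1 - u) ^ (-(s : ℂ) - 1))

theorem one_sub_mem_slitPlane {u : ℂ} (hu : ‖u‖ < 1) : 1 - u ∈ Complex.slitPlane := by
  left
  have := Complex.re_le_norm u
  simp only [Complex.sub_re, Complex.one_re]
  linarith

theorem hasDerivAt_one_sub_cpow {u : ℂ} (hu : ‖u‖ < 1) (c : ℂ) :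
    HasDerivAt (fun u : ℂ => (1 - u) ^ c) (-c * (1 - u) ^ (c - 1)) u := by
  have h := ((hasDerivAt_id u).const_sub 1).cpow_const (c := c) (one_sub_mem_slitPlane hu)
  exact h.congr_deriv (by simp only [id_eq]; ring)

theorem hasDerivAt_quadratic (A B U : ℝ) (u : ℂ) :
    HasDerivAt (fun u : ℂ => A * (u - U) + B * (u - U) ^ 2) (A + 2 * B * (u - U)) u := by
  have h1 := (hasDerivAt_id u).sub_const (U : ℂ)
  have h := (h1.const_mul (A : ℂ)).add ((h1.pow 2).const_mul (B : ℂ))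
  refine h.congr_deriv ?_
  simp only [id_eq]
  push_cast
  ring

theorem hasDerivAt_testProfile (A B U s : ℝ) {u : ℂ} (hu : ‖u‖ < 1) :
    HasDerivAt (testProfile A B U s) (testProfileDeriv A B U s u) u := by
  have h := (hasDerivAt_quadratic A B U u).mul (hasDerivAt_one_sub_cpow hu (-(s : ℂ)))
  rw [neg_neg] at h
  exact h

/-- At u = U only terms in which the factors u - U have been differentiated away survive. The first
derivative is thus governed by A alone, and B adjusts the second one freely. -/
theorem hasDerivAt_testProfileDeriv (A B s : ℝ) {U : ℝ} (hU : ‖(U : ℂ)‖ < 1) :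
    HasDerivAt (testProfileDeriv A B U s)
      (2 * B * (1 - U : ℂ) ^ (-(s : ℂ)) + 2 * A * s * (1 - U : ℂ) ^ (-(s : ℂ) - 1)) (U : ℂ) := by
  have h0 : HasDerivAt (fun u : ℂ => (A : ℂ) + 2 * B * (u - U)) (2 * B) (U : ℂ) := by
    simpa using (((hasDerivAt_id (U : ℂ)).sub_const (U : ℂ)).const_mul (2 * B : ℂ)).const_add
      (A : ℂ)
  have h := (h0.mul (hasDerivAt_one_sub_cpow hU (-(s : ℂ)))).add
    ((hasDerivAt_quadratic A B U U).mul
      ((hasDerivAt_one_sub_cpow hU (-(s : ℂ) - 1)).const_mul (s : ℂ)))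
  refine h.congr_deriv ?_
  simp only [sub_self]
  ring

theorem analyticOnNhd_testProfile (A B U s : ℝ) :
    AnalyticOnNhd ℂ (testProfile A B U s) (Metric.ball 0 1) :=
  DifferentiableOn.analyticOnNhd (fun u hu =>
    (hasDerivAt_testProfile A B U s (by simpa using hu)).differentiableAt.differentiableWithinAt)
    Metric.isOpen_ball

/-- Since 1 - U ≤ 2|1-u|, also |u - U| ≤ 3|1-u|. With |A| ≤ 1 - U both polynomial terms are
O(|1-u|²), with constants 2·3 and 3² B₀, so the polynomial recovers two powers of the kernel. -/
theorem norm_testProfile_le {A B U s B₀ : ℝ} {u : ℂ} (hU1 : U < 1)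
    (hA : |A| ≤ 1 - U) (hB : |B| ≤ B₀) (hu : ‖u‖ < 1) (hu2 : 1 - U ≤ 2 * ‖1 - u‖) :
    ‖testProfile A B U s u‖ ≤ (6 + 9 * B₀) * ‖1 - u‖ ^ (2 - s) := by
  have h1u : 1 - u ≠ 0 := Complex.slitPlane_ne_zero (one_sub_mem_slitPlane hu)
  have hpos : 0 < ‖1 - u‖ := norm_pos_iff.2 h1u
  have huU : ‖u - U‖ ≤ 3 * ‖1 - u‖ := by
    have h : u - U = ((1 - U : ℝ) : ℂ) - (1 - u) := by push_cast; ring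
    rw [h]
    refine (norm_sub_le _ _).trans ?_
    rw [Complex.norm_real, Real.norm_of_nonneg (by linarith)]
    linarith
  have hpow : ‖(1 - u) ^ (-(s : ℂ))‖ = ‖1 - u‖ ^ (-s) := by
    rw [Complex.norm_cpow_of_ne_zero h1u]
    simp
  unfold testProfile
  rw [norm_mul, hpow, sub_eq_add_neg 2 s, Real.rpow_add hpos, ← mul_assoc]
  gcongr
  refine (norm_add_le _ _).trans ?_
  rw [norm_mul, norm_mul, norm_pow, Complex.norm_real, Complex.norm_real, Real.norm_eq_abs,
    Real.norm_eq_abs, add_mul, show (2 : ℝ) = ((2 : ℕ) : ℝ) by norm_num, Real.rpow_natCast]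
  have hB0 : 0 ≤ B₀ := (abs_nonneg B).trans hB
  refine add_le_add ?_ ?_
  · calc |A| * ‖u - U‖ ≤ (2 * ‖1 - u‖) * (3 * ‖1 - u‖) := by
          gcongr
          exact hA.trans hu2
      _ = _ := by ring
  · calc |B| * ‖u - U‖ ^ 2 ≤ B₀ * (3 * ‖1 - u‖) ^ 2 := by gcongr
      _ = _ := by ring

/-- The function is a multiple of `testProfile` in ⟨w,z⟩ with U = ⟨w,w⟩. Its linear coefficient is
A(1-|w|²), so that linear and quadratic terms have the same size. Only the constant C is uniform in
w; the sup bound M is not, and its factor 1 is the constant weight with which the growth lemma for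
derivatives is later applied. -/
theorem exists_test_function (hn : 1 ≤ n) {p q : ℝ} (hp : 0 < p) (hq : 0 < q)
    {φ : ℝ → ℝ} (hφ : IsNormalFun φ) :
    ∃ s : ℝ, 0 ≤ s ∧ ∀ B₀ : ℝ, 0 ≤ B₀ → ∃ C : ℝ≥0∞, C ≠ ∞ ∧ ∀ w ∈ unitBall n, ∀ A B : ℝ,
      |A| ≤ 1 → |B| ≤ B₀ → ∃ f ∈ mixedNormSpace n hp hq hφ,
        (∃ M, ∀ z ∈ unitBall n, ‖f z‖ ≤ M * 1) ∧ mixedNormPow p q φ f ≤ C ∧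
        radialDeriv f w = (((φ ‖w‖ * (1 - ‖w‖ ^ 2) ^ (2 + n / q))⁻¹ *
          (‖w‖ ^ 2 * (A * (1 - ‖w‖ ^ 2))) : ℝ) : ℂ) ∧
        radialDeriv (radialDeriv f) w = (((φ ‖w‖ * (1 - ‖w‖ ^ 2) ^ (2 + n / q))⁻¹ *
          (‖w‖ ^ 2 * (A * (1 - ‖w‖ ^ 2) + ‖w‖ ^ 2 * (2 * B + 2 * A * s))) : ℝ) : ℂ) := by
  obtain ⟨β, hβ, hbound⟩ := exists_mixedNormPow_le_of_kernel_bound hn hp hq hφ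
  -- The extra 2 is what the quadratic polynomial absorbs, leaving the kernel exponent n/q + β.
  set s : ℝ := n / q + β + 2 with hs
  refine ⟨s, by positivity, fun B₀ hB₀ => ?_⟩
  -- 2^β passes from (1-|w|²)^β to (1-|w|)^β.
  obtain ⟨C, hC, hCf⟩ := hbound ((6 + 9 * B₀) * 2 ^ β) (by positivity)
  refine ⟨C, hC, fun w hw A B hA hB => ?_⟩
  have hw1 := hw
  rw [mem_ball_zero_iff] at hw1
  have hw0 := norm_nonneg w
  set U : ℝ := ‖w‖ ^ 2 with hU
  have hU0 : 0 ≤ U := by positivity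
  have hUw : U ≤ ‖w‖ := by rw [hU]; nlinarith
  have hU1 : U < 1 := by linarith
  have h1U : 0 < 1 - U := by linarith
  have hnU : ‖(U : ℂ)‖ < 1 := by rwa [Complex.norm_real, Real.norm_of_nonneg hU0]
  have hφw := hφ.pos ‖w‖ ⟨hw0, hw1⟩
  set κ : ℝ := (1 - U) ^ β / φ ‖w‖ with hκ
  have hκ0 : 0 < κ := by positivity
  set A' : ℝ := A * (1 - U) with hA'
  have hA'U : |A'| ≤ 1 - U := by
    rw [hA', abs_mul, abs_of_pos h1U]
    exact mul_le_of_le_one_left h1U.le hA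
  set G : ℂ → ℂ := fun u => (κ : ℂ) * testProfile A' B U s u with hG
  set f : Cn n → ℂ := (unitBall n).indicator fun z => G (inner ℂ w z) with hf
  have hin : ∀ z ∈ unitBall n, ‖inner ℂ w z‖ < 1 := fun z hz => by
    rw [mem_ball_zero_iff] at hz
    refine (norm_inner_le_norm (𝕜 := ℂ) w z).trans_lt ?_
    nlinarith [norm_nonneg z]
  have hEq : EqOn f (fun z => G (inner ℂ w z)) (unitBall n) := fun z hz => indicator_of_mem hz _
  have hfb : ∀ z ∈ unitBall n, ‖f z‖ ≤ (6 + 9 * B₀) * 2 ^ β *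
      ((1 - ‖w‖) ^ β / φ ‖w‖ * ‖1 - inner ℂ w z‖ ^ (-(n / q + β))) := by
    intro z hz
    have hlow := one_sub_norm_le_norm_one_sub_inner w (mem_ball_zero_iff.1 hz).le
    have hpos : 0 < ‖1 - inner ℂ w z‖ := by linarith
    have h1 := norm_testProfile_le (s := s) hU1 hA'U hB (hin z hz) (by rw [hU]; nlinarith)
    rw [hEq hz, hG]
    simp only
    rw [norm_mul, Complex.norm_real, Real.norm_of_nonneg hκ0.le]
    have h2 : (1 - U) ^ β ≤ 2 ^ β * (1 - ‖w‖) ^ β := by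
      rw [← Real.mul_rpow zero_le_two (by linarith)]
      refine Real.rpow_le_rpow h1U.le ?_ hβ.le
      rw [hU]; nlinarith
    calc κ * ‖testProfile A' B U s (inner ℂ w z)‖
        ≤ (2 ^ β * (1 - ‖w‖) ^ β / φ ‖w‖) *
          ((6 + 9 * B₀) * ‖1 - inner ℂ w z‖ ^ (2 - s)) := by
          rw [hκ]
          gcongr
      _ = _ := by
          rw [show 2 - s = -(n / q + β) by rw [hs]; ring]
          ring
  have hfa : AnalyticOnNhd ℂ f (unitBall n) := by
    intro z hz
    have h1 : AnalyticAt ℂ (fun z => G (inner ℂ w z)) z := by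
      refine AnalyticAt.comp_of_eq (g := G) (f := fun z => inner ℂ w z) ?_
        ((innerSL ℂ w).analyticAt z) rfl
      exact analyticAt_const.mul (analyticOnNhd_testProfile A' B U s _ (by simpa using hin z hz))
    exact h1.congr (hEq.symm.eventuallyEq_of_mem (Metric.isOpen_ball.mem_nhds hz))
  have hfC := hCf w hw f hfb
  have hww : inner ℂ w w = (U : ℂ) := by
    rw [inner_self_eq_norm_sq_to_K, hU]; simp
  have hder : ∀ z ∈ unitBall n, radialDeriv f z =
      (fun u : ℂ => (κ : ℂ) * (u * testProfileDeriv A' B U s u)) (inner ℂ w z) := by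
    intro z hz
    rw [radialDeriv_congr hEq hz, radialDeriv_comp_inner
      ((hasDerivAt_testProfile A' B U s (hin z hz)).const_mul (κ : ℂ))]
    ring
  have hpow : (1 - U : ℂ) ^ (-(s : ℂ)) = (((1 - U) ^ (-s) : ℝ) : ℂ) := by
    rw [Complex.ofReal_cpow h1U.le]; push_cast; rfl
  have hpow1 : (1 - U : ℂ) ^ (-(s : ℂ) - 1) = (((1 - U) ^ (-s - 1) : ℝ) : ℂ) := by
    rw [Complex.ofReal_cpow h1U.le]; push_cast; rfl
  have hκs : κ * (1 - U) ^ (-s) = (φ ‖w‖ * (1 - U) ^ (2 + n / q))⁻¹ := by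
    rw [hκ, hs, show -(n / q + β + 2) = -β + -(2 + n / q) by ring, Real.rpow_add h1U,
      Real.rpow_neg h1U.le, Real.rpow_neg h1U.le]
    field_simp
  refine ⟨f, ⟨⟨hfa, fun z hz => indicator_of_notMem hz _⟩, hfC.trans_lt hC.lt_top⟩,
    ⟨(6 + 9 * B₀) * 2 ^ β * ((1 - ‖w‖) ^ β / φ ‖w‖ * (1 - ‖w‖) ^ (-(n / q + β))), fun z hz => ?_⟩,
    hfC, ?_, ?_⟩
  · rw [mul_one]
    have h1w : 0 < 1 - ‖w‖ := by linarith
    refine (hfb z hz).trans ?_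
    have hlow := one_sub_norm_le_norm_one_sub_inner w (mem_ball_zero_iff.1 hz).le
    have : ‖1 - inner ℂ w z‖ ^ (-(n / q + β)) ≤ (1 - ‖w‖) ^ (-(n / q + β)) :=
      Real.rpow_le_rpow_of_nonpos h1w hlow (by
        have : 0 ≤ n / q + β := by positivity
        linarith)
    gcongr
  · rw [hder w hw, hww]
    simp only [testProfileDeriv, sub_self]
    rw [hpow, ← hκs]
    push_cast
    ring
  · rw [radialDeriv_congr hder hw, radialDeriv_comp_inner (w := w) (z := w)
      (G := fun u : ℂ => (κ : ℂ) * (u * testProfileDeriv A' B U s u))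
      (G' := (κ : ℂ) * (1 * testProfileDeriv A' B U s U + U * (2 * B * (1 - U : ℂ) ^ (-(s : ℂ)) +
        2 * A' * s * (1 - U : ℂ) ^ (-(s : ℂ) - 1)))) (by
        rw [hww]
        exact ((hasDerivAt_id (U : ℂ)).mul
          (hasDerivAt_testProfileDeriv A' B s hnU)).const_mul (κ : ℂ)), hww]
    simp only [testProfileDeriv, sub_self]
    rw [hpow, hpow1, ← hκs]
    have h1 : (1 - U) ^ (-s - 1) = (1 - U) ^ (-s) / (1 - U) := by
      rw [Real.rpow_sub h1U, Real.rpow_one]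
    rw [h1, hA']
    have h1Uc : (1 - U : ℂ) ≠ 0 := by exact_mod_cast h1U.ne'
    push_cast
    field_simp
    ring

/-! ### Quasi-norm inequalities and behaviour at the boundary. -/

theorem mixedNorm_smul {p q : ℝ} (hp : 0 < p) (hq : 0 < q) (φ : ℝ → ℝ) (c : ℂ) (f : Cn n → ℂ) :
    mixedNorm p q φ (c • f) = ‖c‖ₑ * mixedNorm p q φ f := by
  rw [mixedNorm, mixedNormPow_smul hp hq, ENNReal.mul_rpow_of_nonneg _ _ (by positivity),
    ← ENNReal.rpow_mul, mul_one_div_cancel hp.ne', ENNReal.rpow_one, mixedNorm]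

theorem exists_mixedNormPow_add_le {p q : ℝ} (hp : 0 < p) (hq : 0 < q) {φ : ℝ → ℝ}
    (hφ : IsNormalFun φ) :
    ∃ C : ℝ≥0∞, C ≠ ∞ ∧ ∀ f g : Cn n → ℂ, f ∈ holBall n →
      mixedNormPow p q φ (f + g) ≤ C * (mixedNormPow p q φ f + mixedNormPow p q φ g) := by
  have hs : 0 < 1 / q * p := by positivity
  let C : ℝ≥0∞ := (2 ^ q) ^ (1 / q * p) * 2 ^ (1 / q * p)
  have hC : C ≠ ∞ := by
    refine ENNReal.mul_ne_top (ENNReal.rpow_ne_top_of_nonneg hs.le ?_)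
      (ENNReal.rpow_ne_top_of_nonneg hs.le (by simp))
    exact ENNReal.rpow_ne_top_of_nonneg hq.le (by simp)
  refine ⟨C, hC, fun f g hf => ?_⟩
  have hw : AEMeasurable (fun r => ENNReal.ofReal (φ r ^ p / (1 - r)))
      (volume.restrict (Ioo (0 : ℝ) 1)) := by
    refine AEMeasurable.ennreal_ofReal (ContinuousOn.aemeasurable ?_ measurableSet_Ioo)
    refine ContinuousOn.div ?_ (by fun_prop) fun r hr => (sub_pos.2 hr.2).ne'
    exact (hφ.continuousOn.mono Ioo_subset_Ico_self).rpow_const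
      fun r hr => Or.inl (hφ.pos r ⟨hr.1.le, hr.2⟩).ne'
  have hF : AEMeasurable
      (fun r => integralMean q f r ^ p * ENNReal.ofReal (φ r ^ p / (1 - r)))
      (volume.restrict (Ioo (0 : ℝ) 1)) :=
    (((aemeasurable_integralMeanPow hf q).pow_const _).pow_const _).mul hw
  simp only [mixedNormPow]
  rw [← lintegral_add_left' hF, ← lintegral_const_mul' _ _ hC]
  refine setLIntegral_mono' measurableSet_Ioo fun r hr => ?_
  rw [← add_mul, ← mul_assoc]
  gcongr
  simp only [integralMean, ← ENNReal.rpow_mul]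
  refine (ENNReal.rpow_le_rpow (integralMeanPow_add_le hf hq hr) hs.le).trans ?_
  rw [ENNReal.mul_rpow_of_nonneg _ _ hs.le, mul_assoc]
  gcongr
  exact enn_add_rpow_le hs _ _

/-- The lower bound works with differences of test functions, and the mixed norm is only a
quasi-norm in general; c records the loss. The summand 1 in its choice only ensures c > 0, so that
one may divide by it. -/
theorem exists_mixedNorm_sub_le {p q : ℝ} (hp : 0 < p) (hq : 0 < q) {φ : ℝ → ℝ}
    (hφ : IsNormalFun φ) {C : ℝ≥0∞} (hC : C ≠ ∞) :
    ∃ c : ℝ≥0, 0 < c ∧ ∀ f g : Cn n → ℂ, f ∈ holBall n → mixedNormPow p q φ f ≤ C →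
      mixedNormPow p q φ g ≤ C → mixedNorm p q φ (f - g) ≤ c := by
  obtain ⟨C', hC', hadd⟩ := exists_mixedNormPow_add_le (n := n) hp hq hφ
  have hN : (C' * (C + C)) ^ (1 / p) ≠ ∞ :=
    ENNReal.rpow_ne_top_of_nonneg (by positivity) (by finiteness)
  refine ⟨((C' * (C + C)) ^ (1 / p)).toNNReal + 1, by positivity, fun f g hf hfC hgC => ?_⟩
  rw [ENNReal.coe_add, ENNReal.coe_toNNReal hN]
  refine le_trans ?_ le_self_add
  refine ENNReal.rpow_le_rpow ?_ (by positivity)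
  rw [show f - g = f + (-1 : ℂ) • g by ext; simp [sub_eq_add_neg]]
  refine (hadd f _ hf).trans ?_
  rw [mixedNormPow_smul hp hq, enorm_neg, enorm_one, ENNReal.one_rpow, one_mul]
  gcongr

theorem le_zygmundNorm (μ : ℝ → ℝ) (f : Cn n → ℂ) {z : Cn n} (hz : z ∈ unitBall n) :
    ENNReal.ofReal (μ ‖z‖) * ‖radialDeriv (radialDeriv f) z‖ₑ ≤ zygmundNorm μ f :=
  le_add_left (le_iSup₂ (f := fun z (_ : z ∈ unitBall n) =>
      ENNReal.ofReal (μ ‖z‖) * ‖radialDeriv (radialDeriv f) z‖ₑ) z hz)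

theorem zygmundNorm_sub_le (μ : ℝ → ℝ) {f g : Cn n → ℂ}
    (hf : AnalyticOnNhd ℂ f (unitBall n)) (hg : AnalyticOnNhd ℂ g (unitBall n)) :
    zygmundNorm μ (f - g) ≤ zygmundNorm μ f + zygmundNorm μ g := by
  rw [show f - g = f + (-1 : ℂ) • g by ext; simp [sub_eq_add_neg]]
  refine (zygmundNorm_add_le μ hf (g := (-1 : ℂ) • g)
    fun z hz => analyticAt_const.smul (hg z hz)).trans ?_
  rw [zygmundNorm_smul, enorm_neg, enorm_one, one_mul]

theorem rsOperator_sub {f₁ f₂ g : Cn n → ℂ} (hf₁ : AnalyticOnNhd ℂ f₁ (unitBall n))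
    (hf₂ : AnalyticOnNhd ℂ f₂ (unitBall n)) (hg : AnalyticOnNhd ℂ g (unitBall n)) :
    rsOperator g (f₁ - f₂) = rsOperator g f₁ - rsOperator g f₂ := by
  rw [show f₁ - f₂ = f₁ + (-1 : ℂ) • f₂ by ext; simp [sub_eq_add_neg],
    rsOperator_add (f₂ := (-1 : ℂ) • f₂) hf₁ (fun z hz => analyticAt_const.smul (hf₂ z hz)) hg,
    rsOperator_smul]
  ext
  simp [sub_eq_add_neg]

theorem radialDeriv_radialDeriv_sub {f₁ f₂ : Cn n → ℂ} (hf₁ : AnalyticOnNhd ℂ f₁ (unitBall n))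
    (hf₂ : AnalyticOnNhd ℂ f₂ (unitBall n)) {z : Cn n} (hz : z ∈ unitBall n) :
    radialDeriv (f₁ - f₂) z = radialDeriv f₁ z - radialDeriv f₂ z ∧
    radialDeriv (radialDeriv (f₁ - f₂)) z =
      radialDeriv (radialDeriv f₁) z - radialDeriv (radialDeriv f₂) z := by
  have h : ∀ {u v : Cn n → ℂ}, AnalyticOnNhd ℂ u (unitBall n) → AnalyticOnNhd ℂ v (unitBall n) →
      ∀ x ∈ unitBall n, radialDeriv (u - v) x = (radialDeriv u - radialDeriv v) x := by
    intro u v hu hv x hx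
    simp only [radialDeriv, Pi.sub_apply]
    rw [fderiv_sub (hu x hx).differentiableAt (hv x hx).differentiableAt]
    rfl
  refine ⟨h hf₁ hf₂ z hz, ?_⟩
  rw [radialDeriv_congr (h hf₁ hf₂) hz]
  exact h (radialDeriv_analytic hf₁) (radialDeriv_analytic hf₂) z hz

/-- Both φ(r)/(1-r)^a and (1-r)^a tend to 0. This decay is what makes a fixed bounded function
invisible at the boundary. -/
theorem IsNormalFun.tendsto_zero {φ : ℝ → ℝ} (hφ : IsNormalFun φ) :
    Tendsto φ (𝓝[<] 1) (𝓝 0) := by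
  obtain ⟨a, b, ha, -, -, hlim, -, -⟩ := hφ.exists_exponents
  have h1 : Tendsto (fun r : ℝ => (1 - r) ^ a) (𝓝[<] 1) (𝓝 0) := by
    have : ContinuousAt (fun r : ℝ => (1 - r) ^ a) 1 :=
      (continuousAt_const.sub continuousAt_id).rpow_const (Or.inr ha.le)
    have h := this.tendsto.mono_left (nhdsWithin_le_nhds (s := Iio 1))
    simpa [Real.zero_rpow ha.ne'] using h
  have h2 := hlim.mul h1
  rw [zero_mul] at h2
  refine h2.congr' ?_
  filter_upwards [self_mem_nhdsWithin] with r hr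
  have : 0 < 1 - r := sub_pos.2 hr
  field_simp

/-- The filter of points of the ball approaching the boundary. -/
abbrev boundaryFilter (n : ℕ) : Filter (Cn n) := comap (fun z : Cn n => ‖z‖) (𝓝[<] 1)

theorem eventually_boundaryFilter {r : ℝ} (hr : r < 1) :
    ∀ᶠ z in boundaryFilter n, r < ‖z‖ ∧ z ∈ unitBall n := by
  have h : ∀ᶠ x in 𝓝[<] (1 : ℝ), r < x ∧ x < 1 := Ioo_mem_nhdsLT hr
  filter_upwards [tendsto_comap.eventually h] with z hz
  exact ⟨hz.1, by rw [mem_ball_zero_iff]; exact hz.2⟩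

/-! ### Lower bound for the essential norm. -/

section Lower

variable {p q : ℝ} {hp : 0 < p} {hq : 0 < q} {φ : ℝ → ℝ} {hφ : IsNormalFun φ} {μ : ℝ → ℝ}
  {g : Cn n → ℂ}

/-- `f` is a test function at `w` for the quantity `F`. -/
structure IsTestFunction (hp : 0 < p) (hq : 0 < q) (hφ : IsNormalFun φ) (μ : ℝ → ℝ)
    (g : Cn n → ℂ) (C : ℝ≥0∞) (F : Cn n → ℝ) (w : Cn n) (f : Cn n → ℂ) : Prop where
  mem : f ∈ mixedNormSpace n hp hq hφ
  bounded : ∃ M, ∀ z ∈ unitBall n, ‖f z‖ ≤ M * 1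
  norm_le : mixedNormPow p q φ f ≤ C
  le : F w ≤ 8 * (μ ‖w‖ *
    ‖radialDeriv (radialDeriv f) w * g w + radialDeriv f w * radialDeriv g w‖)

theorem IsTestFunction.ofReal_le {C : ℝ≥0∞} {F : Cn n → ℝ} {w : Cn n} {f : Cn n → ℂ}
    (hf : IsTestFunction hp hq hφ μ g C F w f) (hμ : IsWeight μ) (hw : w ∈ unitBall n)
    (hg : AnalyticOnNhd ℂ g (unitBall n))
    (hL : rsOperator g f ∈ zygmundSpace n μ) :
    ENNReal.ofReal (F w) ≤ 8 * (ENNReal.ofReal (μ ‖w‖) *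
      ‖radialDeriv (radialDeriv (rsOperator g f)) w‖ₑ) := by
  have hμw := hμ.pos ‖w‖ ⟨norm_nonneg w, by simpa using hw⟩
  rw [radialDeriv_radialDeriv_rsOperator hf.mem.1.1 hg hL.1.1 hw, ← ofReal_norm,
    ← ENNReal.ofReal_mul hμw.le, show (8 : ℝ≥0∞) = ENNReal.ofReal 8 by simp,
    ← ENNReal.ofReal_mul (by norm_num)]
  exact ENNReal.ofReal_le_ofReal hf.le

/-- Boundedness of L_g applied to the test function at w, read off at the point w. The resulting
finiteness of the boundary quotients feeds the vanishing statement for bounded f. -/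
theorem exists_bound_of_isTestFunction (hμ : IsWeight μ) (hg : g ∈ holBall n)
    (hb : IsBoundedOp hp hq hφ μ (rsOperator g)) {C : ℝ≥0∞} (hC : C ≠ ∞) {F : Cn n → ℝ}
    (hF : ∀ w ∈ unitBall n, 1 / 2 ≤ ‖w‖ → ∃ f, IsTestFunction hp hq hφ μ g C F w f) :
    ∃ K : ℝ, 0 ≤ K ∧ ∀ w ∈ unitBall n, 1 / 2 ≤ ‖w‖ → F w ≤ K := by
  obtain ⟨hmap, C', hC'⟩ := hb
  have hfin : 8 * (C' * C ^ (1 / p)) ≠ ∞ :=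
    ENNReal.mul_ne_top (by simp) (ENNReal.mul_ne_top (by simp)
      (ENNReal.rpow_ne_top_of_nonneg (by positivity) hC))
  refine ⟨(8 * (C' * C ^ (1 / p))).toReal, ENNReal.toReal_nonneg, fun w hw hw2 => ?_⟩
  obtain ⟨f, hf⟩ := hF w hw hw2
  have h1 := hf.ofReal_le hμ hw hg.1 (hmap f hf.mem)
  rw [← ENNReal.ofReal_le_ofReal_iff ENNReal.toReal_nonneg, ENNReal.ofReal_toReal hfin]
  refine h1.trans (mul_le_mul_right ((le_zygmundNorm μ _ hw).trans ((hC' f hf.mem).trans ?_)) _)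
  refine mul_le_mul_right (ENNReal.rpow_le_rpow hf.norm_le (by positivity)) _

/-- `μ |ℛ²(L_g f)|` vanishes at the boundary for bounded `f`. -/
theorem tendsto_weight_radialDeriv_rsOperator (hμ : IsWeight μ)
    (hg : g ∈ holBall n) {K : ℝ} (hK : 0 ≤ K)
    (hK1 : ∀ z ∈ unitBall n, 1 / 2 ≤ ‖z‖ →
      μ ‖z‖ * ‖g z‖ / (φ ‖z‖ * (1 - ‖z‖ ^ 2) ^ (2 + n / q)) ≤ K)
    (hK2 : ∀ z ∈ unitBall n, 1 / 2 ≤ ‖z‖ →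
      μ ‖z‖ * ‖radialDeriv g z‖ / (φ ‖z‖ * (1 - ‖z‖ ^ 2) ^ (1 + n / q)) ≤ K)
    (hq : 0 < q) (hφ : IsNormalFun φ)
    {f : Cn n → ℂ} (hf : AnalyticOnNhd ℂ f (unitBall n))
    (hL : AnalyticOnNhd ℂ (rsOperator g f) (unitBall n))
    {M : ℝ} (hM : ∀ z ∈ unitBall n, ‖f z‖ ≤ M * 1) :
    Tendsto (fun z => ENNReal.ofReal (μ ‖z‖) *
      ‖radialDeriv (radialDeriv (rsOperator g f)) z‖ₑ) (boundaryFilter n) (𝓝 0) := by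
  have hM0 : 0 ≤ M := by
    have := (norm_nonneg _).trans (hM 0 (by simp)); linarith
  -- The powers of 1-|z| lost in the two derivatives cancel against those in the quotients, with 36
  -- = 8·4 + 2·2, and φ remains.
  have hlim : Tendsto (fun z : Cn n => ENNReal.ofReal (36 * M * K * φ ‖z‖))
      (boundaryFilter n) (𝓝 0) := by
    have h := (hφ.tendsto_zero.comp (tendsto_comap (f := fun z : Cn n => ‖z‖))).const_mul
      (36 * M * K)
    rw [mul_zero] at h
    have h2 := ENNReal.tendsto_ofReal h
    rwa [ENNReal.ofReal_zero] at h2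
  refine tendsto_of_tendsto_of_tendsto_of_le_of_le' tendsto_const_nhds hlim
    (Eventually.of_forall fun _ => zero_le) ?_
  filter_upwards [eventually_boundaryFilter (n := n) (r := 1 / 2) (by norm_num)] with z hz
  obtain ⟨hz2, hz⟩ := hz
  have hz1 := hz
  rw [mem_ball_zero_iff] at hz1
  have hz0 := norm_nonneg z
  have hφz := hφ.pos ‖z‖ ⟨hz0, hz1⟩
  have hμz := hμ.pos ‖z‖ ⟨hz0, hz1⟩
  set d := 1 - ‖z‖ with hd
  set e := 1 - ‖z‖ ^ 2 with he
  have hd0 : 0 < d := by linarith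
  have he0 : 0 < e := by rw [he]; nlinarith
  have he1 : e ≤ 1 := by rw [he]; nlinarith
  have hed : e ≤ 2 * d := by rw [he, hd]; nlinarith
  obtain ⟨hR1, hR2⟩ := norm_radialDeriv_le_of_growth (ψ := fun _ => 1) (D := 1)
    monotoneOn_const (fun _ _ => zero_le_one) one_pos (fun _ _ => by norm_num) hf hM0 hM hz
  have h1 := hK1 z hz hz2.le
  have h2 := hK2 z hz hz2.le
  rw [← he, div_le_iff₀ (by positivity)] at h1 h2
  have hepow : e ^ (n / q : ℝ) ≤ 1 := Real.rpow_le_one he0.le he1 (by positivity)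
  have hp2 : e ^ (2 + n / q : ℝ) ≤ 4 * d ^ 2 := by
    rw [Real.rpow_add he0, Real.rpow_two]
    calc e ^ 2 * e ^ (n / q : ℝ) ≤ (2 * d) ^ 2 * 1 := by gcongr
      _ = _ := by ring
  have hp1 : e ^ (1 + n / q : ℝ) ≤ 2 * d := by
    rw [Real.rpow_add he0, Real.rpow_one]
    calc e * e ^ (n / q : ℝ) ≤ (2 * d) * 1 := by gcongr
      _ = _ := by ring
  rw [radialDeriv_radialDeriv_rsOperator hf hg.1 hL hz, ← ofReal_norm,
    ← ENNReal.ofReal_mul hμz.le]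
  refine ENNReal.ofReal_le_ofReal ?_
  calc μ ‖z‖ * ‖radialDeriv (radialDeriv f) z * g z + radialDeriv f z * radialDeriv g z‖
      ≤ μ ‖z‖ * (‖radialDeriv (radialDeriv f) z‖ * ‖g z‖ +
        ‖radialDeriv f z‖ * ‖radialDeriv g z‖) := by
        gcongr
        refine (norm_add_le _ _).trans ?_
        rw [norm_mul, norm_mul]
    _ = ‖radialDeriv (radialDeriv f) z‖ * (μ ‖z‖ * ‖g z‖) +
        ‖radialDeriv f z‖ * (μ ‖z‖ * ‖radialDeriv g z‖) := by ring
    _ ≤ (8 * 1 ^ 2 * M * 1 / d ^ 2) * (K * (φ ‖z‖ * (4 * d ^ 2))) +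
        (2 * 1 * M * 1 / d) * (K * (φ ‖z‖ * (2 * d))) := by
        refine add_le_add (mul_le_mul hR2 (h1.trans ?_) (by positivity) (by positivity))
          (mul_le_mul hR1 (h2.trans ?_) (by positivity) (by positivity))
        · gcongr
        · gcongr
    _ = _ := by field_simp; ring

/-- Compactness of T makes T(f_k - f_j) small along a subsequence, so L_g(f_k - f_j) is controlled
by L_g - T. At z_k it differs from L_g f_k only by L_g f_j, which vanishes at the boundary for fixed
j. -/
theorem limsupBoundary_le_mul_essNorm (hμ : IsWeight μ) (hg : g ∈ holBall n)
    (hb : IsBoundedOp hp hq hφ μ (rsOperator g)) {C : ℝ≥0∞} {c : ℝ≥0} (hc : 0 < c)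
    (hsub : ∀ f g : Cn n → ℂ, f ∈ holBall n → mixedNormPow p q φ f ≤ C →
      mixedNormPow p q φ g ≤ C → mixedNorm p q φ (f - g) ≤ c) (hC : C ≠ ∞)
    {K : ℝ} (hK : 0 ≤ K)
    (hK1 : ∀ z ∈ unitBall n, 1 / 2 ≤ ‖z‖ →
      μ ‖z‖ * ‖g z‖ / (φ ‖z‖ * (1 - ‖z‖ ^ 2) ^ (2 + n / q)) ≤ K)
    (hK2 : ∀ z ∈ unitBall n, 1 / 2 ≤ ‖z‖ →
      μ ‖z‖ * ‖radialDeriv g z‖ / (φ ‖z‖ * (1 - ‖z‖ ^ 2) ^ (1 + n / q)) ≤ K)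
    {F : Cn n → ℝ}
    (hF : ∀ w ∈ unitBall n, 1 / 2 ≤ ‖w‖ → ∃ f, IsTestFunction hp hq hφ μ g C F w f) :
    limsupBoundary F ≤ 8 * c * essNorm hp hq hφ μ (rsOperator g) := by
  have h8c0 : (8 * c : ℝ≥0∞) ≠ 0 := mul_ne_zero (by simp) (by simpa using hc.ne')
  have h8ct : (8 * c : ℝ≥0∞) ≠ ∞ := ENNReal.mul_ne_top (by simp) (by simp)
  -- With the constant on the left, the infimum can be tested on one compact T at a time.
  rw [← ENNReal.div_le_iff' h8c0 h8ct]
  refine le_iInf₂ fun T hT => ?_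
  rw [ENNReal.div_le_iff' h8c0 h8ct]
  set S : ℝ≥0∞ := ⨆ (f : mixedNormSpace n hp hq hφ) (_ : mixedNorm p q φ (f : Cn n → ℂ) ≤ 1),
      zygmundNorm μ (rsOperator g f - (T f : Cn n → ℂ)) with hS
  refine le_of_forall_lt_imp_le_of_dense fun a ha => ?_
  have hfreq : ∃ᶠ z in boundaryFilter n, a < ENNReal.ofReal (F z) :=
    frequently_lt_of_lt_limsup (by isBoundedDefault) ha
  obtain ⟨z, hz, hzp⟩ := exists_seq_forall_of_frequently
    (hfreq.and_eventually (eventually_boundaryFilter (n := n) (r := 1 / 2) (by norm_num)))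
  choose f hf using fun k => hF (z k) (hzp k).2.2 (hzp k).2.1.le
  let fk : ℕ → mixedNormSpace n hp hq hφ := fun k => ⟨f k, (hf k).mem⟩
  have hCp : C ^ (1 / p) ≠ ∞ := ENNReal.rpow_ne_top_of_nonneg (by positivity) hC
  obtain ⟨h, s, hs, hconv⟩ := hT fk ⟨(C ^ (1 / p)).toNNReal, fun k => by
    rw [ENNReal.coe_toNNReal hCp]
    exact ENNReal.rpow_le_rpow (hf k).norm_le (by positivity)⟩
  set ε : ℕ → ℝ≥0∞ := fun k => zygmundNorm μ ((T (fk (s k)) : Cn n → ℂ) - (h : Cn n → ℂ)) with hε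
  set η : ℕ → Cn n → ℝ≥0∞ := fun j x => ENNReal.ofReal (μ ‖x‖) *
      ‖radialDeriv (radialDeriv (rsOperator g (f (s j)))) x‖ₑ with hη
  have hη0 : ∀ j, Tendsto (fun k => η j (z (s k))) atTop (𝓝 0) := fun j => by
    obtain ⟨M, hM⟩ := (hf (s j)).bounded
    exact (tendsto_weight_radialDeriv_rsOperator hμ hg hK hK1 hK2 hq hφ (hf (s j)).mem.1.1
      (hb.1 _ (hf (s j)).mem).1.1 hM).comp (hz.comp hs.tendsto_atTop)
  -- Homogeneity: rescale by 1/c to enter the unit ball.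
  have hcS : ∀ D : mixedNormSpace n hp hq hφ, mixedNorm p q φ (D : Cn n → ℂ) ≤ c →
      zygmundNorm μ (rsOperator g D - (T D : Cn n → ℂ)) ≤ c * S := by
    intro D hD
    have hc0 : (c : ℝ≥0∞) ≠ 0 := by simpa using hc.ne'
    have hce : ‖(((c : ℝ) : ℂ))⁻¹‖ₑ = (c : ℝ≥0∞)⁻¹ := by
      have hcc : ((c : ℝ) : ℂ) ≠ 0 := by exact_mod_cast hc.ne'
      rw [enorm_inv hcc, ← ofReal_norm, Complex.norm_real, NNReal.norm_eq,
        ENNReal.ofReal_coe_nnreal]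
    have h1 : zygmundNorm μ (rsOperator g ((((c : ℝ) : ℂ))⁻¹ • D : mixedNormSpace n hp hq hφ) -
        (T ((((c : ℝ) : ℂ))⁻¹ • D) : Cn n → ℂ)) ≤ S := by
      refine le_iSup₂ (f := fun (f : mixedNormSpace n hp hq hφ)
        (_ : mixedNorm p q φ (f : Cn n → ℂ) ≤ 1) =>
        zygmundNorm μ (rsOperator g f - (T f : Cn n → ℂ))) ((((c : ℝ) : ℂ))⁻¹ • D) ?_
      rw [Submodule.coe_smul, mixedNorm_smul hp hq, hce]
      calc (c : ℝ≥0∞)⁻¹ * mixedNorm p q φ (D : Cn n → ℂ) ≤ (c : ℝ≥0∞)⁻¹ * c := by gcongr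
        _ = 1 := ENNReal.inv_mul_cancel hc0 (by simp)
    rw [map_smul, Submodule.coe_smul, Submodule.coe_smul, rsOperator_smul, ← smul_sub,
      zygmundNorm_smul, hce] at h1
    calc zygmundNorm μ (rsOperator g D - (T D : Cn n → ℂ))
        = c * ((c : ℝ≥0∞)⁻¹ * zygmundNorm μ (rsOperator g D - (T D : Cn n → ℂ))) := by
          rw [← mul_assoc, ENNReal.mul_inv_cancel hc0 (by simp), one_mul]
      _ ≤ _ := by gcongr
  have key : ∀ j k, a ≤ 8 * (c * S + (ε k + ε j) + η j (z (s k))) := by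
    intro j k
    have hzk := (hzp (s k)).2.2
    refine (hzp (s k)).1.le.trans (((hf (s k)).ofReal_le hμ hzk hg.1
      (hb.1 _ (hf (s k)).mem)).trans ?_)
    refine mul_le_mul_right ?_ 8
    set D : mixedNormSpace n hp hq hφ := fk (s k) - fk (s j) with hD
    have hLa : ∀ u : mixedNormSpace n hp hq hφ,
        AnalyticOnNhd ℂ (rsOperator g u) (unitBall n) := fun u => (hb.1 u u.2).1.1
    have hTa : ∀ u : mixedNormSpace n hp hq hφ,
        AnalyticOnNhd ℂ (T u : Cn n → ℂ) (unitBall n) := fun u => (T u).2.1.1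
    have hLD : rsOperator g D = rsOperator g (f (s k)) - rsOperator g (f (s j)) :=
      rsOperator_sub (hf (s k)).mem.1.1 (hf (s j)).mem.1.1 hg.1
    have hDc : mixedNorm p q φ (D : Cn n → ℂ) ≤ c :=
      hsub _ _ (hf (s k)).mem.1 (hf (s k)).norm_le (hf (s j)).norm_le
    have hTD : zygmundNorm μ (T D : Cn n → ℂ) ≤ ε k + ε j := by
      have e : (T D : Cn n → ℂ) = ((T (fk (s k)) : Cn n → ℂ) - (h : Cn n → ℂ)) -
          ((T (fk (s j)) : Cn n → ℂ) - (h : Cn n → ℂ)) := by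
        rw [hD, map_sub, Submodule.coe_sub, sub_sub_sub_cancel_right]
      rw [e]
      exact zygmundNorm_sub_le μ (fun x hx => (hTa _ x hx).sub (h.2.1.1 x hx))
        (fun x hx => (hTa _ x hx).sub (h.2.1.1 x hx))
    have hLDn : zygmundNorm μ (rsOperator g D) ≤ c * S + (ε k + ε j) := by
      have e : rsOperator g D = (rsOperator g D - (T D : Cn n → ℂ)) + (T D : Cn n → ℂ) := by
        rw [sub_add_cancel]
      rw [e]
      exact (zygmundNorm_add_le μ (fun x hx => (hLa D x hx).sub (hTa D x hx)) (hTa D)).trans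
        (add_le_add (hcS D hDc) hTD)
    have hR : radialDeriv (radialDeriv (rsOperator g (f (s k)))) (z (s k)) =
        radialDeriv (radialDeriv (rsOperator g D)) (z (s k)) +
          radialDeriv (radialDeriv (rsOperator g (f (s j)))) (z (s k)) := by
      rw [hLD, (radialDeriv_radialDeriv_sub (hLa (fk (s k))) (hLa (fk (s j))) hzk).2]
      simp [fk]
    rw [hR]
    refine (mul_le_mul_right (enorm_add_le _ _) _).trans ?_
    rw [mul_add]
    exact add_le_add ((le_zygmundNorm μ _ hzk).trans hLDn) le_rfl
  -- The order of limits matters: first k → ∞ with j fixed, since the decay of η j is not uniform in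
  -- j, and then j → ∞.
  have lim1 : ∀ j, a ≤ 8 * (c * S + (0 + ε j) + 0) := fun j => by
    refine ge_of_tendsto' (ENNReal.Tendsto.const_mul ((((hconv.add_const (ε j)).const_add
      (c * S))).add (hη0 j)) (Or.inr (by simp))) (key j)
  have lim2 : a ≤ 8 * (c * S + (0 + 0) + 0) := by
    refine ge_of_tendsto' (ENNReal.Tendsto.const_mul ((((hconv.const_add 0).const_add
      (c * S))).add_const 0) (Or.inr (by simp))) lim1
  simpa [mul_assoc] using lim2

end Lower

/-! ### Bounded functions and Taylor polynomials of dilations. -/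

/-- Bounded holomorphic functions belong to `H(p,q,φ)`, with control of the norm. -/
theorem exists_mixedNorm_le_of_bounded {p q : ℝ} (hp : 0 < p) (hq : 0 < q) {φ : ℝ → ℝ}
    (hφ : IsNormalFun φ) :
    ∃ C : ℝ≥0∞, C ≠ ∞ ∧ ∀ (f : Cn n → ℂ) (M : ℝ), 0 ≤ M → (∀ z ∈ unitBall n, ‖f z‖ ≤ M) →
      mixedNorm p q φ f ≤ C * ENNReal.ofReal M := by
  obtain ⟨a, b, ha, -, hanti, -, -, -⟩ := hφ.exists_exponents
  set I : ℝ≥0∞ := ∫⁻ r in Ioo (0 : ℝ) 1, ENNReal.ofReal (φ r ^ p / (1 - r)) with hI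
  have hIt : I ≠ ∞ := by
    -- From φ(r) ≤ φ(0)(1-r)^a the weight is at most a constant times (1-r)^{ap-1}, which is
    -- integrable.
    have hle : I ≤ ENNReal.ofReal (φ 0 ^ p) * ENNReal.ofReal ((1 - 0) ^ (a * p) / (a * p)) := by
      refine le_trans ?_ (mul_le_mul_right (lintegral_Ioo_rpow_le zero_lt_one (by positivity)) _)
      rw [hI, ← lintegral_const_mul' _ _ ENNReal.ofReal_ne_top]
      refine setLIntegral_mono' measurableSet_Ioo fun r hr => ?_
      have h0 := hφ.pos 0 ⟨le_rfl, zero_lt_one⟩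
      have hr' := hφ.pos r ⟨hr.1.le, hr.2⟩
      have h1r : 0 < 1 - r := sub_pos.2 hr.2
      rw [← ENNReal.ofReal_mul (by positivity)]
      refine ENNReal.ofReal_le_ofReal ?_
      have h := hanti ⟨le_rfl, zero_lt_one⟩ ⟨hr.1.le, hr.2⟩ hr.1.le
      simp only [sub_zero, Real.one_rpow, div_one] at h
      rw [div_le_iff₀ (by positivity)] at h
      calc φ r ^ p / (1 - r) ≤ (φ 0 * (1 - r) ^ a) ^ p / (1 - r) := by gcongr
        _ = _ := by
          rw [Real.mul_rpow h0.le (by positivity), ← Real.rpow_mul h1r.le, Real.rpow_sub h1r,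
            Real.rpow_one, mul_div_assoc]
    exact ne_top_of_le_ne_top (by finiteness) hle
  set σ : ℝ≥0∞ := sphereMeasure n univ with hσ
  have hσt : σ ≠ ∞ := measure_ne_top _ _
  refine ⟨σ ^ (1 / q) * I ^ (1 / p), ENNReal.mul_ne_top
    (ENNReal.rpow_ne_top_of_nonneg (by positivity) hσt)
    (ENNReal.rpow_ne_top_of_nonneg (by positivity) hIt), fun f M hM hf => ?_⟩
  have h1 : ∀ r ∈ Ioo (0 : ℝ) 1, integralMean q f r ≤ σ ^ (1 / q) * ENNReal.ofReal M := by
    intro r hr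
    have : integralMeanPow q f r ≤ σ * ENNReal.ofReal M ^ q := by
      rw [mul_comm, hσ, ← lintegral_const]
      refine lintegral_mono fun ζ => ?_
      rw [← ofReal_norm]
      exact ENNReal.rpow_le_rpow (ENNReal.ofReal_le_ofReal (hf _ (smul_sphere_mem hr ζ))) hq.le
    calc integralMean q f r ≤ (σ * ENNReal.ofReal M ^ q) ^ (1 / q) :=
          ENNReal.rpow_le_rpow this (by positivity)
      _ = _ := by
          rw [ENNReal.mul_rpow_of_nonneg _ _ (by positivity), ← ENNReal.rpow_mul,
            mul_one_div_cancel hq.ne', ENNReal.rpow_one]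
  have h2 : mixedNormPow p q φ f ≤ (σ ^ (1 / q) * ENNReal.ofReal M) ^ p * I := by
    rw [hI, ← lintegral_const_mul' _ _ (ENNReal.rpow_ne_top_of_nonneg hp.le
      (ENNReal.mul_ne_top (ENNReal.rpow_ne_top_of_nonneg (by positivity) hσt) (by simp)))]
    refine setLIntegral_mono' measurableSet_Ioo fun r hr => ?_
    gcongr
    exact h1 r hr
  calc mixedNorm p q φ f ≤ ((σ ^ (1 / q) * ENNReal.ofReal M) ^ p * I) ^ (1 / p) :=
        ENNReal.rpow_le_rpow h2 (by positivity)
    _ = _ := by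
        rw [ENNReal.mul_rpow_of_nonneg _ _ (by positivity), ← ENNReal.rpow_mul,
          mul_one_div_cancel hp.ne', ENNReal.rpow_one]
        ring

/-- Chain rule for the linear map x ↦ xz. Homogeneous Taylor terms of f become Taylor coefficients
of slices, so one-variable Cauchy estimates apply. -/
theorem iteratedDeriv_slice {f : Cn n → ℂ} (hf : AnalyticOnNhd ℂ f (unitBall n)) (z : Cn n)
    (k : ℕ) :
    iteratedDeriv k (fun x : ℂ => f (x • z)) 0 = iteratedFDeriv ℂ k f 0 fun _ => z := by
  set L : ℂ →L[ℂ] Cn n := ContinuousLinearMap.toSpanSingleton ℂ z with hL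
  have hopen : IsOpen (L ⁻¹' unitBall n) := Metric.isOpen_ball.preimage L.continuous
  have h0 : L 0 ∈ unitBall n := by simp
  have hc : ContDiffOn ℂ k f (unitBall n) := hf.contDiffOn Metric.isOpen_ball.uniqueDiffOn
  have h := L.iteratedFDerivWithin_comp_right hc Metric.isOpen_ball.uniqueDiffOn
    hopen.uniqueDiffOn h0 (i := k) le_rfl
  rw [iteratedFDerivWithin_of_isOpen k hopen h0,
    iteratedFDerivWithin_of_isOpen k Metric.isOpen_ball h0, map_zero] at h
  rw [iteratedDeriv_eq_iteratedFDeriv]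
  have h2 := congrArg (fun m => m fun _ => (1 : ℂ)) h
  simpa [hL, Function.comp_def] using h2

/-- The coefficients of the Taylor polynomial of the dilation `z ↦ f (r z)`. -/
def taylorCoeff (r : ℝ) (N : ℕ) (f : Cn n → ℂ) (k : Fin N) :
    ContinuousMultilinearMap ℂ (fun _ : Fin k => Cn n) ℂ :=
  (((k : ℕ).factorial : ℂ)⁻¹ * (r : ℂ) ^ (k : ℕ)) • iteratedFDeriv ℂ k f 0

/-- The polynomial function on the ball with given homogeneous parts, extended by zero. -/
def polyFun {N : ℕ} (c : ∀ k : Fin N, ContinuousMultilinearMap ℂ (fun _ : Fin k => Cn n) ℂ) :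
    Cn n → ℂ :=
  (unitBall n).indicator fun z => ∑ k, c k fun _ => z

/-- The polynomial with given homogeneous parts as a continuous function on the closed ball. -/
def polyMap (n N : ℕ) :
    (∀ k : Fin N, ContinuousMultilinearMap ℂ (fun _ : Fin k => Cn n) ℂ) →ₗ[ℂ]
      C(Metric.closedBall (0 : Cn n) 1, ℂ) where
  toFun c := ⟨fun z => ∑ k, c k fun _ => (z : Cn n), by fun_prop⟩
  map_add' c d := by ext z; simp [Finset.sum_add_distrib]
  map_smul' a c := by ext z; simp [Finset.mul_sum]

theorem polyFun_apply {N : ℕ}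
    (c : ∀ k : Fin N, ContinuousMultilinearMap ℂ (fun _ : Fin k => Cn n) ℂ) {z : Cn n}
    (hz : z ∈ unitBall n) :
    polyFun c z = polyMap n N c ⟨z, Metric.ball_subset_closedBall hz⟩ := indicator_of_mem hz _

theorem polyFun_add {N : ℕ}
    (c d : ∀ k : Fin N, ContinuousMultilinearMap ℂ (fun _ : Fin k => Cn n) ℂ) :
    polyFun (c + d) = polyFun c + polyFun d := by
  ext z
  by_cases hz : z ∈ unitBall n
  · rw [Pi.add_apply, polyFun_apply _ hz, polyFun_apply _ hz, polyFun_apply _ hz, map_add]; rfl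
  · simp [polyFun, hz]

theorem polyFun_smul {N : ℕ} (a : ℂ)
    (c : ∀ k : Fin N, ContinuousMultilinearMap ℂ (fun _ : Fin k => Cn n) ℂ) :
    polyFun (a • c) = a • polyFun c := by
  ext z
  by_cases hz : z ∈ unitBall n
  · rw [Pi.smul_apply, polyFun_apply _ hz, polyFun_apply _ hz, map_smul]; rfl
  · simp [polyFun, hz]

theorem polyFun_mem_holBall {N : ℕ}
    (c : ∀ k : Fin N, ContinuousMultilinearMap ℂ (fun _ : Fin k => Cn n) ℂ) :
    polyFun c ∈ holBall n := by
  refine ⟨fun z hz => ?_, fun z hz => indicator_of_notMem hz _⟩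
  have h : AnalyticAt ℂ (fun z => ∑ k, c k fun _ => z) z := by
    refine Finset.analyticAt_fun_sum _ fun k _ => ?_
    have h1 : AnalyticAt ℂ (c k) (fun _ => z) := (c k).analyticAt
    exact h1.comp_of_eq (f := fun z : Cn n => fun _ : Fin (k : ℕ) => z)
      (AnalyticAt.pi fun _ => analyticAt_id) rfl
  have he : EqOn (fun z => ∑ k, c k fun _ => z) (polyFun c) (unitBall n) := fun x hx =>
    (indicator_of_mem hx fun z => ∑ k, c k fun _ => z).symm
  exact h.congr (he.eventuallyEq_of_mem (Metric.isOpen_ball.mem_nhds hz))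

theorem polyFun_mem {p q : ℝ} (hp : 0 < p) (hq : 0 < q) {φ : ℝ → ℝ} (hφ : IsNormalFun φ) {N : ℕ}
    (c : ∀ k : Fin N, ContinuousMultilinearMap ℂ (fun _ : Fin k => Cn n) ℂ) :
    polyFun c ∈ mixedNormSpace n hp hq hφ := by
  obtain ⟨C, hC, hCf⟩ := exists_mixedNorm_le_of_bounded (n := n) hp hq hφ
  refine ⟨polyFun_mem_holBall c, ?_⟩
  have h := hCf (polyFun c) ‖polyMap n N c‖ (norm_nonneg _) fun z hz => by
    rw [polyFun_apply c hz]; exact ContinuousMap.norm_coe_le_norm _ _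
  have h2 : mixedNorm p q φ (polyFun c) < ∞ := h.trans_lt (by finiteness)
  rw [mixedNorm, ENNReal.rpow_lt_top_iff_of_pos (by positivity)] at h2
  exact h2

theorem taylorCoeff_add {r : ℝ} {N : ℕ} {f g : Cn n → ℂ} (hf : AnalyticOnNhd ℂ f (unitBall n))
    (hg : AnalyticOnNhd ℂ g (unitBall n)) :
    taylorCoeff r N (f + g) = taylorCoeff r N f + taylorCoeff r N g := by
  ext k : 1
  have h0 : (0 : Cn n) ∈ unitBall n := by simp
  rw [Pi.add_apply, taylorCoeff, iteratedFDeriv_add_apply (hf 0 h0).contDiffAt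
    (hg 0 h0).contDiffAt, smul_add]
  rfl

theorem taylorCoeff_smul {r : ℝ} {N : ℕ} (a : ℂ) {f : Cn n → ℂ}
    (hf : AnalyticOnNhd ℂ f (unitBall n)) :
    taylorCoeff r N (a • f) = a • taylorCoeff r N f := by
  ext k : 1
  have h0 : (0 : Cn n) ∈ unitBall n := by simp
  rw [Pi.smul_apply, taylorCoeff, iteratedFDeriv_const_smul_apply (hf 0 h0).contDiffAt,
    smul_comm]
  rfl

/-- Cauchy's estimate on |x| = ρ in the slice through z; the dilation contributes r^k. -/
theorem norm_taylor_term_le {f : Cn n → ℂ} (hf : AnalyticOnNhd ℂ f (unitBall n)) {r ρ B : ℝ}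
    (hr : 0 ≤ r) (hρ0 : 0 < ρ) (hρ1 : ρ < 1) (hB : ∀ x : Cn n, ‖x‖ ≤ ρ → ‖f x‖ ≤ B) {z : Cn n}
    (hz : ‖z‖ ≤ 1) (k : ℕ) :
    ‖((k.factorial : ℂ)⁻¹ * (r : ℂ) ^ k) * iteratedFDeriv ℂ k f 0 fun _ => z‖ ≤
      B * (r / ρ) ^ k := by
  have hle : ∀ x ∈ Metric.closedBall (0 : ℂ) ρ, ‖x • z‖ ≤ ρ := by
    intro x hx
    rw [mem_closedBall_zero_iff] at hx
    rw [norm_smul]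
    nlinarith [norm_nonneg z, norm_nonneg x]
  have han : AnalyticOnNhd ℂ (fun x : ℂ => f (x • z)) (Metric.closedBall (0 : ℂ) ρ) :=
    analyticOnNhd_slice hf z fun x hx => by
      rw [mem_ball_zero_iff]; linarith [hle x hx]
  have h := Complex.norm_iteratedDeriv_le_of_forall_mem_sphere_norm_le k hρ0
    (DifferentiableOn.diffContOnCl (by
      rw [closure_ball _ hρ0.ne']; exact han.differentiableOn))
    (C := B) fun x hx => hB _ (hle x (Metric.sphere_subset_closedBall hx))
  rw [iteratedDeriv_slice hf] at h
  rw [norm_mul, norm_mul, norm_inv, norm_pow, Complex.norm_natCast, Complex.norm_real,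
    Real.norm_of_nonneg hr]
  have hk : (0 : ℝ) < k.factorial := by exact_mod_cast k.factorial_pos
  calc ((k.factorial : ℝ)⁻¹ * r ^ k) * ‖iteratedFDeriv ℂ k f 0 fun _ => z‖
      ≤ ((k.factorial : ℝ)⁻¹ * r ^ k) * (k.factorial * B / ρ ^ k) := by gcongr
    _ = _ := by rw [div_pow]; field_simp

theorem polyMap_taylorCoeff_apply (r : ℝ) (N : ℕ) (f : Cn n → ℂ)
    (z : Metric.closedBall (0 : Cn n) 1) :
    polyMap n N (taylorCoeff r N f) z = ∑ k ∈ Finset.range N,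
      ((k.factorial : ℂ)⁻¹ * (r : ℂ) ^ k) * iteratedFDeriv ℂ k f 0 fun _ => (z : Cn n) := by
  rw [← Fin.sum_univ_eq_sum_range fun k => ((k.factorial : ℂ)⁻¹ * (r : ℂ) ^ k) *
    iteratedFDeriv ℂ k f 0 fun _ => (z : Cn n)]
  rfl

theorem norm_polyMap_taylorCoeff_le {f : Cn n → ℂ} (hf : AnalyticOnNhd ℂ f (unitBall n))
    {r ρ B : ℝ} (hr : 0 ≤ r) (hrρ : r < ρ) (hρ1 : ρ < 1) (hB0 : 0 ≤ B)
    (hB : ∀ x : Cn n, ‖x‖ ≤ ρ → ‖f x‖ ≤ B) (N : ℕ) :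
    ‖polyMap n N (taylorCoeff r N f)‖ ≤ N * B := by
  have hρ0 : 0 < ρ := hr.trans_lt hrρ
  rw [ContinuousMap.norm_le _ (by positivity)]
  intro z
  rw [polyMap_taylorCoeff_apply]
  refine (norm_sum_le_of_le _ (f := _) (n := fun _ => B) fun k _ => ?_).trans (by simp)
  refine (norm_taylor_term_le hf hr hρ0 hρ1 hB (mem_closedBall_zero_iff.1 z.2) k).trans ?_
  exact mul_le_of_le_one_right hB0 (pow_le_one₀ (by positivity) ((div_le_one hρ0).2 hrρ.le))

/-- The slice through z, evaluated at x = r, is the sum of its Taylor series; the tail is geometric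
of ratio r/ρ, uniformly in z and in f with the same bound B. -/
theorem norm_polyFun_taylorCoeff_sub_le {f : Cn n → ℂ} (hf : AnalyticOnNhd ℂ f (unitBall n))
    {r ρ B : ℝ} (hr : 0 ≤ r) (hrρ : r < ρ) (hρ1 : ρ < 1)
    (hB : ∀ x : Cn n, ‖x‖ ≤ ρ → ‖f x‖ ≤ B) (N : ℕ) {z : Cn n} (hz : z ∈ unitBall n) :
    ‖polyFun (taylorCoeff r N f) z - f ((r : ℂ) • z)‖ ≤
      B * (r / ρ) ^ N / (1 - r / ρ) := by
  have hρ0 : 0 < ρ := hr.trans_lt hrρ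
  rw [polyFun_apply _ hz, polyMap_taylorCoeff_apply]
  refine norm_sub_le_of_geometric_bound_of_hasSum ((div_lt_one hρ0).2 hrρ)
    (norm_taylor_term_le hf hr hρ0 hρ1 hB (mem_ball_zero_iff.1 hz).le) ?_ N
  have han : AnalyticOnNhd ℂ (fun x : ℂ => f (x • z)) (Metric.ball (0 : ℂ) 1) :=
    analyticOnNhd_slice hf z fun x hx => by
      rw [mem_ball_zero_iff] at hx hz ⊢
      rw [norm_smul]
      nlinarith [norm_nonneg z, norm_nonneg x]
  have h := Complex.hasSum_taylorSeries_on_ball han.differentiableOn (z := (r : ℂ)) (by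
    rw [mem_ball_zero_iff, Complex.norm_real, Real.norm_of_nonneg hr]; linarith)
  simpa only [sub_zero, smul_eq_mul, iteratedDeriv_slice hf, ← mul_assoc] using h

/-- Dilations are close to the identity on compact subsets of the ball. -/
theorem norm_sub_dilation_le {f : Cn n → ℂ} (hf : AnalyticOnNhd ℂ f (unitBall n)) {r s B : ℝ}
    (hr : 1 / 2 ≤ r) (hr1 : r ≤ 1) (hs : s < 1) (hB0 : 0 ≤ B)
    (hB : ∀ x : Cn n, ‖x‖ ≤ (1 + s) / 2 → ‖f x‖ ≤ B) {z : Cn n} (hz : ‖z‖ ≤ s) :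
    ‖f z - f ((r : ℂ) • z)‖ ≤ 4 * B / (1 - s) * (1 - r) := by
  have hmem : ∀ t ∈ Icc r 1, ‖(t : ℂ) • z‖ ≤ s := fun t ht => by
    rw [norm_smul, Complex.norm_real, Real.norm_of_nonneg (by linarith [ht.1])]
    exact (mul_le_of_le_one_left (norm_nonneg z) ht.2).trans hz
  have hder : ∀ t ∈ Icc r 1, HasDerivWithinAt (fun t : ℝ => f ((t : ℂ) • z))
      (fderiv ℂ f ((t : ℂ) • z) z) (Icc r 1) t := fun t ht =>
    (HasDerivAt.comp_ofReal (z := t) (hasDerivAt_slice (hf _ (by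
      rw [mem_ball_zero_iff]; linarith [hmem t ht])))).hasDerivWithinAt
  have hbd : ∀ t ∈ Icc r 1, ‖fderiv ℂ f ((t : ℂ) • z) z‖ ≤ 4 * B / (1 - s) := by
    intro t ht
    have ht0 : 0 < t := by linarith [ht.1]
    have htz := hmem t ht
    have hR : ‖radialDeriv f ((t : ℂ) • z)‖ ≤ 2 * B / (1 - s) := by
      refine (norm_radialDeriv_le hf (by rw [mem_ball_zero_iff]; linarith)
        (fun x hx => hB x (hx.trans (by linarith)))).trans ?_
      gcongr
    -- The velocity of the path is the radial derivative divided by t, and t ≥ 1/2 costs a factor 2.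
    have e : radialDeriv f ((t : ℂ) • z) = (t : ℂ) * fderiv ℂ f ((t : ℂ) • z) z := by
      simp [radialDeriv]
    rw [e, norm_mul, Complex.norm_real, Real.norm_of_nonneg ht0.le] at hR
    have h2 : 1 / 2 * ‖fderiv ℂ f ((t : ℂ) • z) z‖ ≤ 2 * B / (1 - s) :=
      le_trans (by gcongr; linarith [ht.1]) hR
    calc _ ≤ 2 * (2 * B / (1 - s)) := by linarith
      _ = _ := by ring
  have h := (convex_Icc r 1).norm_image_sub_le_of_norm_hasDerivWithin_le hder hbd
    (left_mem_Icc.2 hr1) (right_mem_Icc.2 hr1)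
  simpa [abs_of_nonneg (sub_nonneg.2 hr1)] using h

/-- Functions dominated by the growth weight are approximated by polynomials, uniformly on compact
subsets of the ball and with control by the growth weight on the whole ball. -/
theorem exists_polyFun_approx {q : ℝ} (hq : 0 < q) {φ : ℝ → ℝ} (hφ : IsNormalFun φ) {A s ε : ℝ}
    (hA : 0 < A) (hs0 : 0 ≤ s) (hs : s < 1) (hε : 0 < ε) :
    ∃ (r : ℝ) (N : ℕ), 0 ≤ r ∧ r < 1 ∧ ∀ f : Cn n → ℂ, AnalyticOnNhd ℂ f (unitBall n) →
      (∀ z ∈ unitBall n, ‖f z‖ ≤ A * growthWeight n q φ ‖z‖) →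
      (∀ z ∈ unitBall n,
        ‖f z - polyFun (taylorCoeff r N f) z‖ ≤ 3 * A * growthWeight n q φ ‖z‖) ∧
      ∀ z : Cn n, ‖z‖ ≤ s → ‖f z - polyFun (taylorCoeff r N f) z‖ ≤ ε := by
  set W := growthWeight n q φ with hW
  have hmono : MonotoneOn W (Ico 0 1) := growthWeight_monotoneOn hφ n hq
  have hpos : ∀ r ∈ Ico (0 : ℝ) 1, 0 < W r := fun r hr => growthWeight_pos hφ n q hr
  set B₁ := A * W ((1 + s) / 2) with hB₁
  have hB₁0 : 0 < B₁ := mul_pos hA (hpos _ ⟨by linarith, by linarith⟩)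
  obtain ⟨r, hr2, hr1, hrε⟩ : ∃ r : ℝ, 1 / 2 < r ∧ r < 1 ∧ 4 * B₁ / (1 - s) * (1 - r) < ε / 2 := by
    have h1 : ∀ᶠ r : ℝ in 𝓝[<] 1, 4 * B₁ / (1 - s) * (1 - r) < ε / 2 := by
      have hc : Continuous fun r : ℝ => 4 * B₁ / (1 - s) * (1 - r) := by fun_prop
      have h := (hc.tendsto 1).mono_left (nhdsWithin_le_nhds (s := Iio 1))
      exact h.eventually (gt_mem_nhds (by simpa using hε))
    have h2 : ∀ᶠ r : ℝ in 𝓝[<] 1, r ∈ Ioo (1 / 2) 1 := Ioo_mem_nhdsLT (by norm_num)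
    obtain ⟨r, h, h'⟩ := (h1.and h2).exists
    exact ⟨r, h'.1, h'.2, h⟩
  have hr0 : 0 < r := by linarith
  set ρ := (1 + r) / 2 with hρ
  have hrρ : r < ρ := by linarith
  have hρ1 : ρ < 1 := by linarith
  have hρ0 : 0 < ρ := by linarith
  have hrρ1 : r / ρ < 1 := (div_lt_one hρ0).2 hrρ
  -- The bound ε/2 serves the compact set. The bound A W(0) ≤ A W(|z|) serves the whole ball: f(z),
  -- its dilation and the tail each contribute A W(|z|), whence the factor 3.
  set τ := min (ε / 2) (A * W 0) with hτ
  have hτ0 : 0 < τ := lt_min (by positivity) (mul_pos hA (hpos 0 ⟨le_rfl, zero_lt_one⟩))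
  obtain ⟨N, hN⟩ : ∃ N : ℕ, A * W ρ * (r / ρ) ^ N / (1 - r / ρ) < τ := by
    have h := ((tendsto_pow_atTop_nhds_zero_of_lt_one (by positivity) hrρ1).const_mul
      (A * W ρ)).div_const (1 - r / ρ)
    rw [mul_zero, zero_div] at h
    exact (h.eventually (gt_mem_nhds hτ0)).exists
  refine ⟨r, N, hr0.le, hr1, fun f hf hfA => ?_⟩
  have hle : ∀ t < 1, ∀ x : Cn n, ‖x‖ ≤ t → ‖f x‖ ≤ A * W t := fun t ht x hx => by
    have hx0 := norm_nonneg x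
    refine (hfA x (by rw [mem_ball_zero_iff]; linarith)).trans ?_
    exact mul_le_mul_of_nonneg_left (hmono ⟨hx0, by linarith⟩ ⟨by linarith, ht⟩ hx) hA.le
  have htail : ∀ z ∈ unitBall n, ‖polyFun (taylorCoeff r N f) z - f ((r : ℂ) • z)‖ ≤ τ :=
    fun z hz => (norm_polyFun_taylorCoeff_sub_le hf hr0.le hrρ hρ1 (hle ρ hρ1) N hz).trans hN.le
  have htri : ∀ z ∈ unitBall n, ‖f z - polyFun (taylorCoeff r N f) z‖ ≤
      ‖f z - f ((r : ℂ) • z)‖ + τ := fun z hz => by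
    have e : f z - polyFun (taylorCoeff r N f) z = (f z - f ((r : ℂ) • z)) -
        (polyFun (taylorCoeff r N f) z - f ((r : ℂ) • z)) := by ring
    rw [e]
    exact (norm_sub_le _ _).trans (by linarith [htail z hz])
  refine ⟨fun z hz => ?_, fun z hz => ?_⟩
  · have hz1 := hz
    rw [mem_ball_zero_iff] at hz1
    have hz0 := norm_nonneg z
    have h1 := htri z hz
    have h2 := norm_sub_le (f z) (f ((r : ℂ) • z))
    have h3 := hle ‖z‖ hz1 z le_rfl
    have h4 := hle ‖z‖ hz1 ((r : ℂ) • z) (by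
      rw [norm_smul, Complex.norm_real, Real.norm_of_nonneg hr0.le]
      exact mul_le_of_le_one_left hz0 hr1.le)
    have h5 : τ ≤ A * W ‖z‖ := (min_le_right _ _).trans
      (mul_le_mul_of_nonneg_left (hmono ⟨le_rfl, zero_lt_one⟩ ⟨hz0, hz1⟩ hz0) hA.le)
    linarith
  · have h1 := htri z (by rw [mem_ball_zero_iff]; linarith)
    have h2 := norm_sub_dilation_le hf hr2.le hr1.le hs hB₁0.le (hle _ (by linarith)) hz
    have h3 : τ ≤ ε / 2 := min_le_left _ _
    linarith

/-! ### Upper bound for the essential norm. -/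

section Upper

variable {p q : ℝ} {hp : 0 < p} {hq : 0 < q} {φ : ℝ → ℝ} {hφ : IsNormalFun φ} {μ : ℝ → ℝ}
  {g : Cn n → ℂ}

/-- The operator `f ↦ L_g(P_f)`, where `P_f` is a Taylor polynomial of a dilation of `f`. -/
def taylorOp (hg : g ∈ holBall n) (hb : IsBoundedOp hp hq hφ μ (rsOperator g)) (r : ℝ) (N : ℕ) :
    mixedNormSpace n hp hq hφ →ₗ[ℂ] zygmundSpace n μ where
  toFun f := ⟨rsOperator g (polyFun (taylorCoeff r N f)), hb.1 _ (polyFun_mem hp hq hφ _)⟩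
  map_add' f₁ f₂ := by
    ext1
    simp only [Submodule.coe_add]
    rw [taylorCoeff_add f₁.2.1.1 f₂.2.1.1, polyFun_add,
      rsOperator_add (polyFun_mem_holBall _).1 (polyFun_mem_holBall _).1 hg.1]
  map_smul' a f := by
    ext1
    simp only [Submodule.coe_smul, RingHom.id_apply]
    rw [taylorCoeff_smul a f.2.1.1, polyFun_smul, rsOperator_smul]

instance finiteDimensional_continuousMultilinearMap (k : ℕ) :
    FiniteDimensional ℂ (ContinuousMultilinearMap ℂ (fun _ : Fin k => Cn n) ℂ) :=
  Module.Finite.of_injective (ContinuousMultilinearMap.toMultilinearMapLinear :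
    ContinuousMultilinearMap ℂ (fun _ : Fin k => Cn n) ℂ →ₗ[ℂ] _)
    ContinuousMultilinearMap.toMultilinearMap_injective

/-- The operator factors through polynomials with N homogeneous parts, a finite-dimensional space.
The growth bound keeps them bounded in sup norm along a bounded sequence, and sup norm convergence
passes through L_g because bounded functions embed continuously in H(p,q,φ). -/
theorem isCompactOp_taylorOp (hn : 1 ≤ n) (hg : g ∈ holBall n)
    (hb : IsBoundedOp hp hq hφ μ (rsOperator g)) {r : ℝ} (hr : 0 ≤ r) (hr1 : r < 1) (N : ℕ) :
    IsCompactOp hp hq hφ μ (taylorOp hg hb r N) := by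
  rintro f ⟨M, hM⟩
  obtain ⟨C₀, hC₀, hbdd⟩ := exists_mixedNorm_le_of_bounded (n := n) hp hq hφ
  obtain ⟨C₁, hC₁, hpt⟩ := exists_enorm_le_mixedNorm hn hp hq hφ
  obtain ⟨hmap, CL, hCL⟩ := id hb
  set W := growthWeight n q φ with hW
  set ρ := (1 + r) / 2 with hρ
  have hrρ : r < ρ := by linarith
  have hρ1 : ρ < 1 := by linarith
  have hW0 : 0 < W ρ := growthWeight_pos hφ n q ⟨by linarith, hρ1⟩
  set B := (C₁ * M).toReal * W ρ with hB
  have hB0 : 0 ≤ B := by positivity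
  have hfB : ∀ k, ∀ x : Cn n, ‖x‖ ≤ ρ → ‖(f k : Cn n → ℂ) x‖ ≤ B := fun k x hx => by
    have hx1 : ‖x‖ < 1 := by linarith
    rw [← ENNReal.ofReal_le_ofReal_iff hB0, ofReal_norm, hB,
      ENNReal.ofReal_mul ENNReal.toReal_nonneg, ENNReal.ofReal_toReal (by finiteness)]
    refine (hpt _ (f k).2.1.1 x (by rwa [mem_ball_zero_iff])).trans ?_
    rw [mul_right_comm]
    have h1 := ENNReal.ofReal_le_ofReal (growthWeight_monotoneOn hφ n hq
      ⟨norm_nonneg x, hx1⟩ ⟨by linarith, hρ1⟩ hx)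
    gcongr
    exact hM k
  -- Taking the range of `polyMap` as the finite-dimensional space makes the limit automatically a
  -- polynomial c of the required form.
  let V := LinearMap.range (polyMap n N)
  have : ProperSpace V := FiniteDimensional.proper ℂ V
  let u : ℕ → V := fun k => ⟨polyMap n N (taylorCoeff r N (f k)), LinearMap.mem_range_self _ _⟩
  have hu : ∀ k, u k ∈ Metric.closedBall (0 : V) (N * B) := fun k => by
    rw [Metric.mem_closedBall, Subtype.dist_eq, Submodule.coe_zero, dist_zero_right]
    exact norm_polyMap_taylorCoeff_le (f k).2.1.1 hr hrρ hρ1 hB0 (hfB k) N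
  obtain ⟨⟨_, c, rfl⟩, -, s, hs, hlim⟩ := tendsto_subseq_of_bounded Metric.isBounded_closedBall hu
  refine ⟨⟨rsOperator g (polyFun c), hmap _ (polyFun_mem hp hq hφ c)⟩, s, hs, ?_⟩
  have hlim2 : Tendsto (fun k => CL * (C₀ * ENNReal.ofReal
      ‖polyMap n N (taylorCoeff r N (f (s k))) - polyMap n N c‖)) atTop (𝓝 0) := by
    have h1 := tendsto_iff_norm_sub_tendsto_zero.1 (tendsto_subtype_rng.1 hlim)
    have h2 := ENNReal.tendsto_ofReal h1
    rw [ENNReal.ofReal_zero] at h2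
    have h3 := ENNReal.Tendsto.const_mul (a := (CL : ℝ≥0∞)) (ENNReal.Tendsto.const_mul (a := C₀)
      h2 (Or.inr hC₀)) (Or.inr (by simp))
    rwa [mul_zero, mul_zero] at h3
  refine tendsto_of_tendsto_of_tendsto_of_le_of_le tendsto_const_nhds hlim2
    (fun _ => zero_le) fun k => ?_
  have hmem := polyFun_mem hp hq hφ (taylorCoeff r N (f (s k) : Cn n → ℂ))
  have e : ((taylorOp hg hb r N (f (s k)) : zygmundSpace n μ) : Cn n → ℂ) -
      rsOperator g (polyFun c) =
      rsOperator g (polyFun (taylorCoeff r N (f (s k) : Cn n → ℂ)) - polyFun c) :=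
    (rsOperator_sub (polyFun_mem_holBall _).1 (polyFun_mem_holBall _).1 hg.1).symm
  change zygmundNorm μ (((taylorOp hg hb r N (f (s k)) : zygmundSpace n μ) : Cn n → ℂ) -
      rsOperator g (polyFun c)) ≤ _
  rw [e]
  refine (hCL _ (sub_mem hmem (polyFun_mem hp hq hφ c))).trans (mul_le_mul_right ?_ _)
  refine hbdd _ _ (norm_nonneg _) fun z hz => ?_
  rw [Pi.sub_apply, polyFun_apply _ hz, polyFun_apply _ hz]
  exact ContinuousMap.norm_coe_le_norm
    (polyMap n N (taylorCoeff r N (f (s k))) - polyMap n N c) _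

/-- If `F < m` at the boundary in the sense of the upper limit, then `F < m` near the boundary. -/
theorem exists_lt_of_limsupBoundary_lt {F : Cn n → ℝ} {m : ℝ≥0} (h : limsupBoundary F < m) :
    ∃ s < 1, ∀ z ∈ unitBall n, s < ‖z‖ → F z ≤ m := by
  have h1 := eventually_lt_of_limsup_lt h (by isBoundedDefault)
  rw [eventually_comap] at h1
  obtain ⟨s, hs, hsub⟩ := (mem_nhdsLT_iff_exists_Ioo_subset).1 h1
  refine ⟨s, hs, fun z hz hsz => ?_⟩
  rw [mem_ball_zero_iff] at hz
  have h2 := hsub ⟨hsz, hz⟩ z rfl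
  rw [← ENNReal.ofReal_coe_nnreal] at h2
  exact (ENNReal.ofReal_le_ofReal_iff m.2).1 h2.le

end Upper

/-- The growth of `μ |ℛ²h g + ℛh ℛg|` near the boundary. -/
theorem weight_mul_norm_le_near {q : ℝ} {φ : ℝ → ℝ} (hq : 0 < q)
    (hφ : IsNormalFun φ) {μ : ℝ → ℝ} (hμ : IsWeight μ) {D A : ℝ} (hD : 0 < D)
    (hA : 0 < A)
    (hWD : ∀ r ∈ Ico (0 : ℝ) 1, growthWeight n q φ ((1 + r) / 2) ≤ D * growthWeight n q φ r)
    {h g : Cn n → ℂ} (hh : AnalyticOnNhd ℂ h (unitBall n))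
    (hhA : ∀ z ∈ unitBall n, ‖h z‖ ≤ A * growthWeight n q φ ‖z‖) {z : Cn n}
    (hz : z ∈ unitBall n) {m : ℝ}
    (h1 : μ ‖z‖ * ‖g z‖ / (φ ‖z‖ * (1 - ‖z‖ ^ 2) ^ (2 + n / q)) ≤ m)
    (h2 : μ ‖z‖ * ‖radialDeriv g z‖ / (φ ‖z‖ * (1 - ‖z‖ ^ 2) ^ (1 + n / q)) ≤ m) :
    μ ‖z‖ * ‖radialDeriv (radialDeriv h) z * g z + radialDeriv h z * radialDeriv g z‖ ≤
      A * (8 * D ^ 2 * 2 ^ (2 + n / q) + 2 * D * 2 ^ (1 + n / q)) * m := by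
  have hz1 := hz
  rw [mem_ball_zero_iff] at hz1
  have hz0 := norm_nonneg z
  obtain ⟨hR1, hR2⟩ := norm_radialDeriv_le_of_growth (growthWeight_monotoneOn hφ n hq)
    (fun r hr => (growthWeight_pos hφ n q hr).le) hD hWD hh hA.le hhA hz
  have hφz := hφ.pos ‖z‖ ⟨hz0, hz1⟩
  have hμz := hμ.pos ‖z‖ ⟨hz0, hz1⟩
  unfold growthWeight at hR1 hR2
  set d := 1 - ‖z‖ with hd
  set e := 1 - ‖z‖ ^ 2 with he
  have hd0 : 0 < d := by linarith
  have he0 : 0 < e := by rw [he]; nlinarith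
  have hed : e ≤ 2 * d := by rw [he, hd]; nlinarith
  have hm0 : 0 ≤ m := le_trans (by positivity) h1
  rw [div_le_iff₀ (by positivity)] at h1 h2
  have hp2 : e ^ (2 + n / q : ℝ) ≤ 2 ^ (2 + n / q : ℝ) * (d ^ 2 * d ^ (n / q : ℝ)) := by
    calc e ^ (2 + n / q : ℝ) ≤ (2 * d) ^ (2 + n / q : ℝ) := by gcongr
      _ = _ := by rw [Real.mul_rpow (by norm_num) hd0.le, Real.rpow_add hd0, Real.rpow_two]
  have hp1 : e ^ (1 + n / q : ℝ) ≤ 2 ^ (1 + n / q : ℝ) * (d * d ^ (n / q : ℝ)) := by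
    calc e ^ (1 + n / q : ℝ) ≤ (2 * d) ^ (1 + n / q : ℝ) := by gcongr
      _ = _ := by rw [Real.mul_rpow (by norm_num) hd0.le, Real.rpow_add hd0, Real.rpow_one]
  calc μ ‖z‖ * ‖radialDeriv (radialDeriv h) z * g z + radialDeriv h z * radialDeriv g z‖
      ≤ μ ‖z‖ * (‖radialDeriv (radialDeriv h) z‖ * ‖g z‖ +
        ‖radialDeriv h z‖ * ‖radialDeriv g z‖) := by
        gcongr
        refine (norm_add_le _ _).trans ?_
        rw [norm_mul, norm_mul]
    _ = ‖radialDeriv (radialDeriv h) z‖ * (μ ‖z‖ * ‖g z‖) +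
        ‖radialDeriv h z‖ * (μ ‖z‖ * ‖radialDeriv g z‖) := by ring
    _ ≤ (8 * D ^ 2 * A * (φ ‖z‖ * d ^ (n / q : ℝ))⁻¹ / d ^ 2) *
          (m * (φ ‖z‖ * (2 ^ (2 + n / q : ℝ) * (d ^ 2 * d ^ (n / q : ℝ))))) +
        (2 * D * A * (φ ‖z‖ * d ^ (n / q : ℝ))⁻¹ / d) *
          (m * (φ ‖z‖ * (2 ^ (1 + n / q : ℝ) * (d * d ^ (n / q : ℝ))))) := by
        refine add_le_add (mul_le_mul hR2 (h1.trans ?_) (by positivity) (by positivity))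
          (mul_le_mul hR1 (h2.trans ?_) (by positivity) (by positivity))
        · gcongr
        · gcongr
    _ = _ := by
        have : 0 < d ^ (n / q : ℝ) := by positivity
        field_simp

/-- Smallness of `μ |ℛ²h g + ℛh ℛg|` on a compact subset of the ball for small `h`. -/
theorem exists_weight_mul_norm_le_of_small {μ : ℝ → ℝ} (hμ : IsWeight μ) {g : Cn n → ℂ}
    (hg : AnalyticOnNhd ℂ g (unitBall n)) {s η : ℝ} (hs0 : 0 ≤ s) (hs : s < 1) (hη : 0 < η) :
    ∃ ε > 0, ∀ h : Cn n → ℂ, AnalyticOnNhd ℂ h (unitBall n) →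
      (∀ z : Cn n, ‖z‖ ≤ (3 + s) / 4 → ‖h z‖ ≤ ε) → ∀ z : Cn n, ‖z‖ ≤ s →
      μ ‖z‖ * ‖radialDeriv (radialDeriv h) z * g z + radialDeriv h z * radialDeriv g z‖ ≤ η := by
  obtain ⟨B₀, hB₀, hgB⟩ := exists_norm_le_of_norm_le hg hs
  obtain ⟨B₁, hB₁, hRgB⟩ := exists_norm_le_of_norm_le (radialDeriv_analytic hg) hs
  obtain ⟨Bμ, hBμ⟩ := isCompact_Icc.exists_bound_of_continuousOn
    (hμ.continuousOn.mono (Icc_subset_Ico_right hs : Icc 0 s ⊆ Ico 0 1))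
  have hBμ0 : 0 ≤ Bμ := (norm_nonneg _).trans (hBμ 0 ⟨le_rfl, hs0⟩)
  have hs1 : 0 < 1 - s := sub_pos.2 hs
  set Q := Bμ * (8 / (1 - s) ^ 2 * B₀ + 4 / (1 - s) * B₁) with hQ
  have hQ0 : 0 ≤ Q := by positivity
  refine ⟨η / (Q + 1), by positivity, fun h hh hε z hz => ?_⟩
  set ε := η / (Q + 1) with hεdef
  have hε0 : 0 < ε := by positivity
  have hz0 := norm_nonneg z
  -- Two Cauchy steps, each halving the distance to the sphere: from s to (1+s)/2, then to (3+s)/4.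
  have hR : ∀ y : Cn n, ‖y‖ ≤ (1 + s) / 2 → ‖radialDeriv h y‖ ≤ 4 * ε / (1 - s) := fun y hy => by
    refine (norm_radialDeriv_le hh (by rw [mem_ball_zero_iff]; linarith)
      (fun x hx => hε x (by linarith))).trans ?_
    calc 2 * ε / (1 - ‖y‖) ≤ 2 * ε / ((1 - s) / 2) := by gcongr; linarith
      _ = _ := by field_simp; ring
  have hR2 : ‖radialDeriv (radialDeriv h) z‖ ≤ 8 * ε / (1 - s) ^ 2 := by
    refine (norm_radialDeriv_le (radialDeriv_analytic hh) (by rw [mem_ball_zero_iff]; linarith)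
      (fun x hx => hR x (by linarith))).trans ?_
    calc 2 * (4 * ε / (1 - s)) / (1 - ‖z‖) ≤ 2 * (4 * ε / (1 - s)) / (1 - s) := by gcongr
      _ = _ := by field_simp; ring
  calc μ ‖z‖ * ‖radialDeriv (radialDeriv h) z * g z + radialDeriv h z * radialDeriv g z‖
      ≤ Bμ * (‖radialDeriv (radialDeriv h) z‖ * ‖g z‖ +
        ‖radialDeriv h z‖ * ‖radialDeriv g z‖) := by
        refine mul_le_mul ((le_abs_self _).trans (hBμ _ ⟨hz0, hz⟩)) ?_ (norm_nonneg _) hBμ0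
        refine (norm_add_le _ _).trans ?_
        rw [norm_mul, norm_mul]
    _ ≤ Bμ * (8 * ε / (1 - s) ^ 2 * B₀ + 4 * ε / (1 - s) * B₁) := by
        have h3 := hR z (by linarith)
        have h4 := hgB z hz
        have h5 := hRgB z hz
        gcongr
    _ = Q / (Q + 1) * η := by rw [hQ, hεdef]; ring
    _ ≤ η := mul_le_of_le_one_left hη.le ((div_le_one (by positivity)).2 (by linarith))

theorem exists_essNorm_le (hn : 1 ≤ n) {p q : ℝ} (hp : 0 < p) (hq : 0 < q) {φ : ℝ → ℝ}
    (hφ : IsNormalFun φ) :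
    ∃ C : ℝ≥0, ∀ (μ : ℝ → ℝ) (_ : IsWeight μ) (g : Cn n → ℂ) (_ : g ∈ holBall n)
      (_ : IsBoundedOp hp hq hφ μ (rsOperator g)),
      essNorm hp hq hφ μ (rsOperator g) ≤ C * max
          (limsupBoundary fun z : Cn n =>
            μ ‖z‖ * ‖g z‖ / (φ ‖z‖ * (1 - ‖z‖ ^ 2) ^ (2 + n / q)))
          (limsupBoundary fun z : Cn n =>
            μ ‖z‖ * ‖radialDeriv g z‖ / (φ ‖z‖ * (1 - ‖z‖ ^ 2) ^ (1 + n / q))) := by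
  obtain ⟨C₁, hC₁, hpt⟩ := exists_enorm_le_mixedNorm hn hp hq hφ
  obtain ⟨D, hD, hWD⟩ := exists_growthWeight_doubling hφ n q
  set A := C₁.toReal + 1 with hA
  have hA0 : 0 < A := by positivity
  -- The near-boundary constant for a function dominated by 3A times the growth weight, as f - P_f
  -- is.
  set E : ℝ := (3 * A) * (8 * D ^ 2 * 2 ^ (2 + n / q : ℝ) + 2 * D * 2 ^ (1 + n / q : ℝ)) with hE
  have hE0 : 0 < E := by positivity
  refine ⟨E.toNNReal, fun μ hμ g hg hb => ?_⟩
  refine le_of_forall_gt_imp_ge_of_dense fun a ha => ?_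
  have hEt : (E.toNNReal : ℝ≥0∞) ≠ ∞ := ENNReal.coe_ne_top
  have hE0' : (E.toNNReal : ℝ≥0∞) ≠ 0 := by simpa using hE0
  rw [mul_comm, ← ENNReal.lt_div_iff_mul_lt (Or.inl hE0') (Or.inl hEt)] at ha
  obtain ⟨m, hm, hma⟩ := ENNReal.lt_iff_exists_nnreal_btwn.1 ha
  have hm0 : 0 < (m : ℝ) := by exact_mod_cast zero_le.trans_lt hm
  obtain ⟨s₁, hs₁, hF₁⟩ := exists_lt_of_limsupBoundary_lt ((le_max_left _ _).trans_lt hm)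
  obtain ⟨s₂, hs₂, hF₂⟩ := exists_lt_of_limsupBoundary_lt ((le_max_right _ _).trans_lt hm)
  refine le_trans ?_ ((ENNReal.lt_div_iff_mul_lt (Or.inl hE0') (Or.inl hEt)).1 hma).le
  set s := max 0 (max s₁ s₂) with hs
  have hs0 : 0 ≤ s := le_max_left _ _
  have hs1 : s < 1 := max_lt zero_lt_one (max_lt hs₁ hs₂)
  have hEm : 0 < m * E := mul_pos hm0 hE0
  -- The tolerance on the compact part is the bound m E that holds near the boundary; r and N depend
  -- on it, but not on f.
  obtain ⟨ε, hε, hsmall⟩ := exists_weight_mul_norm_le_of_small hμ hg.1 hs0 hs1 hEm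
  obtain ⟨r, N, hr, hr1, happ⟩ := exists_polyFun_approx (n := n) hq hφ hA0
    (s := (3 + s) / 4) (by linarith) (by linarith) hε
  refine iInf₂_le_of_le (taylorOp hg hb r N) (isCompactOp_taylorOp hn hg hb hr hr1 N)
    (iSup₂_le fun f hf => ?_)
  have hfA : ∀ z ∈ unitBall n, ‖(f : Cn n → ℂ) z‖ ≤ A * growthWeight n q φ ‖z‖ := fun z hz => by
    have hW := growthWeight_pos hφ n q ⟨norm_nonneg z, mem_ball_zero_iff.1 hz⟩
    rw [← ENNReal.ofReal_le_ofReal_iff (by positivity), ofReal_norm, ENNReal.ofReal_mul hA0.le]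
    refine (hpt _ f.2.1.1 z hz).trans ?_
    calc _ ≤ C₁ * ENNReal.ofReal (growthWeight n q φ ‖z‖) * 1 := by gcongr
      _ = ENNReal.ofReal C₁.toReal * ENNReal.ofReal (growthWeight n q φ ‖z‖) := by
        rw [mul_one, ENNReal.ofReal_toReal hC₁]
      _ ≤ _ := by gcongr; linarith
  set P : Cn n → ℂ := polyFun (taylorCoeff r N (f : Cn n → ℂ)) with hP
  have hPmem : P ∈ mixedNormSpace n hp hq hφ := polyFun_mem hp hq hφ _
  set h : Cn n → ℂ := (f : Cn n → ℂ) - P with hh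
  have hhmem : h ∈ mixedNormSpace n hp hq hφ := sub_mem f.2 hPmem
  have e : rsOperator g f - (taylorOp hg hb r N f : Cn n → ℂ) = rsOperator g h :=
    (rsOperator_sub f.2.1.1 hPmem.1.1 hg.1).symm
  obtain ⟨hh1, hh2⟩ := happ f f.2.1.1 hfA
  rw [e, zygmundNorm, rsOperator_zero, enorm_zero, zero_add]
  refine iSup₂_le fun z hz => ?_
  have hμz := hμ.pos ‖z‖ ⟨norm_nonneg z, mem_ball_zero_iff.1 hz⟩
  rw [radialDeriv_radialDeriv_rsOperator hhmem.1.1 hg.1 (hb.1 _ hhmem).1.1 hz, ← ofReal_norm,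
    ← ENNReal.ofReal_mul hμz.le, ← ENNReal.ofReal_coe_nnreal, ← ENNReal.ofReal_coe_nnreal,
    ← ENNReal.ofReal_mul hm0.le, Real.coe_toNNReal _ hE0.le]
  refine ENNReal.ofReal_le_ofReal ?_
  rcases le_or_gt ‖z‖ s with hzs | hzs
  · exact hsmall h hhmem.1.1 hh2 z hzs
  · rw [mul_comm, mul_comm (m : ℝ), mul_comm (‖_‖)]
    exact weight_mul_norm_le_near hq hφ hμ hD (by positivity) hWD hhmem.1.1 hh1 hz
      (hF₁ z hz (((le_max_left _ _).trans (le_max_right _ _)).trans_lt hzs))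
      (hF₂ z hz (((le_max_right _ _).trans (le_max_right _ _)).trans_lt hzs))

/-- Test functions for both boundary quantities, with uniformly bounded norms. -/
theorem exists_isTestFunction (hn : 1 ≤ n) {p q : ℝ} (hp : 0 < p) (hq : 0 < q) {φ : ℝ → ℝ}
    (hφ : IsNormalFun φ) :
    ∃ C : ℝ≥0∞, C ≠ ∞ ∧ ∀ (μ : ℝ → ℝ) (_ : IsWeight μ) (g : Cn n → ℂ), ∀ w ∈ unitBall n,
      1 / 2 ≤ ‖w‖ →
      (∃ f, IsTestFunction hp hq hφ μ g C (fun z : Cn n =>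
        μ ‖z‖ * ‖g z‖ / (φ ‖z‖ * (1 - ‖z‖ ^ 2) ^ (2 + n / q))) w f) ∧
      ∃ f, IsTestFunction hp hq hφ μ g C (fun z : Cn n =>
        μ ‖z‖ * ‖radialDeriv g z‖ / (φ ‖z‖ * (1 - ‖z‖ ^ 2) ^ (1 + n / q))) w f := by
  obtain ⟨s, hs, htest⟩ := exists_test_function hn hp hq hφ
  obtain ⟨C, hC, hf⟩ := htest (2 + s) (by positivity)
  refine ⟨C, hC, fun μ hμ g w hw hw2 => ?_⟩
  have hw1 := hw
  rw [mem_ball_zero_iff] at hw1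
  have hφw := hφ.pos ‖w‖ ⟨norm_nonneg w, hw1⟩
  have hμw := hμ.pos ‖w‖ ⟨norm_nonneg w, hw1⟩
  have hU : 1 / 4 ≤ ‖w‖ ^ 2 := by nlinarith
  have hU1 : 0 < 1 - ‖w‖ ^ 2 := by nlinarith
  constructor
  · obtain ⟨f, hmem, hbd, hle, hR, hR2⟩ := hf w hw 0 1 (by simp) (by rw [abs_one]; linarith)
    refine ⟨f, hmem, hbd, hle, ?_⟩
    rw [hR, hR2]
    set U := ‖w‖ ^ 2 with hUdef
    set T := (φ ‖w‖ * (1 - U) ^ (2 + n / q : ℝ))⁻¹ with hT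
    have hT0 : 0 < T := by positivity
    have h0 : 0 ≤ μ ‖w‖ * ‖g w‖ * T := by positivity
    simp only [zero_mul, mul_zero, zero_add, Complex.ofReal_zero, add_zero, mul_one]
    rw [norm_mul, Complex.norm_real, Real.norm_of_nonneg (by positivity), div_eq_mul_inv, ← hT]
    -- Here ℛf(w) = 0 and ℛ²f(w) = 2U²T. Since U ≥ 1/4 gives 16U² ≥ 1, the constant 8 suffices.
    calc μ ‖w‖ * ‖g w‖ * T = 16 * (1 / 4 * (1 / 4)) * (μ ‖w‖ * ‖g w‖ * T) := by ring
      _ ≤ 16 * (U * U) * (μ ‖w‖ * ‖g w‖ * T) := by gcongr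
      _ = _ := by ring
  -- This B solves (1-U) + U(2B + 2s) = 0, which makes ℛ²f(w) vanish when A = 1; it stays bounded
  -- because |w| ≥ 1/2.
  · have hB : |-((1 - ‖w‖ ^ 2) / (2 * ‖w‖ ^ 2)) - s| ≤ 2 + s := by
      have h1 : (1 - ‖w‖ ^ 2) / (2 * ‖w‖ ^ 2) ≤ 2 := by
        rw [div_le_iff₀ (by positivity)]; linarith
      have h2 : 0 ≤ (1 - ‖w‖ ^ 2) / (2 * ‖w‖ ^ 2) := by positivity
      rw [abs_le]
      constructor <;> linarith
    obtain ⟨f, hmem, hbd, hle, hR, hR2⟩ := hf w hw 1 _ (by simp) hB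
    refine ⟨f, hmem, hbd, hle, ?_⟩
    have hR0 : radialDeriv (radialDeriv f) w = 0 := by
      rw [hR2, Complex.ofReal_eq_zero]
      have : ‖w‖ ≠ 0 := by linarith
      field_simp
      ring
    rw [hR, hR0]
    set U := ‖w‖ ^ 2 with hUdef
    have hpow : (1 - U) ^ (2 + n / q : ℝ) = (1 - U) * (1 - U) ^ (1 + n / q : ℝ) := by
      rw [show (2 + n / q : ℝ) = 1 + (1 + n / q) by ring, Real.rpow_add hU1, Real.rpow_one]
    set V := (1 - U) ^ (1 + n / q : ℝ) with hV
    have hV0 : 0 < V := by positivity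
    have h0 : 0 ≤ μ ‖w‖ * ‖radialDeriv g w‖ / (φ ‖w‖ * V) := by positivity
    rw [zero_mul, zero_add, norm_mul, Complex.norm_real, hpow,
      Real.norm_of_nonneg (by positivity)]
    calc μ ‖w‖ * ‖radialDeriv g w‖ / (φ ‖w‖ * V)
        ≤ 8 * U * (μ ‖w‖ * ‖radialDeriv g w‖ / (φ ‖w‖ * V)) :=
          le_mul_of_one_le_left h0 (by linarith)
      _ = _ := by field_simp

end

end

theorem mainTheorem2 (n : ℕ) (hn : 1 ≤ n) (p q : ℝ) (hp : 0 < p) (hq : 0 < q)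
    (φ : ℝ → ℝ) (hφ : IsNormalFun φ) :
    ∃ C : ℝ≥0, 0 < C ∧ ∀ (μ : ℝ → ℝ) (_ : IsWeight μ) (g : Cn n → ℂ) (_ : g ∈ holBall n)
      (_ : IsBoundedOp hp hq hφ μ (rsOperator g)),
      essNorm hp hq hφ μ (rsOperator g) ≤ C * max
          (limsupBoundary fun z : Cn n =>
            μ ‖z‖ * ‖g z‖ / (φ ‖z‖ * (1 - ‖z‖ ^ 2) ^ (2 + n / q)))
          (limsupBoundary fun z : Cn n =>
            μ ‖z‖ * ‖radialDeriv g z‖ / (φ ‖z‖ * (1 - ‖z‖ ^ 2) ^ (1 + n / q))) ∧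
      max (limsupBoundary fun z : Cn n =>
            μ ‖z‖ * ‖g z‖ / (φ ‖z‖ * (1 - ‖z‖ ^ 2) ^ (2 + n / q)))
          (limsupBoundary fun z : Cn n =>
            μ ‖z‖ * ‖radialDeriv g z‖ / (φ ‖z‖ * (1 - ‖z‖ ^ 2) ^ (1 + n / q)))
        ≤ C * essNorm hp hq hφ μ (rsOperator g) := by
  obtain ⟨E, hE⟩ := exists_essNorm_le hn hp hq hφ
  obtain ⟨C, hC, htest⟩ := exists_isTestFunction hn hp hq hφ
  obtain ⟨c, hc, hsub⟩ := exists_mixedNorm_sub_le (n := n) hp hq hφ hC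
  refine ⟨E + 8 * c, by positivity, fun μ hμ g hg hb => ⟨?_, ?_⟩⟩
  · refine (hE μ hμ g hg hb).trans (mul_le_mul_left ?_ _)
    exact_mod_cast le_self_add
  -- Both quotients must be bounded before either limit is estimated, since the vanishing of
  -- μ|ℛ²(L_g f_j)| uses both.
  · obtain ⟨K₁, hK₁, hF₁⟩ := exists_bound_of_isTestFunction hμ hg hb hC
      fun w hw hw2 => (htest μ hμ g w hw hw2).1
    obtain ⟨K₂, hK₂, hF₂⟩ := exists_bound_of_isTestFunction hμ hg hb hC
      fun w hw hw2 => (htest μ hμ g w hw hw2).2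
    have hle : (8 * c : ℝ≥0∞) * essNorm hp hq hφ μ (rsOperator g) ≤
        (E + 8 * c : ℝ≥0) * essNorm hp hq hφ μ (rsOperator g) := by
      refine mul_le_mul_left ?_ _
      push_cast
      exact le_add_self
    have hK1 := fun z hz hz2 => (hF₁ z hz hz2).trans (le_max_left K₁ K₂)
    have hK2 := fun z hz hz2 => (hF₂ z hz hz2).trans (le_max_right K₁ K₂)
    refine max_le (le_trans ?_ hle) (le_trans ?_ hle)
    · exact limsupBoundary_le_mul_essNorm hμ hg hb hc hsub hC (hK₁.trans (le_max_left _ _))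
        hK1 hK2 fun w hw hw2 => (htest μ hμ g w hw hw2).1
    · exact limsupBoundary_le_mul_essNorm hμ hg hb hc hsub hC (hK₁.trans (le_max_left _ _))
        hK1 hK2 fun w hw hw2 => (htest μ hμ g w hw hw2).2
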